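/- **Conventions.** Fix integers $\Lambda,\Lambda_F\ge 1$; all vector spaces are over $\mathbb C$ and everything is bosonic (no sign factors). $I,J,K,L$ (with or without indices) denote non-empty finite sequences, and $\dot I,\dot J,\dot K,\dot L$ denote finite sequences that may be empty, of integers in $\{1,\dots,\Lambda\}$; juxtaposition is concatenation, and sums such as $\sum_{K_1K_2=K}$ or $\sum_{\dot K_1K_2\dot K_3=\dot K}$ run over all ways of cutting a sequence into pieces that are non-empty when undotted. $\delta^K_J$ is $1$ if $K=J$ and $0$ otherwise. All $\lambda_i,\rho_i$ lie in $\{1,\dots,\Lambda_F\}$. **The space.** Let $\mathcal G$ be the vector space with basis the symbols $\bar\Xi^{\lambda_1}_{\lambda_2}\otimes f^{\dot I}_{\dot J}\otimes\Xi^{\lambda_3}_{\lambda_4}$ (first kind), $\bar\Xi^{\lambda_1}_{\lambda_2}\otimes l^{\dot I}_{\dot J}$ (second kind), $r^{\dot I}_{\dot J}\otimes\Xi^{\lambda_3}_{\lambda_4}$ (third kind), $\gamma^I_J$ (fourth kind) and $\tilde f^I_J$ (fifth kind), where in $\tilde f^I_J$ the sequences $I$ and $J$ are taken up to cyclic rotation,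 i.e. $\tilde f^{I_1I_2}_J=\tilde f^{I_2I_1}_J$ and $\tilde f^I_{J_1J_2}=\tilde f^I_{J_2J_1}$. An operator of the $n$-th kind is a linear combination of basis elements of the $n$-th kind. **(A) The grand string algebra.** There is exactly one alternating bilinear bracket on $\mathcal G$ with the following values (for all values of the indices), and it is a Lie bracket. The bracket of an operator of the first, second or third kind with one of the fifth kind is $0$, and $$[\bar\Xi^{\lambda_1}_{\lambda_2}\otimes f^{\dot I}_{\dot J}\otimes\Xi^{\lambda_3}_{\lambda_4},\bar\Xi^{\lambda_5}_{\lambda_6}\otimes f^{\dot K}_{\dot L}\otimes\Xi^{\lambda_7}_{\lambda_8}]=\delta^{\lambda_5}_{\lambda_2}\delta^{\dot K}_{\dot J}\delta^{\lambda_7}_{\lambda_4}\bar\Xi^{\lambda_1}_{\lambda_6}\otimes f^{\dot I}_{\dot L}\otimes\Xi^{\lambda_3}_{\lambda_8}-\delta^{\lambda_1}_{\lambda_6}\delta^{\dot I}_{\dot L}\delta^{\lambda_3}_{\lambda_8}\bar\Xi^{\lambda_5}_{\lambda_2}\otimes f^{\dot K}_{\dot J}\otimes\Xi^{\lambda_7}_{\lambda_4};$$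 $$[\bar\Xi^{\lambda_1}_{\lambda_2}\otimes f^{\dot I}_{\dot J}\otimes\Xi^{\lambda_3}_{\lambda_4},\bar\Xi^{\lambda_5}_{\lambda_6}\otimes l^{\dot K}_{\dot L}]=\delta^{\lambda_5}_{\lambda_2}\sum_{\dot J_1\dot J_2=\dot J}\delta^{\dot K}_{\dot J_1}\bar\Xi^{\lambda_1}_{\lambda_6}\otimes f^{\dot I}_{\dot L\dot J_2}\otimes\Xi^{\lambda_3}_{\lambda_4}-\delta^{\lambda_1}_{\lambda_6}\sum_{\dot I_1\dot I_2=\dot I}\delta^{\dot I_1}_{\dot L}\bar\Xi^{\lambda_5}_{\lambda_2}\otimes f^{\dot K\dot I_2}_{\dot J}\otimes\Xi^{\lambda_3}_{\lambda_4};$$ $$[\bar\Xi^{\lambda_1}_{\lambda_2}\otimes f^{\dot I}_{\dot J}\otimes\Xi^{\lambda_3}_{\lambda_4},r^{\dot K}_{\dot L}\otimes\Xi^{\lambda_5}_{\lambda_6}]=\delta^{\lambda_5}_{\lambda_4}\sum_{\dot J_1\dot J_2=\dot J}\delta^{\dot K}_{\dot J_2}\bar\Xi^{\lambda_1}_{\lambda_2}\otimes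 f^{\dot I}_{\dot J_1\dot L}\otimes\Xi^{\lambda_3}_{\lambda_6}-\delta^{\lambda_3}_{\lambda_6}\sum_{\dot I_1\dot I_2=\dot I}\delta^{\dot I_2}_{\dot L}\bar\Xi^{\lambda_1}_{\lambda_2}\otimes f^{\dot I_1\dot K}_{\dot J}\otimes\Xi^{\lambda_5}_{\lambda_4};$$ $$[\bar\Xi^{\lambda_1}_{\lambda_2}\otimes f^{\dot I}_{\dot J}\otimes\Xi^{\lambda_3}_{\lambda_4},\gamma^K_L]=\bar\Xi^{\lambda_1}_{\lambda_2}\otimes\Big(\sum_{\dot J_1J_2\dot J_3=\dot J}\delta^K_{J_2}f^{\dot I}_{\dot J_1L\dot J_3}-\sum_{\dot I_1I_2\dot I_3=\dot I}\delta^{I_2}_Lf^{\dot I_1K\dot I_3}_{\dot J}\Big)\otimes\Xi^{\lambda_3}_{\lambda_4};$$ $$[\bar\Xi^{\lambda_1}_{\lambda_2}\otimes l^{\dot I}_{\dot J},\bar\Xi^{\lambda_3}_{\lambda_4}\otimes l^{\dot K}_{\dot L}]=\delta^{\lambda_3}_{\lambda_2}\bar\Xi^{\lambda_1}_{\lambda_4}\otimes\Big(\delta^{\dot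 K}_{\dot J}l^{\dot I}_{\dot L}+\sum_{\dot J_1J_2=\dot J}\delta^{\dot K}_{\dot J_1}l^{\dot I}_{\dot LJ_2}+\sum_{\dot K_1K_2=\dot K}\delta^{\dot K_1}_{\dot J}l^{\dot IK_2}_{\dot L}\Big)-\delta^{\lambda_1}_{\lambda_4}\bar\Xi^{\lambda_3}_{\lambda_2}\otimes\Big(\delta^{\dot I}_{\dot L}l^{\dot K}_{\dot J}+\sum_{\dot L_1L_2=\dot L}\delta^{\dot I}_{\dot L_1}l^{\dot K}_{\dot JL_2}+\sum_{\dot I_1I_2=\dot I}\delta^{\dot I_1}_{\dot L}l^{\dot KI_2}_{\dot J}\Big);$$ $$[r^{\dot I}_{\dot J}\otimes\Xi^{\lambda_1}_{\lambda_2},r^{\dot K}_{\dot L}\otimes\Xi^{\lambda_3}_{\lambda_4}]=\delta^{\lambda_3}_{\lambda_2}\Big(\delta^{\dot K}_{\dot J}r^{\dot I}_{\dot L}+\sum_{J_1\dot J_2=\dot J}\delta^{\dot K}_{\dot J_2}r^{\dot I}_{J_1\dot L}+\sum_{K_1\dot K_2=\dot K}\delta^{\dot K_2}_{\dot J}r^{K_1\dot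 I}_{\dot L}\Big)\otimes\Xi^{\lambda_1}_{\lambda_4}-\delta^{\lambda_1}_{\lambda_4}\Big(\delta^{\dot I}_{\dot L}r^{\dot K}_{\dot J}+\sum_{L_1\dot L_2=\dot L}\delta^{\dot I}_{\dot L_2}r^{\dot K}_{L_1\dot J}+\sum_{I_1\dot I_2=\dot I}\delta^{\dot I_2}_{\dot L}r^{I_1\dot K}_{\dot J}\Big)\otimes\Xi^{\lambda_3}_{\lambda_2};$$ $$[\bar\Xi^{\lambda_1}_{\lambda_2}\otimes l^{\dot I}_{\dot J},r^{\dot K}_{\dot L}\otimes\Xi^{\lambda_3}_{\lambda_4}]=\bar\Xi^{\lambda_1}_{\lambda_2}\otimes\Big(\sum_{\dot J_1\dot J_2=\dot J,\ \dot K_1\dot K_2=\dot K}\delta^{\dot K_1}_{\dot J_2}f^{\dot I\dot K_2}_{\dot J_1\dot L}-\sum_{\dot I_1\dot I_2=\dot I,\ \dot L_1\dot L_2=\dot L}\delta^{\dot I_2}_{\dot L_1}f^{\dot I_1\dot K}_{\dot J\dot L_2}\Big)\otimes\Xi^{\lambda_3}_{\lambda_4};$$ $$\begin{aligned}[]&[\bar\Xi^{\lambda_1}_{\lambda_2}\otimes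 l^{\dot I}_{\dot J},\gamma^K_L]=\bar\Xi^{\lambda_1}_{\lambda_2}\otimes\Big(\delta^K_{\dot J}l^{\dot I}_L+\sum_{K_1K_2=K}\delta^{K_1}_{\dot J}l^{\dot IK_2}_L+\sum_{J_1J_2=\dot J}\delta^K_{J_2}l^{\dot I}_{J_1L}+\sum_{J_1J_2=\dot J}\delta^K_{J_1}l^{\dot I}_{LJ_2}+\sum_{J_1J_2=\dot J,\,K_1K_2=K}\delta^{K_1}_{J_2}l^{\dot IK_2}_{J_1L}+\sum_{J_1J_2J_3=\dot J}\delta^K_{J_2}l^{\dot I}_{J_1LJ_3}\\&-\delta^{\dot I}_Ll^K_{\dot J}-\sum_{L_1L_2=L}\delta^{\dot I}_{L_1}l^K_{\dot JL_2}-\sum_{I_1I_2=\dot I}\delta^{I_2}_Ll^{I_1K}_{\dot J}-\sum_{I_1I_2=\dot I}\delta^{I_1}_Ll^{KI_2}_{\dot J}-\sum_{L_1L_2=L,\,I_1I_2=\dot I}\delta^{I_2}_{L_1}l^{I_1K}_{\dot JL_2}-\sum_{I_1I_2I_3=\dot I}\delta^{I_2}_Ll^{I_1KI_3}_{\dot J}\Big);\end{aligned}$$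 $$\begin{aligned}[]&[r^{\dot I}_{\dot J}\otimes\Xi^{\lambda_1}_{\lambda_2},\gamma^K_L]=\Big(\delta^K_{\dot J}r^{\dot I}_L+\sum_{K_1K_2=K}\delta^{K_2}_{\dot J}r^{K_1\dot I}_L+\sum_{J_1J_2=\dot J}\delta^K_{J_2}r^{\dot I}_{J_1L}+\sum_{J_1J_2=\dot J}\delta^K_{J_1}r^{\dot I}_{LJ_2}+\sum_{J_1J_2=\dot J,\,K_1K_2=K}\delta^{K_2}_{J_1}r^{K_1\dot I}_{LJ_2}+\sum_{J_1J_2J_3=\dot J}\delta^K_{J_2}r^{\dot I}_{J_1LJ_3}\\&-\delta^{\dot I}_Lr^K_{\dot J}-\sum_{L_1L_2=L}\delta^{\dot I}_{L_2}r^K_{L_1\dot J}-\sum_{I_1I_2=\dot I}\delta^{I_2}_Lr^{I_1K}_{\dot J}-\sum_{I_1I_2=\dot I}\delta^{I_1}_Lr^{KI_2}_{\dot J}-\sum_{L_1L_2=L,\,I_1I_2=\dot I}\delta^{I_1}_{L_2}r^{KI_2}_{L_1\dot J}-\sum_{I_1I_2I_3=\dot I}\delta^{I_2}_Lr^{I_1KI_3}_{\dot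 J}\Big)\otimes\Xi^{\lambda_1}_{\lambda_2};\end{aligned}$$ $$[\tilde f^I_J,\tilde f^K_L]=\delta^K_J\tilde f^I_L+\sum_{K_1K_2=K}\delta^{K_2K_1}_J\tilde f^I_L-(I\leftrightarrow K,J\leftrightarrow L);\tag{1}$$ $$\begin{aligned}[]&[\gamma^I_J,\tilde f^K_L]=\Big\{\delta^K_J\tilde f^I_L+\sum_{K_1K_2=K}\delta^{K_2K_1}_J\tilde f^I_L+\sum_{K_1K_2=K}\delta^{K_1}_J\tilde f^{IK_2}_L+\sum_{K_1K_2K_3=K}\delta^{K_2}_J\tilde f^{K_1IK_3}_L+\sum_{K_1K_2=K}\delta^{K_2}_J\tilde f^{K_1I}_L+\sum_{K_1K_2K_3=K}\delta^{K_3K_1}_J\tilde f^{IK_2}_L\Big\}\\&-\Big\{\delta^I_L\tilde f^K_J+\sum_{L_1L_2=L}\delta^I_{L_2L_1}\tilde f^K_J+\sum_{L_1L_2=L}\delta^I_{L_2}\tilde f^K_{L_1J}+\sum_{L_1L_2L_3=L}\delta^I_{L_2}\tilde f^K_{L_1JL_3}+\sum_{L_1L_2=L}\delta^I_{L_1}\tilde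 f^K_{JL_2}+\sum_{L_1L_2L_3=L}\delta^I_{L_3L_1}\tilde f^K_{JL_2}\Big\};\end{aligned}\tag{2}$$ $$\begin{aligned}[]&[\gamma^I_J,\gamma^K_L]=\delta^K_J\gamma^I_L+\sum_{J_1J_2=J}\delta^K_{J_2}\gamma^I_{J_1L}+\sum_{K_1K_2=K}\delta^{K_1}_J\gamma^{IK_2}_L+\sum_{J_1J_2=J,\,K_1K_2=K}\delta^{K_1}_{J_2}\gamma^{IK_2}_{J_1L}+\sum_{J_1J_2=J}\delta^K_{J_1}\gamma^I_{LJ_2}+\sum_{K_1K_2=K}\delta^{K_2}_J\gamma^{K_1I}_L\\&+\sum_{J_1J_2=J,\,K_1K_2=K}\delta^{K_2}_{J_1}\gamma^{K_1I}_{LJ_2}+\sum_{J_1J_2J_3=J}\delta^K_{J_2}\gamma^I_{J_1LJ_3}+\sum_{K_1K_2K_3=K}\delta^{K_2}_J\gamma^{K_1IK_3}_L+\sum_{J_1J_2=J,\,K_1K_2=K}\delta^{K_1}_{J_2}\delta^{K_2}_{J_1}\tilde f^I_L\\&+\sum_{J_1J_2J_3=J,\,K_1K_2=K}\delta^{K_1}_{J_3}\delta^{K_2}_{J_1}\tilde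 f^I_{J_2L}+\sum_{J_1J_2=J,\,K_1K_2K_3=K}\delta^{K_1}_{J_2}\delta^{K_3}_{J_1}\tilde f^{IK_2}_L+\sum_{J_1J_2J_3=J,\,K_1K_2K_3=K}\delta^{K_1}_{J_3}\delta^{K_3}_{J_1}\tilde f^{IK_2}_{J_2L}-(I\leftrightarrow K,J\leftrightarrow L).\end{aligned}\tag{3}$$ In the resulting Lie algebra $\mathcal G$ (the *grand string algebra*) the operators of the first kind, those of the first three kinds together, and those of the fifth kind each form a proper ideal, and the operators of the second kind and those of the third kind each form a subalgebra. **(B) The heterix algebra.** Let $\mathcal H$ be the vector space with basis $\gamma'^I_J$ and $\tilde f'^I_J$, where now $I,J$ are non-empty sequences of integers in $\{1,\dots,\Lambda+2\Lambda_F\}$, taken up to cyclic rotation in $\tilde f'^I_J$. There is exactly one alternating bilinear bracket on $\mathcal H$ satisfying (1)–(3) with primes added, and it is a Lie bracket; $\mathcal H$ is the *heterix algebra*. Let $\mathcal T'_o$ have basis $s'^{\dot K}$ and $\mathcal T'_c$ have basis $\Psi'^K$ ($K$ non-empty, up to cyclic rotation), with integers in $\{1,\dots,\Lambda+2\Lambda_F\}$.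 The formulas $$\tilde f'^I_Js'^{\dot K}=0,\qquad \gamma'^I_Js'^{\dot K}=\sum_{\dot K_1K_2\dot K_3=\dot K}\delta^{K_2}_Js'^{\dot K_1I\dot K_3},\qquad \tilde f'^I_J\Psi'^K=\delta^K_J\Psi'^I+\sum_{J_1J_2=J}\delta^K_{J_2J_1}\Psi'^I,$$ $$\gamma'^I_J\Psi'^K=\delta^K_J\Psi'^I+\sum_{K_1K_2=K}\big(\delta^{K_2K_1}_J\Psi'^I+\delta^{K_1}_J\Psi'^{IK_2}+\delta^{K_2}_J\Psi'^{IK_1}\big)+\sum_{K_1K_2K_3=K}\delta^{K_2}_J\Psi'^{IK_3K_1}+\sum_{J_1J_2=J}\ \sum_{K_1K_2K_3=K}\delta^{K_3}_{J_1}\delta^{K_1}_{J_2}\Psi'^{IK_2}$$ define a representation of $\mathcal H$ on each of $\mathcal T'_o$ and $\mathcal T'_c$, and $\mathcal T'_o\oplus\mathcal T'_c$ is faithful. **(C) Realisation.** In $\mathcal H$ put $$l'^I_J=\gamma'^I_J-\sum_{i=1}^{\Lambda+2\Lambda_F}\gamma'^{iI}_{iJ}-\tilde f'^I_J,\qquad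 r'^I_J=\gamma'^I_J-\sum_{j=1}^{\Lambda+2\Lambda_F}\gamma'^{Ij}_{Jj}-\tilde f'^I_J,\qquad f'^I_J=l'^I_J-\sum_{j=1}^{\Lambda+2\Lambda_F}l'^{Ij}_{Jj}.$$ The linear map $\iota:\mathcal G\to\mathcal H$ given by $\gamma^I_J\mapsto\gamma'^I_J$, $\tilde f^I_J\mapsto\tilde f'^I_J$, $\bar\Xi^{\lambda_1}_{\lambda_2}\otimes l^{\dot I}_{\dot J}\mapsto l'^{\lambda_1+\Lambda,\dot I}_{\lambda_2+\Lambda,\dot J}$, $r^{\dot I}_{\dot J}\otimes\Xi^{\lambda_3}_{\lambda_4}\mapsto r'^{\dot I,\lambda_3+\Lambda+\Lambda_F}_{\dot J,\lambda_4+\Lambda+\Lambda_F}$, $\bar\Xi^{\lambda_1}_{\lambda_2}\otimes f^{\dot I}_{\dot J}\otimes\Xi^{\lambda_3}_{\lambda_4}\mapsto f'^{\lambda_1+\Lambda,\dot I,\lambda_3+\Lambda+\Lambda_F}_{\lambda_2+\Lambda,\dot J,\lambda_4+\Lambda+\Lambda_F}$ is an injective homomorphism of Lie algebras, so $\mathcal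 G$ is a subalgebra of $\mathcal H$. **(D) Representation.** Let $\mathcal T_o$ have basis $\bar\phi^{\rho_1}\otimes s^{\dot K}\otimes\phi^{\rho_2}$ and $\mathcal T_c$ have basis $\Psi^K$ ($K$ non-empty, up to cyclic rotation). Then $\mathcal G$ acts on $\mathcal T_o\oplus\mathcal T_c$, preserving both (non-zero) summands, so that this representation is reducible, by the following formulas. On $\mathcal T_o$: $$\bar\Xi^{\lambda_1}_{\lambda_2}\otimes f^{\dot I}_{\dot J}\otimes\Xi^{\lambda_3}_{\lambda_4}\,(\bar\phi^{\lambda_5}\otimes s^{\dot K}\otimes\phi^{\lambda_6})=\delta^{\lambda_5}_{\lambda_2}\delta^{\dot K}_{\dot J}\delta^{\lambda_6}_{\lambda_4}\,\bar\phi^{\lambda_1}\otimes s^{\dot I}\otimes\phi^{\lambda_3},$$ $$\bar\Xi^{\lambda_1}_{\lambda_2}\otimes l^{\dot I}_{\dot J}\,(\bar\phi^{\lambda_3}\otimes s^{\dot K}\otimes\phi^{\lambda_4})=\delta^{\lambda_3}_{\lambda_2}\sum_{\dot K_1\dot K_2=\dot K}\delta^{\dot K_1}_{\dot J}\,\bar\phi^{\lambda_1}\otimes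 s^{\dot I\dot K_2}\otimes\phi^{\lambda_4},$$ $$r^{\dot I}_{\dot J}\otimes\Xi^{\lambda_1}_{\lambda_2}\,(\bar\phi^{\lambda_3}\otimes s^{\dot K}\otimes\phi^{\lambda_4})=\delta^{\lambda_4}_{\lambda_2}\sum_{\dot K_1\dot K_2=\dot K}\delta^{\dot K_2}_{\dot J}\,\bar\phi^{\lambda_3}\otimes s^{\dot K_1\dot I}\otimes\phi^{\lambda_1},$$ $$\gamma^I_J\,(\bar\phi^{\lambda_1}\otimes s^{\dot K}\otimes\phi^{\lambda_2})=\sum_{\dot K_1K_2\dot K_3=\dot K}\delta^{K_2}_J\,\bar\phi^{\lambda_1}\otimes s^{\dot K_1I\dot K_3}\otimes\phi^{\lambda_2},$$ and $\tilde f^I_J$ acts by $0$; on $\mathcal T_c$ the first three kinds act by $0$, and $\gamma^I_J,\tilde f^I_J$ act by the formulas of (B) for $\gamma'^I_J\Psi'^K,\tilde f'^I_J\Psi'^K$ without the primes. The injections $\bar\phi^{\rho_1}\otimes s^{\dot K}\otimes\phi^{\rho_2}\mapsto s'^{\rho_1+\Lambda,\dot K,\rho_2+\Lambda+\Lambda_F}$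 and $\Psi^K\mapsto\Psi'^K$ intertwine these actions of $x\in\mathcal G$ with the actions of $\iota(x)\in\mathcal H$. **(E) Quotients.** The Lie algebra of operators by which $\mathcal G$ acts on $\mathcal T_o$ (the *open string algebra*), respectively on $\mathcal T_c$ (the *closed string* or *cyclix algebra*), is isomorphic to the quotient of $\mathcal G$ by the kernel of that action. Both kernels are non-zero; the first contains all operators of the fifth kind, and the second contains all operators of the first three kinds. On $\mathcal T_o$ one has $$\sum_\lambda\bar\Xi^\lambda_\lambda\otimes l^I_J=\gamma^I_J-\sum_{i=1}^\Lambda\gamma^{iI}_{iJ},\qquad\sum_\lambda r^I_J\otimes\Xi^\lambda_\lambda=\gamma^I_J-\sum_{j=1}^\Lambda\gamma^{Ij}_{Jj},$$ $$\sum_\lambda\bar\Xi^{\lambda_1}_{\lambda_2}\otimes f^{\dot I}_{\dot J}\otimes\Xi^\lambda_\lambda=\bar\Xi^{\lambda_1}_{\lambda_2}\otimes l^{\dot I}_{\dot J}-\sum_{j=1}^\Lambda\bar\Xi^{\lambda_1}_{\lambda_2}\otimes l^{\dot Ij}_{\dot Jj},\qquad\sum_\lambda\bar\Xi^\lambda_\lambda\otimes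 f^{\dot I}_{\dot J}\otimes\Xi^{\lambda_3}_{\lambda_4}=r^{\dot I}_{\dot J}\otimes\Xi^{\lambda_3}_{\lambda_4}-\sum_{i=1}^\Lambda r^{i\dot I}_{i\dot J}\otimes\Xi^{\lambda_3}_{\lambda_4},$$ and on $\mathcal T_c$ one has $\tilde f^I_J=\gamma^I_J-\sum_{k=1}^\Lambda\gamma^{Ik}_{Jk}=\gamma^I_J-\sum_{k=1}^\Lambda\gamma^{kI}_{kJ}$. -/

import Mathlib

open scoped BigOperators

-- The Lie bracket on `Module.End` is the commutator.
attribute [local instance] LieRing.ofAssociativeRing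

noncomputable section

namespace GrandString

/-! ### Integer sequences, splittings, Kronecker deltas

A (dotted) integer sequence is a list; an undotted sequence is a non-empty list. -/

/-- All `(K₁, K₂)` with `K₁ K₂ = K`, both possibly empty. -/
def split2 {A : Type*} [DecidableEq A] (K : List A) : Finset (List A × List A) :=
  (Finset.range (K.length + 1)).image fun k => (K.take k, K.drop k)

theorem mem_split2 {A : Type*} [DecidableEq A] {K : List A} {p : List A × List A} :
    p ∈ split2 K ↔ p.1 ++ p.2 = K := by
  obtain ⟨a, b⟩ := p
  simp only [split2, Finset.mem_image, Finset.mem_range, Prod.mk.injEq]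
  constructor
  · rintro ⟨k, -, rfl, rfl⟩
    exact List.take_append_drop k K
  · rintro rfl
    exact ⟨a.length, by simp, by simp, by simp⟩

/-- All `(K₁, K₂, K₃)` with `K₁ K₂ K₃ = K`, each possibly empty. -/
def split3 {A : Type*} [DecidableEq A] (K : List A) : Finset (List A × List A × List A) :=
  (split2 K).biUnion fun p => (split2 p.2).image fun q => (p.1, q.1, q.2)

theorem mem_split3 {A : Type*} [DecidableEq A] {K : List A} {t : List A × List A × List A} :
    t ∈ split3 K ↔ t.1 ++ t.2.1 ++ t.2.2 = K := by
  obtain ⟨a, b, c⟩ := t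
  simp only [split3, Finset.mem_biUnion, Finset.mem_image, mem_split2, Prod.mk.injEq]
  constructor
  · rintro ⟨p, hp, q, hq, rfl, rfl, rfl⟩
    rw [List.append_assoc, hq, hp]
  · intro h
    exact ⟨(a, b ++ c), by simpa using h, (b, c), rfl, rfl, rfl, rfl⟩

/-- All `(K₁, K₂)` with `K₁ K₂ = K`, both non-empty. -/
def nsplit2 {A : Type*} [DecidableEq A] (K : List A) : Finset (List A × List A) :=
  (split2 K).filter fun p => p.1 ≠ [] ∧ p.2 ≠ []

/-- All `(K₁, K₂, K₃)` with `K₁ K₂ K₃ = K`, each non-empty. -/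
def nsplit3 {A : Type*} [DecidableEq A] (K : List A) : Finset (List A × List A × List A) :=
  (split3 K).filter fun t => t.1 ≠ [] ∧ t.2.1 ≠ [] ∧ t.2.2 ≠ []

/-- The Kronecker delta. -/
def δ {α : Type*} [DecidableEq α] (a b : α) : ℂ := if a = b then 1 else 0

/-- Non-empty sequences. -/
abbrev Word (A : Type*) := {w : List A // w ≠ []}

/-- Non-empty sequences up to cyclic rotation. -/
abbrev CWord (A : Type*) := {c : Cycle A // c ≠ Cycle.nil}

/-- The class of a non-empty sequence up to cyclic rotation. -/
def CWord.mk {A : Type*} (w : List A) (h : w ≠ []) : CWord A :=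
  ⟨(w : Cycle A), fun h' => h ((Cycle.coe_eq_nil w).1 h')⟩

/-! ### A Lie algebra structure on a given complex vector space -/

/-- A complex Lie bracket on a vector space `V`. -/
structure LieStructure (V : Type*) [AddCommGroup V] [Module ℂ V] where
  /-- the bracket -/
  br : V →ₗ[ℂ] V →ₗ[ℂ] V
  br_self : ∀ x, br x x = 0
  jacobi : ∀ x y z, br x (br y z) = br (br x y) z + br y (br x z)

namespace LieStructure

variable {V : Type*} [AddCommGroup V] [Module ℂ V]

/-- The space `V`, regarded as a Lie algebra with the bracket `S.br`. -/
def Carrier (_S : LieStructure V) : Type _ := V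

instance (S : LieStructure V) : AddCommGroup S.Carrier := inferInstanceAs (AddCommGroup V)

instance (S : LieStructure V) : Module ℂ S.Carrier := inferInstanceAs (Module ℂ V)

/-- The identity map from `V` to the Lie algebra. -/
def of (S : LieStructure V) : V ≃ₗ[ℂ] S.Carrier := LinearEquiv.refl ℂ V

instance (S : LieStructure V) : LieRing S.Carrier where
  bracket x y := S.of (S.br (S.of.symm x) (S.of.symm y))
  add_lie x y z := by simp
  lie_add x y z := by simp
  lie_self x := by simp [S.br_self]
  leibniz_lie x y z := by simp [S.jacobi (S.of.symm x)]

instance (S : LieStructure V) : LieAlgebra ℂ S.Carrier where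
  lie_smul t x y := by simp [Bracket.bracket]

theorem of_br (S : LieStructure V) (x y : V) : S.of (S.br x y) = ⁅S.of x, S.of y⁆ := rfl

end LieStructure

/-! ### Brackets among operators of the fourth and fifth kinds

The right-hand sides, for families `γ` and `ft` (`f` with a tilde) of vectors in any space. Within
the sums, `p` is a splitting `J₁J₂(J₃) = J` and `q` is a splitting of `K` (or of `L`). -/

section RightHandSides

variable {A : Type*} [DecidableEq A] {V : Type*} [AddCommGroup V] [Module ℂ V]

/-- The bracket of two operators of the fifth kind is this minus `(I ↔ K, J ↔ L)`. -/
def ftFt (ft : List A → List A → V) (I J K L : List A) : V :=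
  δ K J • ft I L + ∑ q ∈ nsplit2 K, δ (q.2 ++ q.1) J • ft I L

/-- First brace in the bracket of an operator of the fourth with one of the fifth kind. -/
def gammaFtPlus (ft : List A → List A → V) (I J K L : List A) : V :=
  δ K J • ft I L
    + ∑ q ∈ nsplit2 K, δ (q.2 ++ q.1) J • ft I L
    + ∑ q ∈ nsplit2 K, δ q.1 J • ft (I ++ q.2) L
    + ∑ q ∈ nsplit3 K, δ q.2.1 J • ft (q.1 ++ I ++ q.2.2) L
    + ∑ q ∈ nsplit2 K, δ q.2 J • ft (q.1 ++ I) L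
    + ∑ q ∈ nsplit3 K, δ (q.2.2 ++ q.1) J • ft (I ++ q.2.1) L

/-- Second brace in the bracket of an operator of the fourth with one of the fifth kind. -/
def gammaFtMinus (ft : List A → List A → V) (I J K L : List A) : V :=
  δ I L • ft K J
    + ∑ q ∈ nsplit2 L, δ I (q.2 ++ q.1) • ft K J
    + ∑ q ∈ nsplit2 L, δ I q.2 • ft K (q.1 ++ J)
    + ∑ q ∈ nsplit3 L, δ I q.2.1 • ft K (q.1 ++ J ++ q.2.2)
    + ∑ q ∈ nsplit2 L, δ I q.1 • ft K (J ++ q.2)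
    + ∑ q ∈ nsplit3 L, δ I (q.2.2 ++ q.1) • ft K (J ++ q.2.1)

/-- The bracket of two operators of the fourth kind is this minus `(I ↔ K, J ↔ L)`. -/
def gammaGamma (γ ft : List A → List A → V) (I J K L : List A) : V :=
  δ K J • γ I L
    + ∑ p ∈ nsplit2 J, δ K p.2 • γ I (p.1 ++ L)
    + ∑ q ∈ nsplit2 K, δ q.1 J • γ (I ++ q.2) L
    + ∑ p ∈ nsplit2 J, ∑ q ∈ nsplit2 K, δ q.1 p.2 • γ (I ++ q.2) (p.1 ++ L)
    + ∑ p ∈ nsplit2 J, δ K p.1 • γ I (L ++ p.2)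
    + ∑ q ∈ nsplit2 K, δ q.2 J • γ (q.1 ++ I) L
    + ∑ p ∈ nsplit2 J, ∑ q ∈ nsplit2 K, δ q.2 p.1 • γ (q.1 ++ I) (L ++ p.2)
    + ∑ p ∈ nsplit3 J, δ K p.2.1 • γ I (p.1 ++ L ++ p.2.2)
    + ∑ q ∈ nsplit3 K, δ q.2.1 J • γ (q.1 ++ I ++ q.2.2) L
    + ∑ p ∈ nsplit2 J, ∑ q ∈ nsplit2 K, (δ q.1 p.2 * δ q.2 p.1) • ft I L
    + ∑ p ∈ nsplit3 J, ∑ q ∈ nsplit2 K, (δ q.1 p.2.2 * δ q.2 p.1) • ft I (p.2.1 ++ L)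
    + ∑ p ∈ nsplit2 J, ∑ q ∈ nsplit3 K, (δ q.1 p.2 * δ q.2.2 p.1) • ft (I ++ q.2.1) L
    + ∑ p ∈ nsplit3 J, ∑ q ∈ nsplit3 K,
        (δ q.1 p.2.2 * δ q.2.2 p.1) • ft (I ++ q.2.1) (p.2.1 ++ L)

/-- `B` has the prescribed values on operators of the fourth and fifth kinds. -/
structure ClosedBrackets (γ ft : List A → List A → V) (B : V →ₗ[ℂ] V →ₗ[ℂ] V) : Prop where
  ft_ft : ∀ I J K L : List A, I ≠ [] → J ≠ [] → K ≠ [] → L ≠ [] →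
    B (ft I J) (ft K L) = ftFt ft I J K L - ftFt ft K L I J
  gamma_ft : ∀ I J K L : List A, I ≠ [] → J ≠ [] → K ≠ [] → L ≠ [] →
    B (γ I J) (ft K L) = gammaFtPlus ft I J K L - gammaFtMinus ft I J K L
  gamma_gamma : ∀ I J K L : List A, I ≠ [] → J ≠ [] → K ≠ [] → L ≠ [] →
    B (γ I J) (γ K L) = gammaGamma γ ft I J K L - gammaGamma γ ft K L I J

end RightHandSides

/-! ### Closed singlet states -/

/-- The space of closed singlet states: finite linear combinations of the cyclic states `Ψ^K`. -/
abbrev ClosedStates (A : Type*) := CWord A →₀ ℂ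

/-- The closed singlet state `Ψ^K`, `K` non-empty. -/
def Ψ {A : Type*} (K : List A) : ClosedStates A :=
  if h : K ≠ [] then Finsupp.single (CWord.mk K h) 1 else 0

/-- The value of an operator of the fourth kind on `Ψ^K`. -/
def gammaΨ {A : Type*} [DecidableEq A] (I J K : List A) : ClosedStates A :=
  δ K J • Ψ I
    + ∑ q ∈ nsplit2 K, δ (q.2 ++ q.1) J • Ψ I
    + ∑ q ∈ nsplit2 K, δ q.1 J • Ψ (I ++ q.2)
    + ∑ q ∈ nsplit3 K, δ q.2.1 J • Ψ (I ++ q.2.2 ++ q.1)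
    + ∑ q ∈ nsplit2 K, δ q.2 J • Ψ (I ++ q.1)
    + ∑ p ∈ nsplit2 J, ∑ q ∈ nsplit3 K, (δ q.2.2 p.1 * δ q.1 p.2) • Ψ (I ++ q.2.1)

/-- The value of an operator of the fifth kind on `Ψ^K`. -/
def ftΨ {A : Type*} [DecidableEq A] (I J K : List A) : ClosedStates A :=
  δ K J • Ψ I + ∑ p ∈ nsplit2 J, δ K (p.2 ++ p.1) • Ψ I

/-! ### The heterix algebra and its states, over an alphabet `A` -/

section Heterix

variable {A : Type*}

/-- Finite linear combinations of the `γ'^I_J` (`I`, `J` non-empty) and of the `f'^I_J` with a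
tilde (`I`, `J` non-empty and up to cyclic rotation), which are linearly independent. -/
abbrev HeterixSpace (A : Type*) := ((Word A × Word A) ⊕ (CWord A × CWord A)) →₀ ℂ

/-- `γ'^I_J`, for `I` and `J` non-empty. -/
def gamma' (I J : List A) : HeterixSpace A :=
  if h : I ≠ [] ∧ J ≠ [] then Finsupp.single (Sum.inl (⟨I, h.1⟩, ⟨J, h.2⟩)) 1 else 0

/-- `f'^I_J` with a tilde, for `I` and `J` non-empty. -/
def ft' (I J : List A) : HeterixSpace A :=
  if h : I ≠ [] ∧ J ≠ [] then Finsupp.single (Sum.inr (CWord.mk I h.1, CWord.mk J h.2)) 1 else 0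

/-- `l'^I_J`. -/
def l' [Fintype A] (I J : List A) : HeterixSpace A :=
  gamma' I J - ∑ i : A, gamma' (i :: I) (i :: J) - ft' I J

/-- `r'^I_J`. -/
def r' [Fintype A] (I J : List A) : HeterixSpace A :=
  gamma' I J - ∑ j : A, gamma' (I ++ [j]) (J ++ [j]) - ft' I J

/-- `f'^I_J`. -/
def f' [Fintype A] (I J : List A) : HeterixSpace A :=
  l' I J - ∑ j : A, l' (I ++ [j]) (J ++ [j])

/-- Open singlet states of the heterix algebra: finite linear combinations of the `s'^K`. -/
abbrev HeterixOpenStates (A : Type*) := List A →₀ ℂ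

/-- The open singlet state `s'^K`. -/
def s' (K : List A) : HeterixOpenStates A := Finsupp.single K 1

/-- The action of the heterix algebra on open singlet states. -/
structure HeterixOpenAction [DecidableEq A]
    (ρ : HeterixSpace A →ₗ[ℂ] Module.End ℂ (HeterixOpenStates A)) : Prop where
  ft : ∀ I J K : List A, I ≠ [] → J ≠ [] → ρ (ft' I J) (s' K) = 0
  gamma : ∀ I J K : List A, I ≠ [] → J ≠ [] → ρ (gamma' I J) (s' K) =
    ∑ q ∈ (split3 K).filter (fun q => q.2.1 ≠ []), δ q.2.1 J • s' (q.1 ++ I ++ q.2.2)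

/-- The action of the heterix algebra on closed singlet states. -/
structure HeterixClosedAction [DecidableEq A]
    (ρ : HeterixSpace A →ₗ[ℂ] Module.End ℂ (ClosedStates A)) : Prop where
  ft : ∀ I J K : List A, I ≠ [] → J ≠ [] → K ≠ [] → ρ (ft' I J) (Ψ K) = ftΨ I J K
  gamma : ∀ I J K : List A, I ≠ [] → J ≠ [] → K ≠ [] → ρ (gamma' I J) (Ψ K) = gammaΨ I J K

end Heterix

/-! ### The grand string algebra

`A` is the set of values of the integers in the sequences, and `E` is the set of degrees of freedom
at either end of an open string. -/

section Grand

variable {A E : Type*}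

/-- The labels of the basic operators of the five kinds. -/
inductive GrandIndex (A E : Type*)
  | first (lam₁ lam₂ : E) (I J : List A) (lam₃ lam₄ : E)
  | second (lam₁ lam₂ : E) (I J : List A)
  | third (I J : List A) (lam₃ lam₄ : E)
  | fourth (I J : Word A)
  | fifth (I J : CWord A)

/-- The space of finite linear combinations of the basic operators of the five kinds. -/
abbrev GrandSpace (A E : Type*) := GrandIndex A E →₀ ℂ

/-- `Ξ̄^{λ₁}_{λ₂} ⊗ f^I_J ⊗ Ξ^{λ₃}_{λ₄}`. -/
def opF (l₁ l₂ : E) (I J : List A) (l₃ l₄ : E) : GrandSpace A E :=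
  Finsupp.single (GrandIndex.first l₁ l₂ I J l₃ l₄) 1

/-- `Ξ̄^{λ₁}_{λ₂} ⊗ l^I_J`. -/
def opL (l₁ l₂ : E) (I J : List A) : GrandSpace A E :=
  Finsupp.single (GrandIndex.second l₁ l₂ I J) 1

/-- `r^I_J ⊗ Ξ^{λ₃}_{λ₄}`. -/
def opR (I J : List A) (l₃ l₄ : E) : GrandSpace A E :=
  Finsupp.single (GrandIndex.third I J l₃ l₄) 1

/-- `γ^I_J`, for `I` and `J` non-empty. -/
def opγ (I J : List A) : GrandSpace A E :=
  if h : I ≠ [] ∧ J ≠ [] then Finsupp.single (GrandIndex.fourth ⟨I, h.1⟩ ⟨J, h.2⟩) 1 else 0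

/-- `f^I_J` with a tilde, for `I` and `J` non-empty. -/
def opft (I J : List A) : GrandSpace A E :=
  if h : I ≠ [] ∧ J ≠ [] then
    Finsupp.single (GrandIndex.fifth (CWord.mk I h.1) (CWord.mk J h.2)) 1 else 0

/-- Operators of the first kind. -/
def firstKind (A E : Type*) : Submodule ℂ (GrandSpace A E) :=
  Submodule.span ℂ {x | ∃ l₁ l₂ I J l₃ l₄, x = opF l₁ l₂ I J l₃ l₄}

/-- Operators of the second kind. -/
def secondKind (A E : Type*) : Submodule ℂ (GrandSpace A E) :=
  Submodule.span ℂ {x | ∃ l₁ l₂ I J, x = opL l₁ l₂ I J}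

/-- Operators of the third kind. -/
def thirdKind (A E : Type*) : Submodule ℂ (GrandSpace A E) :=
  Submodule.span ℂ {x | ∃ I J l₃ l₄, x = opR I J l₃ l₄}

/-- Operators of the fourth kind. -/
def fourthKind (A E : Type*) : Submodule ℂ (GrandSpace A E) :=
  Submodule.span ℂ {x | ∃ I J, I ≠ [] ∧ J ≠ [] ∧ x = opγ I J}

/-- Operators of the fifth kind. -/
def fifthKind (A E : Type*) : Submodule ℂ (GrandSpace A E) :=
  Submodule.span ℂ {x | ∃ I J, I ≠ [] ∧ J ≠ [] ∧ x = opft I J}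

/-- First half of the bracket of two operators of the second kind, without the end labels. -/
def lHalf [DecidableEq A] {V : Type*} [AddCommGroup V] [Module ℂ V] (l : List A → List A → V)
    (I J K L : List A) : V :=
  δ K J • l I L
    + ∑ p ∈ (split2 J).filter (fun p => p.2 ≠ []), δ K p.1 • l I (L ++ p.2)
    + ∑ q ∈ (split2 K).filter (fun q => q.2 ≠ []), δ q.1 J • l (I ++ q.2) L

/-- First half of the bracket of two operators of the third kind, without the end labels. -/
def rHalf [DecidableEq A] {V : Type*} [AddCommGroup V] [Module ℂ V] (r : List A → List A → V)
    (I J K L : List A) : V :=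
  δ K J • r I L
    + ∑ p ∈ (split2 J).filter (fun p => p.1 ≠ []), δ K p.2 • r I (p.1 ++ L)
    + ∑ q ∈ (split2 K).filter (fun q => q.1 ≠ []), δ q.2 J • r (q.1 ++ I) L

/-- The bracket of `l^I_J` with `γ^K_L`, without the end labels. -/
def lGamma [DecidableEq A] {V : Type*} [AddCommGroup V] [Module ℂ V] (l : List A → List A → V)
    (I J K L : List A) : V :=
  (δ K J • l I L
    + ∑ q ∈ nsplit2 K, δ q.1 J • l (I ++ q.2) L
    + ∑ p ∈ nsplit2 J, δ K p.2 • l I (p.1 ++ L)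
    + ∑ p ∈ nsplit2 J, δ K p.1 • l I (L ++ p.2)
    + ∑ p ∈ nsplit2 J, ∑ q ∈ nsplit2 K, δ q.1 p.2 • l (I ++ q.2) (p.1 ++ L)
    + ∑ p ∈ nsplit3 J, δ K p.2.1 • l I (p.1 ++ L ++ p.2.2))
  - (δ I L • l K J
    + ∑ q ∈ nsplit2 L, δ I q.1 • l K (J ++ q.2)
    + ∑ p ∈ nsplit2 I, δ p.2 L • l (p.1 ++ K) J
    + ∑ p ∈ nsplit2 I, δ p.1 L • l (K ++ p.2) J
    + ∑ q ∈ nsplit2 L, ∑ p ∈ nsplit2 I, δ p.2 q.1 • l (p.1 ++ K) (J ++ q.2)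
    + ∑ p ∈ nsplit3 I, δ p.2.1 L • l (p.1 ++ K ++ p.2.2) J)

/-- The bracket of `r^I_J` with `γ^K_L`, without the end labels. -/
def rGamma [DecidableEq A] {V : Type*} [AddCommGroup V] [Module ℂ V] (r : List A → List A → V)
    (I J K L : List A) : V :=
  (δ K J • r I L
    + ∑ q ∈ nsplit2 K, δ q.2 J • r (q.1 ++ I) L
    + ∑ p ∈ nsplit2 J, δ K p.2 • r I (p.1 ++ L)
    + ∑ p ∈ nsplit2 J, δ K p.1 • r I (L ++ p.2)
    + ∑ p ∈ nsplit2 J, ∑ q ∈ nsplit2 K, δ q.2 p.1 • r (q.1 ++ I) (L ++ p.2)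
    + ∑ p ∈ nsplit3 J, δ K p.2.1 • r I (p.1 ++ L ++ p.2.2))
  - (δ I L • r K J
    + ∑ q ∈ nsplit2 L, δ I q.2 • r K (q.1 ++ J)
    + ∑ p ∈ nsplit2 I, δ p.2 L • r (p.1 ++ K) J
    + ∑ p ∈ nsplit2 I, δ p.1 L • r (K ++ p.2) J
    + ∑ q ∈ nsplit2 L, ∑ p ∈ nsplit2 I, δ p.1 q.2 • r (K ++ p.2) (q.1 ++ J)
    + ∑ p ∈ nsplit3 I, δ p.2.1 L • r (p.1 ++ K ++ p.2.2) J)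

/-- `B` has the prescribed values on the basic operators of the five kinds. -/
structure GrandBrackets [DecidableEq A] [DecidableEq E]
    (B : GrandSpace A E →ₗ[ℂ] GrandSpace A E →ₗ[ℂ] GrandSpace A E) : Prop where
  first_fifth : ∀ (l₁ l₂ l₃ l₄ : E) (I J K L : List A), K ≠ [] → L ≠ [] →
    B (opF l₁ l₂ I J l₃ l₄) (opft K L) = 0
  second_fifth : ∀ (l₁ l₂ : E) (I J K L : List A), K ≠ [] → L ≠ [] →
    B (opL l₁ l₂ I J) (opft K L) = 0
  third_fifth : ∀ (l₁ l₂ : E) (I J K L : List A), K ≠ [] → L ≠ [] →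
    B (opR I J l₁ l₂) (opft K L) = 0
  first_first : ∀ (l₁ l₂ l₃ l₄ l₅ l₆ l₇ l₈ : E) (I J K L : List A),
    B (opF l₁ l₂ I J l₃ l₄) (opF l₅ l₆ K L l₇ l₈) =
      (δ l₅ l₂ * δ K J * δ l₇ l₄) • opF l₁ l₆ I L l₃ l₈
        - (δ l₁ l₆ * δ I L * δ l₃ l₈) • opF l₅ l₂ K J l₇ l₄
  first_second : ∀ (l₁ l₂ l₃ l₄ l₅ l₆ : E) (I J K L : List A),
    B (opF l₁ l₂ I J l₃ l₄) (opL l₅ l₆ K L) =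
      δ l₅ l₂ • ∑ p ∈ split2 J, δ K p.1 • opF l₁ l₆ I (L ++ p.2) l₃ l₄
        - δ l₁ l₆ • ∑ p ∈ split2 I, δ p.1 L • opF l₅ l₂ (K ++ p.2) J l₃ l₄
  first_third : ∀ (l₁ l₂ l₃ l₄ l₅ l₆ : E) (I J K L : List A),
    B (opF l₁ l₂ I J l₃ l₄) (opR K L l₅ l₆) =
      δ l₅ l₄ • ∑ p ∈ split2 J, δ K p.2 • opF l₁ l₂ I (p.1 ++ L) l₃ l₆
        - δ l₃ l₆ • ∑ p ∈ split2 I, δ p.2 L • opF l₁ l₂ (p.1 ++ K) J l₅ l₄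
  first_fourth : ∀ (l₁ l₂ l₃ l₄ : E) (I J K L : List A), K ≠ [] → L ≠ [] →
    B (opF l₁ l₂ I J l₃ l₄) (opγ K L) =
      ∑ p ∈ (split3 J).filter (fun p => p.2.1 ≠ []),
          δ K p.2.1 • opF l₁ l₂ I (p.1 ++ L ++ p.2.2) l₃ l₄
        - ∑ p ∈ (split3 I).filter (fun p => p.2.1 ≠ []),
          δ p.2.1 L • opF l₁ l₂ (p.1 ++ K ++ p.2.2) J l₃ l₄
  second_second : ∀ (l₁ l₂ l₃ l₄ : E) (I J K L : List A),
    B (opL l₁ l₂ I J) (opL l₃ l₄ K L) =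
      δ l₃ l₂ • lHalf (opL l₁ l₄) I J K L - δ l₁ l₄ • lHalf (opL l₃ l₂) K L I J
  third_third : ∀ (l₁ l₂ l₃ l₄ : E) (I J K L : List A),
    B (opR I J l₁ l₂) (opR K L l₃ l₄) =
      δ l₃ l₂ • rHalf (fun M N => opR M N l₁ l₄) I J K L
        - δ l₁ l₄ • rHalf (fun M N => opR M N l₃ l₂) K L I J
  second_third : ∀ (l₁ l₂ l₃ l₄ : E) (I J K L : List A),
    B (opL l₁ l₂ I J) (opR K L l₃ l₄) =
      ∑ p ∈ split2 J, ∑ q ∈ split2 K, δ q.1 p.2 • opF l₁ l₂ (I ++ q.2) (p.1 ++ L) l₃ l₄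
        - ∑ p ∈ split2 I, ∑ q ∈ split2 L, δ p.2 q.1 • opF l₁ l₂ (p.1 ++ K) (J ++ q.2) l₃ l₄
  second_fourth : ∀ (l₁ l₂ : E) (I J K L : List A), K ≠ [] → L ≠ [] →
    B (opL l₁ l₂ I J) (opγ K L) = lGamma (opL l₁ l₂) I J K L
  third_fourth : ∀ (l₁ l₂ : E) (I J K L : List A), K ≠ [] → L ≠ [] →
    B (opR I J l₁ l₂) (opγ K L) = rGamma (fun M N => opR M N l₁ l₂) I J K L
  fourth_fifth : ClosedBrackets opγ opft B

/-- The space of open singlet states, spanned by `φ̄^{ρ₁} ⊗ s^K ⊗ φ^{ρ₂}`. -/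
abbrev OpenStates (A E : Type*) := (E × List A × E) →₀ ℂ

/-- The open singlet state `φ̄^{ρ₁} ⊗ s^K ⊗ φ^{ρ₂}`. -/
def st (r₁ : E) (K : List A) (r₂ : E) : OpenStates A E := Finsupp.single (r₁, K, r₂) 1

/-- The actions of the five kinds of operators on open singlet states. -/
structure GrandOpenAction [DecidableEq A] [DecidableEq E]
    (ρ : GrandSpace A E →ₗ[ℂ] Module.End ℂ (OpenStates A E)) : Prop where
  first : ∀ (l₁ l₂ l₃ l₄ l₅ l₆ : E) (I J K : List A),
    ρ (opF l₁ l₂ I J l₃ l₄) (st l₅ K l₆) = (δ l₅ l₂ * δ K J * δ l₆ l₄) • st l₁ I l₃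
  second : ∀ (l₁ l₂ l₃ l₄ : E) (I J K : List A),
    ρ (opL l₁ l₂ I J) (st l₃ K l₄) =
      δ l₃ l₂ • ∑ q ∈ split2 K, δ q.1 J • st l₁ (I ++ q.2) l₄
  third : ∀ (l₁ l₂ l₃ l₄ : E) (I J K : List A),
    ρ (opR I J l₁ l₂) (st l₃ K l₄) =
      δ l₄ l₂ • ∑ q ∈ split2 K, δ q.2 J • st l₃ (q.1 ++ I) l₁
  fourth : ∀ (l₁ l₂ : E) (I J K : List A), I ≠ [] → J ≠ [] →
    ρ (opγ I J) (st l₁ K l₂) =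
      ∑ q ∈ (split3 K).filter (fun q => q.2.1 ≠ []), δ q.2.1 J • st l₁ (q.1 ++ I ++ q.2.2) l₂
  fifth : ∀ (l₁ l₂ : E) (I J K : List A), I ≠ [] → J ≠ [] →
    ρ (opft I J) (st l₁ K l₂) = 0

/-- The actions of the five kinds of operators on closed singlet states. -/
structure GrandClosedAction [DecidableEq A]
    (ρ : GrandSpace A E →ₗ[ℂ] Module.End ℂ (ClosedStates A)) : Prop where
  first : ∀ (l₁ l₂ l₃ l₄ : E) (I J K : List A), K ≠ [] → ρ (opF l₁ l₂ I J l₃ l₄) (Ψ K) = 0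
  second : ∀ (l₁ l₂ : E) (I J K : List A), K ≠ [] → ρ (opL l₁ l₂ I J) (Ψ K) = 0
  third : ∀ (l₁ l₂ : E) (I J K : List A), K ≠ [] → ρ (opR I J l₁ l₂) (Ψ K) = 0
  fourth : ∀ I J K : List A, I ≠ [] → J ≠ [] → K ≠ [] → ρ (opγ I J) (Ψ K) = gammaΨ I J K
  fifth : ∀ I J K : List A, I ≠ [] → J ≠ [] → K ≠ [] → ρ (opft I J) (Ψ K) = ftΨ I J K

/-! ### Relabelling: end degrees of freedom become extra letters -/

/-- The alphabet of the heterix algebra: the `Λ` original letters, followed by `Λ_F` letters for the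
conjugate ends and `Λ_F` letters for the fundamental ends. -/
abbrev Letter (A E : Type*) := A ⊕ (E ⊕ E)

/-- A sequence of original letters in the larger alphabet. -/
def adj (K : List A) : List (Letter A E) := K.map Sum.inl

/-- The letter `λ + Λ` for a conjugate end `λ`. -/
def conj (l : E) : Letter A E := Sum.inr (Sum.inl l)

/-- The letter `λ + Λ + Λ_F` for a fundamental end `λ`. -/
def fund (l : E) : Letter A E := Sum.inr (Sum.inr l)

/-- The five kinds of operators expressed by operators of the heterix algebra. -/
structure HeterixRealisation [Fintype A] [Fintype E]
    (ι : GrandSpace A E →ₗ[ℂ] HeterixSpace (Letter A E)) : Prop where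
  fourth : ∀ I J : List A, I ≠ [] → J ≠ [] → ι (opγ I J) = gamma' (adj I) (adj J)
  fifth : ∀ I J : List A, I ≠ [] → J ≠ [] → ι (opft I J) = ft' (adj I) (adj J)
  second : ∀ (l₁ l₂ : E) (I J : List A),
    ι (opL l₁ l₂ I J) = l' (conj l₁ :: adj I) (conj l₂ :: adj J)
  third : ∀ (l₃ l₄ : E) (I J : List A),
    ι (opR I J l₃ l₄) = r' (adj I ++ [fund l₃]) (adj J ++ [fund l₄])
  first : ∀ (l₁ l₂ l₃ l₄ : E) (I J : List A),
    ι (opF l₁ l₂ I J l₃ l₄) =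
      f' (conj l₁ :: adj I ++ [fund l₃]) (conj l₂ :: adj J ++ [fund l₄])

end Grand

end GrandString

end

noncomputable section

namespace GrandString

/-! ### Sums over splittings -/

section Sums

variable {A : Type*} [DecidableEq A] {V : Type*} [AddCommMonoid V]

/-! Every bracket is realised as a commutator of operators on concrete spaces, so that antisymmetry
and the Jacobi identity cost nothing. By `exists_lieStructure`, an injective linear map into a Lie
algebra whose range contains the commutators of the images of basis vectors pulls the bracket back.
Two things remain: the prescribed right-hand sides must be the true commutators, and the operators
must be linearly independent. Uniqueness is immediate, since the bracket is prescribed on each pair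
of basis vectors in at least one order.

For the heterix algebra the target is pairs of operators, on words and on cyclic words. On words,
`γo I J` replaces factors `J` by `I`, and the fifth kind acts by zero. The operators `cr` and `an`,
which prepend and remove a prefix, satisfy `an [j] * cr [k] = δ k j`, and overlaps of words are
governed by the resulting contraction `an_mul_cr`. With `lo I J = cr I * an J` for replacement of a
prefix, an occurrence of `J` either starts at the first letter or lies in the tail, so `γo` is `lo`
plus its own `shift`. The difference between the commutator of two `γo` and the claimed value is
then equal to its own shift, hence zero (`γo_lie_γo`); the input is `lo_mul_lo` and `lo_lie_γo`.
Statements about suffixes follow by reversal.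

On cyclic words, `cl X` cuts the cyclic word at every place, applies `X` and closes up; the fourth
and fifth kinds become `cl (lo I J)` and `cl (fo I J)`. In a product of two operators of the fourth
kind, the contribution without overlap is symmetric (`cl_disjoint_comm`) and cancels in the
commutator. The overlaps are those of `lo` with `γo`, together with those in which the new cut runs
through the word just inserted (`cl_wrap`). In the latter, the removed word can wrap around the
whole cyclic word, which is the origin of the terms of the fifth kind in the bracket of two
operators of the fourth.

Faithfulness (`heterix_faithful`) is triangular: on a word of length n, replacing factors of length
at least n is a matrix unit, which determines the coefficients of the fourth kind by induction on
the length of the lower word; the operators of the fifth kind are then multiples of matrix units on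
cyclic words.

For the grand string algebra the end labels become new letters. Subtracting from a factor
replacement the same replacement preceded by an arbitrary letter leaves replacement of a prefix on
words, and the fifth kind on cyclic words. So `l'` and `r'` replace prefixes and suffixes on words,
`f'` is a matrix unit, and all three vanish on cyclic words. The brackets then reduce to
computations on words, in which end letters contract with each other and commute with everything
built from original letters. Since `iota` is injective (`iota_injective`), `grandRep` is injective
too, and the same principle gives the Lie algebra; that `iota` is a homomorphism is automatic. The
string states span invariant subspaces of the heterix states, and the relations in the quotients are
the same subtraction identities over the original alphabet. -/

theorem sum_split2_nil (F : List A × List A → V) : ∑ p ∈ split2 ([] : List A), F p = F ([], []) := by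
  simp [split2]

/-- The recursion on the first letter behind most inductions over words: the cut is either before
that letter or inside the tail. -/
theorem sum_split2_cons (x : A) (W : List A) (F : List A × List A → V) :
    ∑ p ∈ split2 (x :: W), F p = F ([], x :: W) + ∑ p ∈ split2 W, F (x :: p.1, p.2) := by
  have h : split2 (x :: W) = insert ([], x :: W)
      ((split2 W).image fun p => (x :: p.1, p.2)) := by
    ext ⟨a, b⟩
    simp only [mem_split2, Finset.mem_insert, Finset.mem_image, Prod.mk.injEq, Prod.exists]
    cases a with
    | nil => simp
    | cons y a => simp [eq_comm, and_comm, and_assoc]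
  rw [h, Finset.sum_insert (by simp), Finset.sum_image]
  rintro ⟨a, b⟩ - ⟨c, d⟩ - h
  simpa using h

theorem sum_split2_right (W : List A) (F : List A × List A → V) :
    ∑ p ∈ split2 W, F p = F (W, []) + ∑ p ∈ split2 W with p.2 ≠ [], F p := by
  rw [← Finset.sum_filter_add_sum_filter_not (split2 W) (fun p => p.2 ≠ []), add_comm]
  congr 1
  rw [Finset.sum_eq_single (W, [])]
  · rintro ⟨a, b⟩ h
    simp only [Finset.mem_filter, mem_split2, ne_eq, not_not] at h
    obtain ⟨rfl, rfl⟩ := h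
    simp
  · simp [mem_split2]

theorem sum_split2_left (W : List A) (F : List A × List A → V) :
    ∑ p ∈ split2 W, F p = F ([], W) + ∑ p ∈ split2 W with p.1 ≠ [], F p := by
  rw [← Finset.sum_filter_add_sum_filter_not (split2 W) (fun p => p.1 ≠ []), add_comm]
  congr 1
  rw [Finset.sum_eq_single ([], W)]
  · rintro ⟨a, b⟩ h
    simp only [Finset.mem_filter, mem_split2, ne_eq, not_not] at h
    obtain ⟨rfl, rfl⟩ := h
    simp
  · simp [mem_split2]

theorem sum_split2_filter_right {W : List A} (hW : W ≠ []) (F : List A × List A → V) :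
    ∑ p ∈ split2 W with p.2 ≠ [], F p = F ([], W) + ∑ p ∈ nsplit2 W, F p := by
  have h1 := sum_split2_left W (fun p => if p.2 ≠ [] then F p else 0)
  rw [Finset.sum_filter, h1, if_pos hW, nsplit2, ← Finset.sum_filter, Finset.filter_filter]

theorem sum_split2_filter_left {W : List A} (hW : W ≠ []) (F : List A × List A → V) :
    ∑ p ∈ split2 W with p.1 ≠ [], F p = F (W, []) + ∑ p ∈ nsplit2 W, F p := by
  have h1 := sum_split2_right W (fun p => if p.1 ≠ [] then F p else 0)
  rw [Finset.sum_filter, h1, if_pos hW, nsplit2, ← Finset.sum_filter, Finset.filter_filter]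
  simp only [and_comm]

theorem sum_split2_ne_nil {W : List A} (hW : W ≠ []) (F : List A × List A → V) :
    ∑ p ∈ split2 W, F p = F ([], W) + F (W, []) + ∑ p ∈ nsplit2 W, F p := by
  rw [sum_split2_left, sum_split2_filter_left hW, add_assoc]

@[simp] theorem nsplit2_nil : nsplit2 ([] : List A) = ∅ := by
  ext ⟨a, b⟩; simp +contextual [nsplit2, mem_split2]

@[simp] theorem nsplit3_nil : nsplit3 ([] : List A) = ∅ := by
  ext ⟨a, b, c⟩; simp +contextual [nsplit3, mem_split3]

theorem mem_nsplit2 {W : List A} {p : List A × List A} :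
    p ∈ nsplit2 W ↔ p.1 ++ p.2 = W ∧ p.1 ≠ [] ∧ p.2 ≠ [] := by
  simp [nsplit2, mem_split2]

theorem mem_nsplit3 {W : List A} {p : List A × List A × List A} :
    p ∈ nsplit3 W ↔ p.1 ++ p.2.1 ++ p.2.2 = W ∧ p.1 ≠ [] ∧ p.2.1 ≠ [] ∧ p.2.2 ≠ [] := by
  simp [nsplit3, mem_split3]

/-- A sum over splittings into a non-empty tail reduces to non-empty splittings when the
term with empty head vanishes. -/
theorem sum_split2_filter_right_of_zero (W : List A) (F : List A × List A → V)
    (h : F ([], W) = 0) :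
    ∑ p ∈ split2 W with p.2 ≠ [], F p = ∑ p ∈ nsplit2 W, F p := by
  by_cases hW : W = []
  · subst hW
    simp [Finset.sum_filter, sum_split2_nil]
  · rw [sum_split2_filter_right hW, h, zero_add]

/-- A cut falls strictly before the end of `P`, or else in `Q`; the junction is counted once, with
`Q`. -/
theorem sum_split2_append (P Q : List A) (F : List A × List A → V) :
    ∑ p ∈ split2 (P ++ Q), F p =
      ∑ p ∈ split2 P with p.2 ≠ [], F (p.1, p.2 ++ Q) + ∑ p ∈ split2 Q, F (P ++ p.1, p.2) := by
  induction P generalizing F with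
  | nil => simp [Finset.sum_filter, sum_split2_nil]
  | cons x P ih =>
    rw [List.cons_append, sum_split2_cons, ih]
    simp only [Finset.sum_filter, sum_split2_cons]
    simp [add_assoc]

theorem sum_split2_map {B : Type*} [DecidableEq B] (g : B → A) (W : List B)
    (F : List A × List A → V) :
    ∑ p ∈ split2 (W.map g), F p = ∑ p ∈ split2 W, F (p.1.map g, p.2.map g) := by
  induction W generalizing F with
  | nil => simp [sum_split2_nil]
  | cons x W ih => rw [List.map_cons, sum_split2_cons, sum_split2_cons, ih]; simp

theorem sum_split2_reverse (W : List A) (F : List A × List A → V) :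
    ∑ p ∈ split2 W.reverse, F p = ∑ p ∈ split2 W, F (p.2.reverse, p.1.reverse) := by
  refine Finset.sum_nbij' (fun p => (p.2.reverse, p.1.reverse))
    (fun p => (p.2.reverse, p.1.reverse)) ?_ ?_ ?_ ?_ ?_ <;> rintro ⟨a, b⟩ <;>
    simp [mem_split2]
  · intro h; rw [← List.reverse_append, h, List.reverse_reverse]
  · intro h; rw [← List.reverse_append, h]

theorem sum_split3 (W : List A) (F : List A × List A × List A → V) :
    ∑ t ∈ split3 W, F t = ∑ p ∈ split2 W, ∑ q ∈ split2 p.2, F (p.1, q.1, q.2) := by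
  rw [split3, Finset.sum_biUnion]
  · refine Finset.sum_congr rfl fun p _ => ?_
    rw [Finset.sum_image]
    rintro ⟨a, b⟩ - ⟨c, d⟩ - h
    simpa using h
  · rintro ⟨a, b⟩ ha ⟨c, d⟩ hc hne
    rw [Function.onFun, Finset.disjoint_left]
    rintro ⟨x, y, z⟩ h1 h2
    simp only [Finset.mem_image, mem_split2, Prod.mk.injEq, Prod.exists] at h1 h2
    simp only [Finset.mem_coe, mem_split2] at ha hc
    obtain ⟨_, _, rfl, rfl, rfl, rfl⟩ := h1
    obtain ⟨_, _, rfl, rfl, rfl, rfl⟩ := h2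
    exact hne rfl

/-- Coassociativity of deconcatenation: two successive cuts can be made in either order. -/
theorem sum_split2_assoc (W : List A) (F : List A × List A × List A → V) :
    ∑ p ∈ split2 W, ∑ q ∈ split2 p.2, F (p.1, q.1, q.2) =
      ∑ p ∈ split2 W, ∑ q ∈ split2 p.1, F (q.1, q.2, p.2) := by
  induction W generalizing F with
  | nil => simp [sum_split2_nil]
  | cons x W ih =>
    simp only [sum_split2_cons, sum_split2_nil, Finset.sum_add_distrib]
    rw [ih fun t => F (x :: t.1, t.2.1, t.2.2)]
    abel

theorem sum_split3' (W : List A) (F : List A × List A × List A → V) :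
    ∑ t ∈ split3 W, F t = ∑ p ∈ split2 W, ∑ q ∈ split2 p.1, F (q.1, q.2, p.2) := by
  rw [sum_split3, sum_split2_assoc]

theorem sum_split3_cons (x : A) (W : List A) (F : List A × List A × List A → V) :
    ∑ t ∈ split3 (x :: W), F t =
      ∑ p ∈ split2 (x :: W), F ([], p.1, p.2) + ∑ t ∈ split3 W, F (x :: t.1, t.2.1, t.2.2) := by
  rw [sum_split3, sum_split2_cons, sum_split3]

theorem sum_split3_map {B : Type*} [DecidableEq B] (g : B → A) (W : List B)
    (F : List A × List A × List A → V) :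
    ∑ t ∈ split3 (W.map g), F t = ∑ t ∈ split3 W, F (t.1.map g, t.2.1.map g, t.2.2.map g) := by
  simp only [sum_split3, sum_split2_map]

theorem sum_split3_reverse (W : List A) (F : List A × List A × List A → V) :
    ∑ t ∈ split3 W.reverse, F t =
      ∑ t ∈ split3 W, F (t.2.2.reverse, t.2.1.reverse, t.1.reverse) := by
  rw [sum_split3', sum_split3]
  simp only [sum_split2_reverse]

theorem sum_nsplit3 (W : List A) (F : List A × List A × List A → V) :
    ∑ t ∈ nsplit3 W, F t = ∑ p ∈ nsplit2 W, ∑ q ∈ nsplit2 p.2, F (p.1, q.1, q.2) := by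
  simp only [nsplit3, nsplit2, Finset.sum_filter, sum_split3]
  refine Finset.sum_congr rfl fun p _ => ?_
  rcases p with ⟨a, b⟩
  by_cases ha : a = []
  · simp [ha]
  · by_cases hb : b = []
    · subst hb; simp [sum_split2_nil]
    · simp [ha, hb]

theorem sum_nsplit3' (W : List A) (F : List A × List A × List A → V) :
    ∑ t ∈ nsplit3 W, F t = ∑ p ∈ nsplit2 W, ∑ q ∈ nsplit2 p.1, F (q.1, q.2, p.2) := by
  simp only [nsplit3, nsplit2, Finset.sum_filter, sum_split3']
  refine Finset.sum_congr rfl fun p _ => ?_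
  rcases p with ⟨a, b⟩
  by_cases hb : b = []
  · simp [hb]
  · by_cases ha : a = []
    · subst ha; simp [sum_split2_nil]
    · simp [ha, hb]

theorem sum_nsplit2_map {B : Type*} [DecidableEq B] (g : B → A) (W : List B)
    (F : List A × List A → V) :
    ∑ p ∈ nsplit2 (W.map g), F p = ∑ p ∈ nsplit2 W, F (p.1.map g, p.2.map g) := by
  simp [nsplit2, Finset.sum_filter, sum_split2_map]

theorem sum_nsplit3_map {B : Type*} [DecidableEq B] (g : B → A) (W : List B)
    (F : List A × List A × List A → V) :
    ∑ t ∈ nsplit3 (W.map g), F t = ∑ t ∈ nsplit3 W, F (t.1.map g, t.2.1.map g, t.2.2.map g) := by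
  simp [nsplit3, Finset.sum_filter, sum_split3_map]

theorem sum_nsplit2_reverse (W : List A) (F : List A × List A → V) :
    ∑ p ∈ nsplit2 W.reverse, F p = ∑ p ∈ nsplit2 W, F (p.2.reverse, p.1.reverse) := by
  simp [nsplit2, Finset.sum_filter, sum_split2_reverse, and_comm]

theorem sum_nsplit3_reverse (W : List A) (F : List A × List A × List A → V) :
    ∑ t ∈ nsplit3 W.reverse, F t =
      ∑ t ∈ nsplit3 W, F (t.2.2.reverse, t.2.1.reverse, t.1.reverse) := by
  simp only [nsplit3, Finset.sum_filter, sum_split3_reverse]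
  refine Finset.sum_congr rfl fun t _ => if_congr ?_ rfl rfl
  simp only [ne_eq, List.reverse_eq_nil_iff]
  tauto

end Sums

/-! ### Kronecker deltas -/

section Delta

variable {A : Type*} [DecidableEq A]

@[simp] theorem δ_self (a : A) : δ a a = 1 := if_pos rfl

theorem δ_of_ne {a b : A} (h : a ≠ b) : δ a b = 0 := if_neg h

theorem δ_map {B : Type*} [DecidableEq B] {g : A → B} (hg : g.Injective) (a b : A) :
    δ (g a) (g b) = δ a b := by simp [δ, hg.eq_iff]

@[simp] theorem δ_cons (a b : A) (P Q : List A) : δ (a :: P) (b :: Q) = δ a b * δ P Q := by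
  by_cases h : a = b <;> simp [δ, h]

@[simp] theorem δ_cons_nil (a : A) (P : List A) : δ (a :: P) [] = 0 := δ_of_ne (by simp)

@[simp] theorem δ_nil_cons (a : A) (P : List A) : δ [] (a :: P) = 0 := δ_of_ne (by simp)

@[simp] theorem δ_reverse (P Q : List A) : δ P.reverse Q.reverse = δ P Q :=
  δ_map List.reverse_injective P Q

/-- Concatenation is dual to deconcatenation: exactly one cut of `J` can match, the one after as
many letters as `X` has. -/
theorem δ_append (X Y J : List A) :
    δ (X ++ Y) J = ∑ p ∈ split2 J, δ X p.1 * δ Y p.2 := by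
  induction X generalizing J with
  | nil =>
    rw [sum_split2_left, Finset.sum_eq_zero]
    · simp
    · intro p hp
      rw [δ_of_ne (Ne.symm (Finset.mem_filter.1 hp).2), zero_mul]
  | cons x X ih =>
    cases J with
    | nil => simp [sum_split2_nil]
    | cons j J => simp [sum_split2_cons, ih, Finset.mul_sum, mul_assoc]

theorem δ_append' {X Y : List A} (hX : X ≠ []) (hY : Y ≠ []) (J : List A) :
    δ (X ++ Y) J = ∑ p ∈ nsplit2 J, δ X p.1 * δ Y p.2 := by
  rw [δ_append]
  by_cases hJ : J = []
  · subst hJ; simp [sum_split2_nil, δ_of_ne hX]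
  · rw [sum_split2_ne_nil hJ, δ_of_ne hX, δ_of_ne hY]; simp

variable {V : Type*} [AddCommGroup V] [Module ℂ V]

end Delta

/-! ### Creation and annihilation operators on words -/

section Operators

variable {A : Type*}

/-- The space spanned by all words. -/
def WordSpace (A : Type*) := HeterixOpenStates A

instance : AddCommGroup (WordSpace A) := inferInstanceAs (AddCommGroup (HeterixOpenStates A))

instance : Module ℂ (WordSpace A) := inferInstanceAs (Module ℂ (HeterixOpenStates A))

/-- The basis vector given by a word. -/
def wd (W : List A) : WordSpace A := Finsupp.single W 1

/-- Endomorphisms of the space spanned by all words. -/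
abbrev WordOp (A : Type*) := Module.End ℂ (WordSpace A)

theorem hom_ext_wd {V : Type*} [AddCommGroup V] [Module ℂ V]
    {X Y : WordSpace A →ₗ[ℂ] V} (h : ∀ W, X (wd W) = Y (wd W)) : X = Y :=
  Finsupp.lhom_ext' fun W => LinearMap.ext_ring (h W)

/-- The linear map on words with prescribed values. -/
def wordLift {V : Type*} [AddCommGroup V] [Module ℂ V] (F : List A → V) :
    WordSpace A →ₗ[ℂ] V :=
  (Finsupp.linearCombination ℂ F : HeterixOpenStates A →ₗ[ℂ] V)

@[simp] theorem wordLift_wd {V : Type*} [AddCommGroup V] [Module ℂ V] (F : List A → V)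
    (W : List A) : wordLift F (wd W) = F W :=
  (Finsupp.linearCombination_single ℂ 1 W).trans (one_smul _ _)

/-- Prepending a word. -/
def cr (I : List A) : WordOp A := wordLift fun W => wd (I ++ W)

/-- Appending a word. -/
def crR (I : List A) : WordOp A := wordLift fun W => wd (W ++ I)

/-- Reversal of words. -/
def rev : WordOp A := wordLift fun W => wd W.reverse

@[simp] theorem cr_wd (I W : List A) : cr I (wd W) = wd (I ++ W) := wordLift_wd _ _

@[simp] theorem crR_wd (I W : List A) : crR I (wd W) = wd (W ++ I) := wordLift_wd _ _

@[simp] theorem rev_wd (W : List A) : rev (wd W) = wd W.reverse := wordLift_wd _ _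

@[simp] theorem cr_nil : cr ([] : List A) = 1 := hom_ext_wd fun W => by simp

@[simp] theorem crR_nil : crR ([] : List A) = 1 := hom_ext_wd fun W => by simp

theorem cr_append (I K : List A) : cr (I ++ K) = cr I * cr K := hom_ext_wd fun W => by simp

theorem cr_cons (i : A) (K : List A) : cr (i :: K) = cr [i] * cr K := hom_ext_wd fun W => by simp

theorem crR_append (I K : List A) : crR (I ++ K) = crR K * crR I := hom_ext_wd fun W => by simp

theorem cr_mul_crR (I K : List A) : cr I * crR K = crR K * cr I := hom_ext_wd fun W => by simp

@[simp] theorem rev_mul_rev : rev * rev = (1 : WordOp A) := hom_ext_wd fun W => by simp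

theorem rev_mul_cr (I : List A) : rev * cr I = crR I.reverse * rev := hom_ext_wd fun W => by simp

theorem rev_mul_crR (I : List A) : rev * crR I = cr I.reverse * rev := hom_ext_wd fun W => by simp

variable [DecidableEq A]

/-- Removal of a prefix. -/
def an (J : List A) : WordOp A := wordLift fun W => ∑ q ∈ split2 W, δ q.1 J • wd q.2

/-- Removal of a suffix. -/
def anR (J : List A) : WordOp A := wordLift fun W => ∑ q ∈ split2 W, δ q.2 J • wd q.1

/-- The matrix unit sending the word `J` to the word `I`. -/
def fo (I J : List A) : WordOp A := wordLift fun W => δ W J • wd I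

/-- Replacement of a prefix. -/
def lo (I J : List A) : WordOp A := cr I * an J

/-- Replacement of a suffix. -/
def ro (I J : List A) : WordOp A := crR I * anR J

/-- Replacement of a non-empty factor, in all possible ways. -/
def γo (I J : List A) : WordOp A := wordLift fun W =>
  ∑ q ∈ split3 W with q.2.1 ≠ [], δ q.2.1 J • wd (q.1 ++ I ++ q.2.2)

theorem an_wd (J W : List A) : an J (wd W) = ∑ q ∈ split2 W, δ q.1 J • wd q.2 := wordLift_wd _ _

theorem anR_wd (J W : List A) : anR J (wd W) = ∑ q ∈ split2 W, δ q.2 J • wd q.1 :=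
  wordLift_wd _ _

@[simp] theorem fo_wd (I J W : List A) : fo I J (wd W) = δ W J • wd I := wordLift_wd _ _

theorem γo_wd (I J W : List A) : γo I J (wd W) =
    ∑ q ∈ split3 W with q.2.1 ≠ [], δ q.2.1 J • wd (q.1 ++ I ++ q.2.2) := wordLift_wd _ _

theorem γo_wd_of_ne {J : List A} (hJ : J ≠ []) (I W : List A) : γo I J (wd W) =
    ∑ q ∈ split3 W, δ q.2.1 J • wd (q.1 ++ I ++ q.2.2) := by
  rw [γo_wd, Finset.sum_filter]
  refine Finset.sum_congr rfl fun q _ => ?_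
  by_cases h : q.2.1 = []
  · simp [h, δ_of_ne hJ.symm]
  · simp [h]

@[simp] theorem an_nil : an ([] : List A) = 1 := hom_ext_wd fun W => by
  cases W <;> simp [an_wd, sum_split2_nil, sum_split2_cons]

@[simp] theorem an_cons_wd_nil (j : A) (J : List A) : an (j :: J) (wd []) = 0 := by
  simp [an_wd, sum_split2_nil]

@[simp] theorem an_cons_wd_cons (j x : A) (J W : List A) :
    an (j :: J) (wd (x :: W)) = δ x j • an J (wd W) := by
  simp [an_wd, sum_split2_cons, Finset.smul_sum, smul_smul]

theorem an_cons (j : A) (J : List A) : an (j :: J) = an J * an [j] := hom_ext_wd fun W => by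
  cases W <;> simp

theorem an_append (J L : List A) : an (J ++ L) = an L * an J := by
  induction J with
  | nil => simp
  | cons j J ih => rw [List.cons_append, an_cons, ih, an_cons j J, mul_assoc]

theorem rev_mul_an (J : List A) : rev * an J = anR J.reverse * rev := hom_ext_wd fun W => by
  simp [an_wd, anR_wd, sum_split2_reverse]

theorem rev_mul_fo (I J : List A) : rev * fo I J = fo I.reverse J.reverse * rev :=
  hom_ext_wd fun W => by simp

theorem rev_mul_γo (I J : List A) : rev * γo I J = γo I.reverse J.reverse * rev :=
  hom_ext_wd fun W => by
    simp only [Module.End.mul_apply, rev_wd, γo_wd, Finset.sum_filter, sum_split3_reverse, map_sum]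
    refine Finset.sum_congr rfl fun q _ => ?_
    by_cases h : q.2.1 = [] <;> simp [h]

theorem anR_eq (J : List A) : anR J = rev * an J.reverse * rev := by
  rw [rev_mul_an, List.reverse_reverse, mul_assoc, rev_mul_rev, mul_one]

theorem ro_eq (I J : List A) : ro I J = rev * lo I.reverse J.reverse * rev := by
  rw [ro, lo, anR_eq, ← mul_assoc, ← mul_assoc, ← mul_assoc, rev_mul_cr, List.reverse_reverse]

@[simp] theorem anR_nil : anR ([] : List A) = 1 := by simp [anR_eq]

theorem anR_append (J L : List A) : anR (J ++ L) = anR J * anR L := by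
  rw [anR_eq, anR_eq, anR_eq, List.reverse_append, an_append]
  simp only [mul_assoc]
  rw [← mul_assoc rev rev, rev_mul_rev, one_mul]

@[simp] theorem anR_singleton_wd_nil (j : A) : anR [j] (wd []) = 0 := by
  simp [anR_wd, sum_split2_nil]

theorem anR_singleton_wd_append (j x : A) (W : List A) :
    anR [j] (wd (W ++ [x])) = δ x j • wd W := by
  have := congrArg (fun T => T (wd (W ++ [x]))) (anR_eq [j])
  simpa using this

/-- The one-letter Cuntz-type relation from which the contractions of longer words follow. -/
theorem an_mul_cr_singleton (j k : A) : an [j] * cr [k] = δ k j • (1 : WordOp A) :=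
  hom_ext_wd fun W => by simp

theorem an_cons_mul_cr_cons (j k : A) (J K : List A) :
    an (j :: J) * cr (k :: K) = δ k j • (an J * cr K) :=
  hom_ext_wd fun W => by simp

/-- Contraction of an annihilated prefix against a created one. -/
theorem an_mul_cr (J K : List A) : an J * cr K =
    ∑ q ∈ split2 K, δ q.1 J • cr q.2 + ∑ p ∈ split2 J with p.2 ≠ [], δ K p.1 • an p.2 := by
  induction J generalizing K with
  | nil =>
    rw [Finset.sum_filter, sum_split2_nil]
    cases K <;> simp [sum_split2_nil, sum_split2_cons]
  | cons j J ih =>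
    rw [Finset.sum_filter, sum_split2_cons]
    cases K with
    | nil =>
      simp [sum_split2_nil]
    | cons k K =>
      -- Removing equal first letters leaves the same contraction for shorter words. The filter on
      -- `p.2` ensures that the exact match `J = K` is counted only in the first sum.
      rw [an_cons_mul_cr_cons, ih, sum_split2_cons, Finset.sum_filter]
      simp only [smul_add, Finset.smul_sum, smul_smul, smul_ite, smul_zero, δ_nil_cons, δ_cons,
        δ_cons_nil, zero_smul, zero_add, ite_self]

/-- Only on the empty word is the appended letter also the first one; `k ≠ j` makes that
contribution vanish. -/
theorem an_mul_crR_comm_of_ne (j k : A) (h : k ≠ j) : an [j] * crR [k] = crR [k] * an [j] :=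
  hom_ext_wd fun W => by cases W <;> simp [δ_of_ne h]

/-- The two removed letters are distinct positions as soon as the word has two letters; on shorter
words both orders give zero. -/
theorem an_mul_anR_singleton (j l : A) : an [j] * anR [l] = anR [l] * an [j] :=
  hom_ext_wd fun W => by
    cases W with
    | nil => simp
    | cons x W =>
      rcases List.eq_nil_or_concat W with rfl | ⟨W, y, rfl⟩
      · have := anR_singleton_wd_append l x []
        simp only [List.nil_append] at this
        simp [this]
      · rw [List.concat_eq_append, Module.End.mul_apply, Module.End.mul_apply, ← List.cons_append,
          anR_singleton_wd_append, List.cons_append, an_cons_wd_cons]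
        simp [anR_singleton_wd_append, smul_smul, mul_comm]

theorem an_mul_anR_singleton' (J : List A) (l : A) : an J * anR [l] = anR [l] * an J := by
  induction J with
  | nil => simp
  | cons j J ih =>
    rw [an_cons, mul_assoc, an_mul_anR_singleton, ← mul_assoc, ih, mul_assoc]

theorem an_mul_anR (J L : List A) : an J * anR L = anR L * an J := by
  induction L with
  | nil => simp
  | cons l L ih =>
    rw [← List.singleton_append, anR_append, ← mul_assoc, an_mul_anR_singleton', mul_assoc, ih,
      mul_assoc]

/-! ### Matrix units -/

/-- Multiplying a matrix unit from the left only sees the image of the single word `I`. -/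
theorem mul_fo_eq (X : WordOp A) (I J : List A) (c : List A × List A → ℂ)
    (v : List A × List A → List A) (S : Finset (List A × List A))
    (h : X (wd I) = ∑ p ∈ S, c p • wd (v p)) :
    X * fo I J = ∑ p ∈ S, c p • fo (v p) J :=
  hom_ext_wd fun W => by
    simp only [Module.End.mul_apply, fo_wd, map_smul, h, LinearMap.sum_apply, LinearMap.smul_apply,
      Finset.smul_sum]
    exact Finset.sum_congr rfl fun p _ => smul_comm _ _ _

theorem cr_mul_fo (K I J : List A) : cr K * fo I J = fo (K ++ I) J := hom_ext_wd fun W => by simp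

theorem crR_mul_fo (K I J : List A) : crR K * fo I J = fo (I ++ K) J := hom_ext_wd fun W => by simp

theorem an_mul_fo (L I J : List A) :
    an L * fo I J = ∑ p ∈ split2 I, δ p.1 L • fo p.2 J := mul_fo_eq _ _ _ _ _ _ (an_wd L I)

theorem anR_mul_fo (L I J : List A) :
    anR L * fo I J = ∑ p ∈ split2 I, δ p.2 L • fo p.1 J := mul_fo_eq _ _ _ _ _ _ (anR_wd L I)

theorem fo_mul_fo (I J K L : List A) : fo I J * fo K L = δ K J • fo I L := hom_ext_wd fun W => by
  simp [smul_smul, mul_comm]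

theorem fo_mul_an_cons (I J : List A) (k : A) : fo I J * an [k] = fo I (k :: J) :=
  hom_ext_wd fun W => by cases W <;> simp [smul_smul]

theorem fo_mul_an (I J K : List A) : fo I J * an K = fo I (K ++ J) := by
  induction K generalizing J with
  | nil => simp
  | cons k K ih => rw [an_cons, ← mul_assoc, ih, fo_mul_an_cons, List.cons_append]

theorem fo_mul_anR (I J K : List A) : fo I J * anR K = fo I (J ++ K) := by
  have : fo I J * anR K = rev * (fo I.reverse J.reverse * an K.reverse) * rev := by
    rw [anR_eq, ← mul_assoc, ← mul_assoc, ← mul_assoc, rev_mul_fo, List.reverse_reverse,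
      List.reverse_reverse]
  rw [this, fo_mul_an, rev_mul_fo, mul_assoc, rev_mul_rev]
  simp

/-- Dual to the action of `an` on a word: the functional reading off `J` is split by `δ_append`. -/
theorem fo_mul_cr (I J K : List A) :
    fo I J * cr K = ∑ p ∈ split2 J, δ K p.1 • fo I p.2 := hom_ext_wd fun W => by
  simp [δ_append, Finset.sum_smul, smul_smul]

theorem fo_mul_crR (I J K : List A) :
    fo I J * crR K = ∑ p ∈ split2 J, δ K p.2 • fo I p.1 := hom_ext_wd fun W => by
  simp [δ_append, Finset.sum_smul, smul_smul, mul_comm]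

/-! ### Replacement of factors -/

theorem γo_wd_nil (I : List A) {J : List A} (hJ : J ≠ []) : γo I J (wd []) = 0 := by
  rw [γo_wd_of_ne hJ, sum_split3, sum_split2_nil, sum_split2_nil]
  simp [δ_of_ne hJ.symm]

theorem γo_wd_cons (I : List A) {J : List A} (hJ : J ≠ []) (x : A) (W : List A) :
    γo I J (wd (x :: W)) = lo I J (wd (x :: W)) + cr [x] (γo I J (wd W)) := by
  rw [γo_wd_of_ne hJ, γo_wd_of_ne hJ, sum_split3_cons, lo, Module.End.mul_apply, an_wd]
  simp

/-- Occurrences of `J` beyond the first letter are undisturbed by removing that letter. The extra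
term comes from an occurrence at the very beginning. -/
theorem an_singleton_mul_γo (I : List A) {J : List A} (hJ : J ≠ []) (j : A) :
    an [j] * γo I J = γo I J * an [j] + an [j] * cr I * an J := hom_ext_wd fun W => by
  cases W with
  | nil =>
    obtain ⟨k, J, rfl⟩ := List.exists_cons_of_ne_nil hJ
    simp [γo_wd_nil I hJ]
  | cons x W =>
    have := LinearMap.congr_fun (an_mul_cr_singleton j x) (γo I J (wd W))
    simp only [Module.End.mul_apply, LinearMap.smul_apply, Module.End.one_apply] at this
    simp only [Module.End.mul_apply, LinearMap.add_apply, γo_wd_cons I hJ, map_add, lo, this]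
    simp [add_comm]

theorem γo_mul_cr_singleton (I : List A) {J : List A} (hJ : J ≠ []) (j : A) :
    γo I J * cr [j] = cr [j] * γo I J + cr I * an J * cr [j] := hom_ext_wd fun W => by
  simp [γo_wd_cons I hJ, lo, add_comm]

/-- A Leibniz rule over the letters of `J`. In the term of `p`, the replaced `L` begins just after
the prefix `p.1`, and the removed word reaches into the inserted `K` (or beyond it) by `p.2`; hence
`p.2` is non-empty. -/
theorem an_mul_γo (J K : List A) {L : List A} (hL : L ≠ []) : an J * γo K L =
    γo K L * an J + ∑ p ∈ split2 J with p.2 ≠ [], an p.2 * cr K * an L * an p.1 := by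
  induction J with
  | nil => simp [Finset.sum_filter, sum_split2_nil]
  | cons j J ih =>
    have hS : (∑ p ∈ split2 J with p.2 ≠ [], an p.2 * cr K * an L * an p.1) * an [j] =
        ∑ p ∈ split2 J, if p.2 ≠ [] then an p.2 * cr K * an L * an (j :: p.1) else 0 := by
      rw [Finset.sum_filter, Finset.sum_mul]
      refine Finset.sum_congr rfl fun p _ => ?_
      rw [ite_mul, zero_mul, an_cons j p.1, mul_assoc]
    have hb : an J * (an [j] * cr K * an L) = an (j :: J) * cr K * an L * an [] := by
      rw [an_cons j J, an_nil, mul_one, mul_assoc, mul_assoc, mul_assoc]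
    rw [Finset.sum_filter, sum_split2_cons, if_pos (by simp), ← hS, ← hb, an_cons j J, mul_assoc,
      an_singleton_mul_γo K hL, mul_add, ← mul_assoc, ih, add_mul, mul_assoc (γo K L), add_assoc,
      add_comm (Finset.sum _ _ * _)]

/-- The mirror rule for creation: in the term of `p`, the replaced factor begins inside the
prepended word, just after `p.1`. -/
theorem γo_mul_cr (I K : List A) {L : List A} (hL : L ≠ []) : γo K L * cr I =
    cr I * γo K L + ∑ p ∈ split2 I with p.2 ≠ [], cr p.1 * cr K * an L * cr p.2 := by
  induction I with
  | nil => simp [Finset.sum_filter, sum_split2_nil]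
  | cons j J ih =>
    have hS : cr [j] * (∑ p ∈ split2 J with p.2 ≠ [], cr p.1 * cr K * an L * cr p.2) =
        ∑ p ∈ split2 J, if p.2 ≠ [] then cr (j :: p.1) * cr K * an L * cr p.2 else 0 := by
      rw [Finset.sum_filter, Finset.mul_sum]
      refine Finset.sum_congr rfl fun p _ => ?_
      rw [mul_ite, mul_zero, cr_cons j p.1, mul_assoc, mul_assoc, mul_assoc, mul_assoc, mul_assoc]
    have hb : cr K * an L * cr [j] * cr J = cr [] * cr K * an L * cr (j :: J) := by
      rw [cr_cons j J, cr_nil, one_mul, mul_assoc]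
    rw [Finset.sum_filter, sum_split2_cons, if_pos (by simp), ← hS, ← hb, cr_cons j J, ← mul_assoc,
      γo_mul_cr_singleton K hL, add_mul, mul_assoc, ih, mul_add, ← mul_assoc, add_assoc,
      add_comm (_ * Finset.sum _ _)]

end Operators

/-! ### Formal properties of the right-hand sides -/

section Formal

variable {A : Type*} [DecidableEq A] {V W : Type*} [AddCommGroup V] [Module ℂ V]
  [AddCommGroup W] [Module ℂ W]

theorem map_lHalf (T : V →ₗ[ℂ] W) (l : List A → List A → V) (I J K L : List A) :
    T (lHalf l I J K L) = lHalf (fun M N => T (l M N)) I J K L := by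
  simp [lHalf]

theorem map_rHalf (T : V →ₗ[ℂ] W) (l : List A → List A → V) (I J K L : List A) :
    T (rHalf l I J K L) = rHalf (fun M N => T (l M N)) I J K L := by
  simp [rHalf]

theorem map_lGamma (T : V →ₗ[ℂ] W) (l : List A → List A → V) (I J K L : List A) :
    T (lGamma l I J K L) = lGamma (fun M N => T (l M N)) I J K L := by
  simp [lGamma]

theorem map_rGamma (T : V →ₗ[ℂ] W) (l : List A → List A → V) (I J K L : List A) :
    T (rGamma l I J K L) = rGamma (fun M N => T (l M N)) I J K L := by
  simp [rGamma]

theorem map_gammaGamma (T : V →ₗ[ℂ] W) (γ ft : List A → List A → V) (I J K L : List A) :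
    T (gammaGamma γ ft I J K L) =
      gammaGamma (fun M N => T (γ M N)) (fun M N => T (ft M N)) I J K L := by
  simp [gammaGamma]

theorem map_gammaFtPlus (T : V →ₗ[ℂ] W) (ft : List A → List A → V) (I J K L : List A) :
    T (gammaFtPlus ft I J K L) = gammaFtPlus (fun M N => T (ft M N)) I J K L := by
  simp [gammaFtPlus]

theorem map_gammaFtMinus (T : V →ₗ[ℂ] W) (ft : List A → List A → V) (I J K L : List A) :
    T (gammaFtMinus ft I J K L) = gammaFtMinus (fun M N => T (ft M N)) I J K L := by
  simp [gammaFtMinus]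

theorem map_ftFt (T : V →ₗ[ℂ] W) (ft : List A → List A → V) (I J K L : List A) :
    T (ftFt ft I J K L) = ftFt (fun M N => T (ft M N)) I J K L := by
  simp [ftFt]

/-- Reversal exchanges prefixes and suffixes, which deduces the third kind from the second. -/
theorem rHalf_eq (l : List A → List A → V) (I J K L : List A) :
    rHalf l I J K L = lHalf (fun M N => l M.reverse N.reverse)
      I.reverse J.reverse K.reverse L.reverse := by
  simp [rHalf, lHalf, Finset.sum_filter, sum_split2_reverse]

theorem rGamma_eq (l : List A → List A → V) (I J K L : List A) :
    rGamma l I J K L = lGamma (fun M N => l M.reverse N.reverse)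
      I.reverse J.reverse K.reverse L.reverse := by
  simp only [rGamma, lGamma, sum_nsplit2_reverse, sum_nsplit3_reverse, δ_reverse,
    List.reverse_append, List.reverse_reverse, List.append_assoc]
  abel

variable {B : Type*} [DecidableEq B]

theorem lHalf_map {g : B → A} (hg : g.Injective) (l : List A → List A → V) (I J K L : List B) :
    lHalf l (I.map g) (J.map g) (K.map g) (L.map g) =
      lHalf (fun M N => l (M.map g) (N.map g)) I J K L := by
  simp [lHalf, Finset.sum_filter, sum_split2_map, δ_map hg.list_map]

theorem rHalf_map {g : B → A} (hg : g.Injective) (l : List A → List A → V) (I J K L : List B) :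
    rHalf l (I.map g) (J.map g) (K.map g) (L.map g) =
      rHalf (fun M N => l (M.map g) (N.map g)) I J K L := by
  simp [rHalf, Finset.sum_filter, sum_split2_map, δ_map hg.list_map]

theorem lGamma_map {g : B → A} (hg : g.Injective) (l : List A → List A → V) (I J K L : List B) :
    lGamma l (I.map g) (J.map g) (K.map g) (L.map g) =
      lGamma (fun M N => l (M.map g) (N.map g)) I J K L := by
  simp only [lGamma, sum_nsplit2_map, sum_nsplit3_map, δ_map hg.list_map, ← List.map_append]

theorem rGamma_map {g : B → A} (hg : g.Injective) (l : List A → List A → V) (I J K L : List B) :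
    rGamma l (I.map g) (J.map g) (K.map g) (L.map g) =
      rGamma (fun M N => l (M.map g) (N.map g)) I J K L := by
  simp only [rGamma, sum_nsplit2_map, sum_nsplit3_map, δ_map hg.list_map, ← List.map_append]

theorem gammaGamma_map {g : B → A} (hg : g.Injective) (γ ft : List A → List A → V)
    (I J K L : List B) :
    gammaGamma γ ft (I.map g) (J.map g) (K.map g) (L.map g) =
      gammaGamma (fun M N => γ (M.map g) (N.map g)) (fun M N => ft (M.map g) (N.map g)) I J K L := by
  simp only [gammaGamma, sum_nsplit2_map, sum_nsplit3_map, δ_map hg.list_map, ← List.map_append]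

theorem gammaFtPlus_map {g : B → A} (hg : g.Injective) (ft : List A → List A → V)
    (I J K L : List B) :
    gammaFtPlus ft (I.map g) (J.map g) (K.map g) (L.map g) =
      gammaFtPlus (fun M N => ft (M.map g) (N.map g)) I J K L := by
  simp only [gammaFtPlus, sum_nsplit2_map, sum_nsplit3_map, δ_map hg.list_map, ← List.map_append]

theorem gammaFtMinus_map {g : B → A} (hg : g.Injective) (ft : List A → List A → V)
    (I J K L : List B) :
    gammaFtMinus ft (I.map g) (J.map g) (K.map g) (L.map g) =
      gammaFtMinus (fun M N => ft (M.map g) (N.map g)) I J K L := by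
  simp only [gammaFtMinus, sum_nsplit2_map, sum_nsplit3_map, δ_map hg.list_map, ← List.map_append]

theorem ftFt_map {g : B → A} (hg : g.Injective) (ft : List A → List A → V) (I J K L : List B) :
    ftFt ft (I.map g) (J.map g) (K.map g) (L.map g) =
      ftFt (fun M N => ft (M.map g) (N.map g)) I J K L := by
  simp only [ftFt, sum_nsplit2_map, δ_map hg.list_map, ← List.map_append]

/-- Every upper word that occurs contains `I` and every lower word contains `L`, so agreement on
non-empty words is enough. -/
theorem gammaGamma_congr {γ γ' ft ft' : List A → List A → V}
    (h : ∀ M N, M ≠ [] → N ≠ [] → γ M N = γ' M N) (h' : ∀ M N, M ≠ [] → N ≠ [] → ft M N = ft' M N)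
    {I J K L : List A} (hI : I ≠ []) (hL : L ≠ []) :
    gammaGamma γ ft I J K L = gammaGamma γ' ft' I J K L := by
  simp [gammaGamma, h, h', hI, hL]

theorem gammaGamma_add (γ γ' ft ft' : List A → List A → V) (I J K L : List A) :
    gammaGamma (fun M N => γ M N + γ' M N) (fun M N => ft M N + ft' M N) I J K L =
      gammaGamma γ ft I J K L + gammaGamma γ' ft' I J K L := by
  simp only [gammaGamma, smul_add, Finset.sum_add_distrib]
  abel

/-- The combination on the right is what the recursion on the first letter produces in `γo_lie_γo`.
Overlaps in which both operators act at the beginning of the word appear in both `lGamma`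
expressions, and the `lHalf` terms remove the duplicates. -/
theorem gammaGamma_sub_swap (l : List A → List A → V) {I J K L : List A}
    (hI : I ≠ []) (hJ : J ≠ []) (hK : K ≠ []) (hL : L ≠ []) :
    gammaGamma l (fun _ _ => 0) I J K L - gammaGamma l (fun _ _ => 0) K L I J =
      lGamma l I J K L - lGamma l K L I J - (lHalf l I J K L - lHalf l K L I J) := by
  have a1 : ∀ {I J K : List A} (L : List A), I ≠ [] → J ≠ [] → K ≠ [] →
      lHalf l I J K L = δ K J • l I L + ∑ p ∈ nsplit2 J, δ K p.1 • l I (L ++ p.2)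
        + ∑ q ∈ nsplit2 K, δ q.1 J • l (I ++ q.2) L := by
    intro I J K L hI hJ hK
    rw [lHalf, sum_split2_filter_right_of_zero _ _ (by simp [δ_of_ne hK]),
      sum_split2_filter_right_of_zero _ _ (by simp [δ_of_ne hJ.symm])]
  rw [a1 L hI hJ hK, a1 J hK hL hI]
  simp only [gammaGamma, lGamma, smul_zero, Finset.sum_const_zero]
  abel

/-- The two ways in which a word `K` can overlap the end of a prefix `J`, in terms of non-empty
splittings. -/
theorem sum_overlap (d : List A → List A → ℂ) (hd : ∀ X Y, X ≠ Y → d X Y = 0) (J : List A)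
    {K : List A} (hK : K ≠ []) (F : List A → List A → List A → V) :
    ∑ p ∈ split2 J with p.2 ≠ [], (∑ q ∈ split2 K, d q.1 p.2 • F q.2 p.1 []
        + ∑ q ∈ split2 p.2 with q.2 ≠ [], d K q.1 • F [] p.1 q.2) =
      d K J • F [] [] []
      + ∑ q ∈ nsplit2 K, d q.1 J • F q.2 [] []
      + ∑ p ∈ nsplit2 J, d K p.2 • F [] p.1 []
      + ∑ p ∈ nsplit2 J, d K p.1 • F [] [] p.2
      + ∑ p ∈ nsplit2 J, ∑ q ∈ nsplit2 K, d q.1 p.2 • F q.2 p.1 []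
      + ∑ p ∈ nsplit3 J, d K p.2.1 • F [] p.1 p.2.2 := by
  by_cases hJ : J = []
  · subst hJ
    rw [Finset.sum_filter, sum_split2_nil, Finset.sum_eq_zero (s := nsplit2 K)]
    · simp [hd K [] hK]
    · intro q hq
      rw [hd _ _ (mem_nsplit2.1 hq).2.1, zero_smul]
  -- Since `p.2` and `K` are non-empty, the matches involving an empty word drop out of both inner
  -- sums.
  · have key : ∀ p : List A × List A, p.2 ≠ [] →
        (∑ q ∈ split2 K, d q.1 p.2 • F q.2 p.1 []
          + ∑ q ∈ split2 p.2 with q.2 ≠ [], d K q.1 • F [] p.1 q.2) =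
        (d K p.2 • F [] p.1 [] + ∑ q ∈ nsplit2 K, d q.1 p.2 • F q.2 p.1 [])
          + ∑ q ∈ nsplit2 p.2, d K q.1 • F [] p.1 q.2 := by
      intro p hp
      rw [sum_split2_ne_nil hK, sum_split2_filter_right_of_zero _ _ (by simp [hd K [] hK]),
        hd _ _ hp.symm, zero_smul, zero_add]
    rw [sum_split2_filter_right hJ, key _ hJ,
      Finset.sum_congr rfl fun p hp => key p (mem_nsplit2.1 hp).2.2, sum_nsplit3]
    simp only [Finset.sum_add_distrib]
    abel

end Formal

/-! ### Products and commutators of the operators on words -/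

section OpenBrackets

variable {A : Type*}

/-- The operator acting on the word with its first letter removed. -/
def shift (X : WordOp A) : WordOp A := wordLift fun W =>
  match W with
  | [] => 0
  | x :: W => cr [x] (X (wd W))

@[simp] theorem shift_wd_nil (X : WordOp A) : shift X (wd []) = 0 := wordLift_wd _ _

@[simp] theorem shift_wd_cons (X : WordOp A) (x : A) (W : List A) :
    shift X (wd (x :: W)) = cr [x] (X (wd W)) := wordLift_wd _ _

/-- `shift` as a linear map. -/
def shiftₗ : WordOp A →ₗ[ℂ] WordOp A where
  toFun := shift
  map_add' X Y := hom_ext_wd fun W => by cases W <;> simp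
  map_smul' c X := hom_ext_wd fun W => by cases W <;> simp

theorem shift_mul_cr (X : WordOp A) (x : A) : shift X * cr [x] = cr [x] * X :=
  hom_ext_wd fun W => by simp

/-- Multiplicativity lets `shift` pass through commutators. On non-empty words the first letter is
merely carried along. -/
theorem shift_mul (X Y : WordOp A) : shift X * shift Y = shift (X * Y) := hom_ext_wd fun W => by
  cases W with
  | nil => simp
  | cons x W =>
    have := LinearMap.congr_fun (shift_mul_cr X x) (Y (wd W))
    simpa using this

/-- The value on a word is determined by the value on its tail, and the value on the empty word is
zero; induct on length. -/
theorem eq_zero_of_eq_shift {X : WordOp A} (h : X = shift X) : X = 0 := hom_ext_wd fun W => by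
  induction W with
  | nil => rw [h]; simp
  | cons x W ih => rw [h]; simp [ih]

variable [DecidableEq A]

theorem an_mul_cr' (J K : List A) : an J * cr K =
    ∑ p ∈ split2 J, δ K p.1 • an p.2 + ∑ q ∈ split2 K with q.2 ≠ [], δ q.1 J • cr q.2 := by
  rw [an_mul_cr, sum_split2_right K, sum_split2_right J, cr_nil, an_nil]
  exact add_right_comm _ _ _

theorem lo_mul_lo (I J K L : List A) : lo I J * lo K L = lHalf lo I J K L := by
  have : lo I J * lo K L = cr I * (an J * cr K) * an L := by simp only [lo, mul_assoc]
  rw [this, an_mul_cr, sum_split2_right]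
  simp only [mul_add, add_mul, Finset.mul_sum, Finset.sum_mul, mul_smul_comm, smul_mul_assoc, cr_nil,
    mul_one, lHalf, lo, cr_append, an_append, mul_assoc]
  abel

theorem ro_mul_ro (I J K L : List A) : ro I J * ro K L = rHalf ro I J K L := by
  have : ro I J * ro K L = rev * (lo I.reverse J.reverse * lo K.reverse L.reverse) * rev := by
    rw [ro_eq, ro_eq, mul_assoc, ← mul_assoc rev (_ * _) rev, ← mul_assoc rev rev, ← mul_assoc rev,
      rev_mul_rev, one_mul]
    simp only [mul_assoc]
  rw [this, lo_mul_lo, rHalf_eq]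
  have h := map_lHalf (V := WordOp A) (W := WordOp A) ((LinearMap.mulRight ℂ rev).comp (LinearMap.mulLeft ℂ rev))
    (lo (A := A)) I.reverse J.reverse K.reverse L.reverse
  simp only [LinearMap.comp_apply, LinearMap.mulLeft_apply, LinearMap.mulRight_apply] at h
  rw [h]
  simp only [ro_eq, List.reverse_reverse]

/-- The terms of `l^I_J γ^K_L` in which the two operators overlap. -/
theorem cr_mul_sum_overlap (I J : List A) {K : List A} (hK : K ≠ []) (L : List A) :
    cr I * ∑ p ∈ split2 J with p.2 ≠ [], an p.2 * cr K * an L * an p.1 =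
      δ K J • lo I L
      + ∑ q ∈ nsplit2 K, δ q.1 J • lo (I ++ q.2) L
      + ∑ p ∈ nsplit2 J, δ K p.2 • lo I (p.1 ++ L)
      + ∑ p ∈ nsplit2 J, δ K p.1 • lo I (L ++ p.2)
      + ∑ p ∈ nsplit2 J, ∑ q ∈ nsplit2 K, δ q.1 p.2 • lo (I ++ q.2) (p.1 ++ L)
      + ∑ p ∈ nsplit3 J, δ K p.2.1 • lo I (p.1 ++ L ++ p.2.2) := by
  have := sum_overlap δ (fun _ _ => δ_of_ne) J hK fun X Y Z => lo (I ++ X) (Y ++ L ++ Z)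
  simp only [List.append_nil, List.nil_append] at this
  rw [← this, Finset.mul_sum]
  refine Finset.sum_congr rfl fun p _ => ?_
  rw [an_mul_cr]
  simp only [mul_add, add_mul, Finset.mul_sum, Finset.sum_mul, mul_smul_comm, smul_mul_assoc,
    lo, cr_append, an_append, mul_assoc]

/-- The terms of `γ^K_L l^I_J` in which the two operators overlap. -/
theorem sum_overlap_mul_an (I J K : List A) {L : List A} (hL : L ≠ []) :
    (∑ p ∈ split2 I with p.2 ≠ [], cr p.1 * cr K * an L * cr p.2) * an J =
      δ I L • lo K J
      + ∑ q ∈ nsplit2 L, δ I q.1 • lo K (J ++ q.2)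
      + ∑ p ∈ nsplit2 I, δ p.2 L • lo (p.1 ++ K) J
      + ∑ p ∈ nsplit2 I, δ p.1 L • lo (K ++ p.2) J
      + ∑ q ∈ nsplit2 L, ∑ p ∈ nsplit2 I, δ p.2 q.1 • lo (p.1 ++ K) (J ++ q.2)
      + ∑ p ∈ nsplit3 I, δ p.2.1 L • lo (p.1 ++ K ++ p.2.2) J := by
  have := sum_overlap (fun X Y => δ Y X) (fun _ _ h => δ_of_ne h.symm) I hL
    fun X Y Z => lo (Y ++ K ++ Z) (J ++ X)
  simp only [List.append_nil, List.nil_append] at this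
  rw [Finset.sum_comm (s := nsplit2 L), ← this, Finset.sum_mul]
  refine Finset.sum_congr rfl fun p _ => ?_
  rw [mul_assoc (cr p.1 * cr K), an_mul_cr']
  simp only [mul_add, add_mul, Finset.mul_sum, Finset.sum_mul, mul_smul_comm, smul_mul_assoc,
    lo, cr_append, an_append, mul_assoc]

/-- Moving `γo` through `an J` and through `cr I` gives the common term `cr I * γo K L * an J`,
which cancels. The two families of overlap corrections are the two halves of `lGamma`. -/
theorem lo_lie_γo (I J : List A) {K L : List A} (hK : K ≠ []) (hL : L ≠ []) :
    lo I J * γo K L - γo K L * lo I J = lGamma lo I J K L := by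
  have h1 : lo I J * γo K L = cr I * (an J * γo K L) := by simp only [lo, mul_assoc]
  have h2 : γo K L * lo I J = (γo K L * cr I) * an J := by simp only [lo, mul_assoc]
  rw [h1, h2, an_mul_γo _ _ hL, γo_mul_cr _ _ hL, mul_add, add_mul, cr_mul_sum_overlap I J hK,
    sum_overlap_mul_an I J K hL, lGamma, ← mul_assoc]
  abel

theorem γo_eq (I J : List A) : γo I J = rev * γo I.reverse J.reverse * rev := by
  rw [rev_mul_γo, List.reverse_reverse, List.reverse_reverse, mul_assoc, rev_mul_rev, mul_one]

theorem ro_lie_γo (I J : List A) {K L : List A} (hK : K ≠ []) (hL : L ≠ []) :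
    ro I J * γo K L - γo K L * ro I J = rGamma ro I J K L := by
  have : ro I J * γo K L - γo K L * ro I J =
      rev * (lo I.reverse J.reverse * γo K.reverse L.reverse -
        γo K.reverse L.reverse * lo I.reverse J.reverse) * rev := by
    have h : ∀ X Y : WordOp A, rev * X * rev * (rev * Y * rev) = rev * (X * Y) * rev := by
      intro X Y
      rw [mul_assoc, ← mul_assoc rev (_ * _) rev, ← mul_assoc rev rev, rev_mul_rev, one_mul]
      simp only [mul_assoc]
    rw [ro_eq, γo_eq, h, h, ← sub_mul]
    exact congrArg (· * rev) (mul_sub _ _ _).symm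
  rw [this, lo_lie_γo _ _ (by simpa) (by simpa), rGamma_eq]
  have h := map_lGamma (V := WordOp A) (W := WordOp A) ((LinearMap.mulRight ℂ rev).comp (LinearMap.mulLeft ℂ rev))
    (lo (A := A)) I.reverse J.reverse K.reverse L.reverse
  simp only [LinearMap.comp_apply, LinearMap.mulLeft_apply, LinearMap.mulRight_apply] at h
  rw [h]
  simp only [ro_eq, List.reverse_reverse]

/-- Removal of a prefix after appending a suffix. -/
theorem an_mul_crR (J K : List A) : an J * crR K = crR K * an J +
    ∑ p ∈ split2 J with p.2 ≠ [], ∑ q ∈ split2 K, δ q.1 p.2 • fo q.2 p.1 := by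
  refine hom_ext_wd fun W => ?_
  simp only [Finset.sum_filter]
  induction J generalizing W with
  | nil => simp [sum_split2_nil]
  | cons j J ih =>
    rw [sum_split2_cons, if_pos (by simp)]
    cases W with
    | nil =>
      simp only [Module.End.mul_apply, crR_wd, LinearMap.add_apply, LinearMap.sum_apply,
        an_cons_wd_nil, map_zero, LinearMap.smul_apply, fo_wd, List.nil_append, δ_self, one_smul,
        zero_add]
      -- On the empty word the removed prefix comes entirely from the appended `K`, so only the cut
      -- with empty first part contributes.
      rw [an_wd, Finset.sum_eq_zero (s := split2 J), add_zero]
      intro p _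
      split_ifs <;> simp
    | cons x W =>
      have := ih W
      simp only [Module.End.mul_apply, crR_wd, LinearMap.add_apply, LinearMap.sum_apply,
        an_cons_wd_cons, map_smul, LinearMap.smul_apply, fo_wd, List.cons_append, δ_cons_nil,
        zero_smul, smul_zero, Finset.sum_const_zero, zero_add] at this ⊢
      rw [this, smul_add, Finset.smul_sum]
      refine congrArg₂ _ rfl (Finset.sum_congr rfl fun p _ => ?_)
      split_ifs
      · simp only [LinearMap.sum_apply, LinearMap.smul_apply, fo_wd, δ_cons, Finset.smul_sum,
          smul_smul]
        exact Finset.sum_congr rfl fun q _ => by rw [mul_left_comm]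
      · simp

/-- Removal of a suffix after prepending a prefix. -/
theorem anR_mul_cr (L I : List A) : anR L * cr I = cr I * anR L +
    ∑ p ∈ split2 L with p.1 ≠ [], ∑ q ∈ split2 I, δ q.2 p.1 • fo q.1 p.2 := by
  have : anR L * cr I = rev * (an L.reverse * crR I.reverse) * rev := by
    rw [anR_eq, mul_assoc, rev_mul_cr]
    simp only [mul_assoc]
  rw [this, an_mul_crR, mul_add, add_mul, ← mul_assoc rev, rev_mul_crR, List.reverse_reverse,
    mul_assoc (cr I), rev_mul_an, List.reverse_reverse, mul_assoc (cr I), mul_assoc (anR L),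
    rev_mul_rev, mul_one]
  refine congrArg₂ _ rfl ?_
  simp only [Finset.sum_filter, sum_split2_reverse, Finset.mul_sum, Finset.sum_mul]
  refine Finset.sum_congr rfl fun p _ => ?_
  by_cases h : p.1 = []
  · simp [h]
  · simp only [ne_eq, List.reverse_eq_nil_iff, h, not_false_eq_true, if_true, δ_reverse,
      Finset.mul_sum, Finset.sum_mul, mul_smul_comm, smul_mul_assoc, rev_mul_fo,
      List.reverse_reverse, mul_assoc, rev_mul_rev, mul_one]

/-- Changing a prefix and changing a suffix commute on long words. What remains are the short words
on which the two changes meet, so the commutator is a combination of matrix units. -/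
theorem lo_lie_ro (I J K L : List A) : lo I J * ro K L - ro K L * lo I J =
    ∑ p ∈ split2 J, ∑ q ∈ split2 K, δ q.1 p.2 • fo (I ++ q.2) (p.1 ++ L)
      - ∑ p ∈ split2 I, ∑ q ∈ split2 L, δ p.2 q.1 • fo (p.1 ++ K) (J ++ q.2) := by
  have h1 : lo I J * ro K L = cr I * (an J * crR K) * anR L := by simp only [lo, ro, mul_assoc]
  have h2 : ro K L * lo I J = crR K * (anR L * cr I) * an J := by simp only [lo, ro, mul_assoc]
  have hz : ∀ (K : List A) (F : List A → List A → WordOp A),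
      ∑ q ∈ split2 K, δ q.1 [] • F q.1 q.2 = F [] K := by
    intro K F
    cases K <;> simp [sum_split2_nil, sum_split2_cons]
  -- The contraction formulas omit empty overlaps, whereas the stated sums include them. The two
  -- empty-overlap terms are the same matrix unit, of `I ++ K` and `J ++ L`, and cancel in the
  -- difference.
  rw [h1, h2, an_mul_crR, anR_mul_cr, sum_split2_right J, hz K fun _ X => fo (I ++ X) (J ++ L),
    Finset.sum_comm (s := split2 I), sum_split2_left L]
  have hz' : ∑ q ∈ split2 I, δ q.2 [] • fo (q.1 ++ K) (J ++ L) = fo (I ++ K) (J ++ L) := by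
    rw [sum_split2_right, Finset.sum_eq_zero]
    · simp
    · intro q hq
      rw [δ_of_ne (Finset.mem_filter.1 hq).2, zero_smul]
  rw [hz']
  have h3 : cr I * (crR K * an J) * anR L = crR K * (cr I * anR L) * an J := by
    rw [← mul_assoc, cr_mul_crR, mul_assoc, an_mul_anR]
    simp only [mul_assoc]
  simp only [mul_add, add_mul, h3, Finset.mul_sum, Finset.sum_mul, mul_smul_comm, smul_mul_assoc,
    cr_mul_fo, crR_mul_fo, fo_mul_an, fo_mul_anR]
  abel

theorem fo_mul_lo (I J K L : List A) :
    fo I J * lo K L = ∑ p ∈ split2 J, δ K p.1 • fo I (L ++ p.2) := by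
  rw [lo, ← mul_assoc, fo_mul_cr, Finset.sum_mul]
  simp only [smul_mul_assoc, fo_mul_an]

theorem lo_mul_fo (I J K L : List A) :
    lo K L * fo I J = ∑ p ∈ split2 I, δ p.1 L • fo (K ++ p.2) J := by
  rw [lo, mul_assoc, an_mul_fo, Finset.mul_sum]
  simp only [mul_smul_comm, cr_mul_fo]

theorem fo_mul_ro (I J K L : List A) :
    fo I J * ro K L = ∑ p ∈ split2 J, δ K p.2 • fo I (p.1 ++ L) := by
  rw [ro, ← mul_assoc, fo_mul_crR, Finset.sum_mul]
  simp only [smul_mul_assoc, fo_mul_anR]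

theorem ro_mul_fo (I J K L : List A) :
    ro K L * fo I J = ∑ p ∈ split2 I, δ p.2 L • fo (p.1 ++ K) J := by
  rw [ro, mul_assoc, anR_mul_fo, Finset.mul_sum]
  simp only [mul_smul_comm, crR_mul_fo]

theorem γo_mul_fo (I J K L : List A) : γo K L * fo I J =
    ∑ p ∈ split3 I with p.2.1 ≠ [], δ p.2.1 L • fo (p.1 ++ K ++ p.2.2) J := hom_ext_wd fun W => by
  simp only [Module.End.mul_apply, fo_wd, map_smul, γo_wd, LinearMap.sum_apply,
    LinearMap.smul_apply, Finset.smul_sum]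
  exact Finset.sum_congr rfl fun p _ => smul_comm _ _ _

/-- Write `fo I J` as `fo I [] * an J` and move `an J` through `γo`. Only the overlaps survive,
since inserting the non-empty `K` never leaves the empty word. -/
theorem fo_mul_γo (I J : List A) {K L : List A} (hK : K ≠ []) (hL : L ≠ []) : fo I J * γo K L =
    ∑ p ∈ split3 J with p.2.1 ≠ [], δ K p.2.1 • fo I (p.1 ++ L ++ p.2.2) := by
  have h0 : fo I [] * γo K L = 0 := hom_ext_wd fun W => by
    simp only [Module.End.mul_apply, γo_wd, map_sum, map_smul, fo_wd, LinearMap.zero_apply]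
    refine Finset.sum_eq_zero fun q _ => ?_
    rw [δ_of_ne (b := []) (by simp [hK]), zero_smul, smul_zero]
  have h1 : fo I J = fo I [] * an J := by rw [fo_mul_an, List.append_nil]
  rw [h1, mul_assoc, an_mul_γo _ _ hL, mul_add, ← mul_assoc, h0, zero_mul, zero_add,
    Finset.sum_filter, Finset.sum_filter, sum_split3, Finset.mul_sum]
  refine Finset.sum_congr rfl fun p _ => ?_
  have h2 : fo I [] * (an p.2 * cr K * an L * an p.1) =
      ∑ q ∈ split2 p.2, δ K q.1 • fo I (p.1 ++ L ++ q.2) := by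
    have : fo I [] * (an p.2 * cr K * an L * an p.1) = fo I [] * an p.2 * cr K * an L * an p.1 := by
      simp only [mul_assoc]
    rw [this, fo_mul_an, List.append_nil, fo_mul_cr, Finset.sum_mul, Finset.sum_mul]
    simp only [smul_mul_assoc, fo_mul_an, List.append_assoc]
  split_ifs with h
  · rw [h2]
    refine Finset.sum_congr rfl fun q _ => ?_
    split_ifs with hq
    · rfl
    · rw [not_not.1 hq, δ_of_ne hK, zero_smul]
  · rw [mul_zero, not_not.1 h, sum_split2_nil]
    simp

theorem γo_eq_lo_add_shift (I : List A) {J : List A} (hJ : J ≠ []) :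
    γo I J = lo I J + shift (γo I J) := hom_ext_wd fun W => by
  cases W with
  | nil =>
    obtain ⟨j, J, rfl⟩ := List.exists_cons_of_ne_nil hJ
    simp [γo_wd_nil I hJ, lo]
  | cons x W => simp [γo_wd_cons I hJ]

/-- Each operator is its prefix part plus its own shift. Comparing the commutator and the claimed
value `R γo` modulo shifts reduces the claim to brackets with `lo`, already known; a difference
equal to its own shift is zero. -/
theorem γo_lie_γo {I J K L : List A} (hI : I ≠ []) (hJ : J ≠ []) (hK : K ≠ []) (hL : L ≠ []) :
    γo I J * γo K L - γo K L * γo I J =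
      gammaGamma γo (fun _ _ => 0) I J K L - gammaGamma γo (fun _ _ => 0) K L I J := by
  set R : (List A → List A → WordOp A) → WordOp A := fun g =>
    gammaGamma g (fun _ _ => 0) I J K L - gammaGamma g (fun _ _ => 0) K L I J with hR
  have hlin : shift (R γo) = R (fun M N => shift (γo M N)) := by
    have h1 := map_gammaGamma (V := WordOp A) (W := WordOp A) shiftₗ γo (fun _ _ => 0) I J K L
    have h2 := map_gammaGamma (V := WordOp A) (W := WordOp A) shiftₗ γo (fun _ _ => 0) K L I J
    simp only [map_zero] at h1 h2
    exact (map_sub shiftₗ _ _).trans (congrArg₂ _ h1 h2)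
  have hsub : R γo - shift (R γo) = R lo := by
    have hz : ∀ M N : List A, M ≠ [] → N ≠ [] → γo M N = lo M N + shift (γo M N) :=
      fun M N _ hN => γo_eq_lo_add_shift M hN
    have h0 : ∀ M N : List A, M ≠ [] → N ≠ [] → (0 : WordOp A) = 0 + 0 :=
      fun _ _ _ _ => (add_zero 0).symm
    have : R γo = R lo + R (fun M N => shift (γo M N)) := by
      simp only [hR]
      rw [gammaGamma_congr hz h0 hI hL, gammaGamma_congr hz h0 hK hJ]
      exact (congrArg₂ _ (gammaGamma_add (V := WordOp A) _ _ _ _ I J K L)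
        (gammaGamma_add (V := WordOp A) _ _ _ _ K L I J)).trans (add_sub_add_comm _ _ _ _)
    rw [hlin, this, add_sub_cancel_right]
  have hlo : R lo = lGamma lo I J K L - lGamma lo K L I J
      - (lHalf lo I J K L - lHalf lo K L I J) := gammaGamma_sub_swap (V := WordOp A) _ hI hJ hK hL
  set Z := γo I J * γo K L - γo K L * γo I J with hZ
  -- With `g`, `h` the two operators and `l`, `m` their prefix parts, `shift Z` is the commutator of
  -- `g - l` and `h - m`. Subtracting it from `Z` leaves only commutators in which a prefix
  -- replacement takes part.
  have hZs : Z - shift Z = R lo := by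
    have hs : shift Z =
        shift (γo I J) * shift (γo K L) - shift (γo K L) * shift (γo I J) := by
      rw [shift_mul, shift_mul]
      exact map_sub (shiftₗ (A := A)) _ _
    have e1 : shift (γo I J) = γo I J - lo I J :=
      eq_sub_of_add_eq' (γo_eq_lo_add_shift I hJ).symm
    have e2 : shift (γo K L) = γo K L - lo K L :=
      eq_sub_of_add_eq' (γo_eq_lo_add_shift K hL).symm
    have hring : ∀ {R : Type _} [Ring R] (g l h m : R), g * h - h * g -
        ((g - l) * (h - m) - (h - m) * (g - l)) =
        l * h - h * l - (m * g - g * m) - (l * m - m * l) := fun g l h m => by noncomm_ring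
    rw [hs, e1, e2, hlo, ← lo_lie_γo I J hK hL, ← lo_lie_γo K L hI hJ, ← lo_mul_lo, ← lo_mul_lo,
      hZ]
    exact hring _ _ _ _
  have h0 : Z - R γo = 0 := by
    refine eq_zero_of_eq_shift ?_
    have : shift (Z - R γo) = shift Z - shift (R γo) := map_sub (shiftₗ (A := A)) _ _
    rw [this]
    -- `Z` and `R γo` have the same defect under `shift`, so their difference has none.
    have h4 := hZs.trans hsub.symm
    rw [sub_eq_sub_iff_sub_eq_sub] at h4
    exact h4
  exact sub_eq_zero.1 h0

end OpenBrackets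

/-! ### Sums over rotations -/

section Rotations

variable {A : Type*} {V : Type*} [AddCommGroup V]

/-- The sum of `F` over all rotations of a word. -/
def rsum (F : List A → V) (K : List A) : V := ∑ k ∈ Finset.range K.length, F (K.rotate k)

@[simp] theorem rsum_nil (F : List A → V) : rsum F [] = 0 := by simp [rsum]

theorem rsum_rotate (F : List A → V) (K : List A) (m : ℕ) : rsum F (K.rotate m) = rsum F K := by
  induction m with
  | zero => simp
  | succ m ih =>
    rw [← ih, ← List.rotate_rotate]
    generalize K.rotate m = K
    have h1 := Finset.sum_range_succ (fun k => F (K.rotate k)) K.length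
    rw [Finset.sum_range_succ', List.rotate_length, List.rotate_zero, add_left_inj] at h1
    simp only [rsum, List.length_rotate, List.rotate_rotate]
    rw [← h1]
    exact Finset.sum_congr rfl fun k _ => by rw [add_comm]

theorem rsum_add (F G : List A → V) (K : List A) :
    rsum (fun W => F W + G W) K = rsum F K + rsum G K := Finset.sum_add_distrib

theorem rsum_sum {ι : Type*} (s : Finset ι) (F : ι → List A → V) (K : List A) :
    rsum (fun W => ∑ i ∈ s, F i W) K = ∑ i ∈ s, rsum (F i) K := Finset.sum_comm

theorem map_rsum {V' T : Type*} [AddCommGroup V'] [FunLike T V V'] [AddMonoidHomClass T V V']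
    (f : T) (F : List A → V) (K : List A) : f (rsum F K) = rsum (fun W => f (F W)) K :=
  map_sum f _ _

variable [DecidableEq A]

theorem sum_split2_eq_range {M : Type*} [AddCommMonoid M] (W : List A) (F : List A × List A → M) :
    ∑ p ∈ split2 W, F p = ∑ k ∈ Finset.range (W.length + 1), F (W.take k, W.drop k) := by
  rw [split2, Finset.sum_image]
  intro a ha b hb h
  have := congrArg (fun p : List A × List A => p.1.length) h
  simp only [List.length_take] at this
  simp only [Finset.coe_range, Set.mem_Iio] at ha hb
  omega

theorem rsum_eq_right (F : List A → V) (K : List A) :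
    rsum F K = ∑ p ∈ split2 K with p.2 ≠ [], F (p.2 ++ p.1) := by
  rw [Finset.sum_filter, sum_split2_eq_range, Finset.sum_range_succ, if_neg (by simp), add_zero]
  refine Finset.sum_congr rfl fun k hk => ?_
  have hk' := Finset.mem_range.1 hk
  rw [if_pos (by simpa using hk'), List.rotate_eq_drop_append_take hk'.le]

theorem rsum_eq_left (F : List A → V) (K : List A) :
    rsum F K = ∑ p ∈ split2 K with p.1 ≠ [], F (p.2 ++ p.1) := by
  rw [rsum_eq_right]
  have h := (sum_split2_left K fun p => F (p.2 ++ p.1)).symm.trans (sum_split2_right K _)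
  simp only [List.append_nil, List.nil_append, add_right_inj] at h
  exact h.symm

theorem rsum_eq {K : List A} (hK : K ≠ []) (F : List A → V) :
    rsum F K = F K + ∑ p ∈ nsplit2 K, F (p.2 ++ p.1) := by
  rw [rsum_eq_right, sum_split2_filter_right hK, List.append_nil]

/-- Rotations of a concatenation, according to whether the first factor is cut. -/
theorem rsum_append {K : List A} (hK : K ≠ []) (X : List A) (F : List A → V) :
    rsum F (K ++ X) = ∑ p ∈ split2 X, F (p.2 ++ K ++ p.1)
      + ∑ p ∈ nsplit2 K, F (p.2 ++ X ++ p.1) := by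
  have h := sum_split2_right (K ++ X) fun p => F (p.2 ++ p.1)
  rw [← rsum_eq_right, sum_split2_append, sum_split2_filter_right hK] at h
  simp only [List.append_nil, List.nil_append, ← List.append_assoc] at h
  rw [add_assoc, add_right_inj] at h
  rw [← h, add_comm]

/-- On the rotations of a word, the two parts of a splitting can be interchanged. -/
theorem rsum_sum_split2_comm (G : List A → List A → V) (M : List A) :
    rsum (fun W => ∑ p ∈ split2 W, G p.1 p.2) M = rsum (fun W => ∑ p ∈ split2 W, G p.2 p.1) M := by
  -- Rotating by `m` more letters interchanges the first `m` letters with the rest, so a cut after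
  -- `m` letters becomes a cut after `M.length - m` letters with its parts swapped.
  have key : ∀ m ∈ Finset.range (M.length + 1), rsum (fun W => G (W.take m) (W.drop m)) M =
      rsum (fun W => G (W.drop (M.length - m)) (W.take (M.length - m))) M := by
    intro m hm
    rw [← rsum_rotate (fun W => G (W.drop _) (W.take _)) M m]
    simp only [rsum, List.length_rotate]
    refine Finset.sum_congr rfl fun k _ => ?_
    rw [List.rotate_rotate, add_comm, ← List.rotate_rotate]
    have hl : m ≤ (M.rotate k).length := by
      rw [List.length_rotate]; exact Nat.lt_succ_iff.1 (Finset.mem_range.1 hm)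
    have hd : ((M.rotate k).drop m).length = M.length - m := by simp
    rw [List.rotate_eq_drop_append_take hl, ← hd, List.drop_left, List.take_left]
  have h1 : ∀ H : List A → List A → V, rsum (fun W => ∑ p ∈ split2 W, H p.1 p.2) M =
      ∑ m ∈ Finset.range (M.length + 1), rsum (fun W => H (W.take m) (W.drop m)) M := by
    intro H
    rw [← rsum_sum]
    simp only [rsum, sum_split2_eq_range, List.length_rotate]
  rw [h1, h1 fun U V => G V U, Finset.sum_congr rfl key]
  rw [← Finset.sum_range_reflect]
  refine Finset.sum_congr rfl fun m hm => ?_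
  have := Finset.mem_range.1 hm
  rw [show M.length - (M.length + 1 - 1 - m) = m by omega]

/-- A rotation taking `M` to `L` is undone by one taking `L` to `M`; swapping the two parts of the
cut matches them. -/
theorem rsum_δ_comm (M L : List A) : rsum (fun W => δ W L) M = rsum (fun W => δ M W) L := by
  rw [rsum_eq_right, rsum_eq_left, Finset.sum_filter, Finset.sum_filter]
  simp only [δ, ← ite_and]
  rw [← Finset.sum_filter, ← Finset.sum_filter]
  refine Finset.sum_nbij' Prod.swap Prod.swap ?_ ?_ ?_ ?_ ?_ <;> rintro ⟨a, b⟩ <;>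
    simp +contextual [mem_split2]

variable [Module ℂ V]

/-- The prefix of a rotated word can end before, at, or beyond the old end of `K`, or can be the
entire word. The unrotated word gives the terms without wrap-around at the start of `K`; `d [] = 0`
discards empty prefixes. -/
theorem rsum_prefix {K : List A} (hK : K ≠ []) (d : List A → ℂ) (hd : d [] = 0)
    (F : List A → V) (I : List A) :
    rsum (fun W => ∑ p ∈ split2 W, d p.1 • F (I ++ p.2)) K =
      d K • F I
      + ∑ q ∈ nsplit2 K, d (q.2 ++ q.1) • F I
      + ∑ q ∈ nsplit2 K, d q.1 • F (I ++ q.2)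
      + ∑ q ∈ nsplit3 K, d q.2.1 • F (I ++ q.2.2 ++ q.1)
      + ∑ q ∈ nsplit2 K, d q.2 • F (I ++ q.1)
      + ∑ q ∈ nsplit3 K, d (q.2.2 ++ q.1) • F (I ++ q.2.1) := by
  have h1 : ∀ p ∈ nsplit2 K, ∑ r ∈ split2 (p.2 ++ p.1), d r.1 • F (I ++ r.2) =
      ∑ r ∈ nsplit2 p.2, d r.1 • F (I ++ r.2 ++ p.1) + (d p.2 • F (I ++ p.1)
        + d (p.2 ++ p.1) • F I + ∑ r ∈ nsplit2 p.1, d (p.2 ++ r.1) • F (I ++ r.2)) := by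
    intro p hp
    rw [sum_split2_append, sum_split2_filter_right_of_zero _ _ (by simp [hd]),
      sum_split2_ne_nil (mem_nsplit2.1 hp).2.1]
    simp
  rw [rsum_eq hK, Finset.sum_congr rfl h1, sum_split2_ne_nil hK, sum_nsplit3, sum_nsplit3']
  simp only [Finset.sum_add_distrib, hd, zero_smul, zero_add, List.append_nil]
  abel

/-- The six families are the six positions of `J` relative to the place where the cyclic word `K` is
written open; cyclicity of `ft` moves `I` to the front. -/
theorem gammaFtPlus_eq (ft : List A → List A → V) (hft : ∀ X Y Z, ft (X ++ Y) Z = ft (Y ++ X) Z)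
    (I : List A) {J K : List A} (hJ : J ≠ []) (hK : K ≠ []) (L : List A) :
    gammaFtPlus ft I J K L = rsum (fun W => ∑ p ∈ split2 W, δ p.1 J • ft (I ++ p.2) L) K := by
  rw [rsum_prefix hK (fun X => δ X J) (δ_of_ne hJ.symm) fun X => ft X L, gammaFtPlus]
  simp only [hft _ I, List.append_assoc, hft _ (I ++ _)]

theorem gammaFtMinus_eq (ft : List A → List A → V) (hft : ∀ X Y Z, ft Z (X ++ Y) = ft Z (Y ++ X))
    {I : List A} (J K : List A) {L : List A} (hI : I ≠ []) (hL : L ≠ []) :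
    gammaFtMinus ft I J K L = rsum (fun W => ∑ p ∈ split2 W, δ I p.1 • ft K (J ++ p.2)) L := by
  rw [rsum_prefix hL (fun X => δ I X) (δ_of_ne hI) fun X => ft K X, gammaFtMinus]
  simp only [hft _ J, List.append_assoc, hft _ (J ++ _)]
  abel

theorem ftFt_eq (ft : List A → List A → V) (I J : List A) {K : List A} (hK : K ≠ []) (L : List A) :
    ftFt ft I J K L = rsum (fun W => δ W J • ft I L) K := by
  rw [rsum_eq hK, ftFt]

/-- The bracket of two operators of the fourth kind, with the overlaps grouped by the position of
the second operator. -/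
theorem gammaGamma_eq (γ ft : List A → List A → V) (hft : ∀ X Y Z, ft Z (X ++ Y) = ft Z (Y ++ X))
    (I : List A) {J : List A} (hJ : J ≠ []) (K L : List A) :
    gammaGamma γ ft I J K L =
      (δ K J • γ I L
        + ∑ q ∈ nsplit2 K, δ q.1 J • γ (I ++ q.2) L
        + ∑ p ∈ nsplit2 J, δ K p.2 • γ I (p.1 ++ L)
        + ∑ p ∈ nsplit2 J, δ K p.1 • γ I (L ++ p.2)
        + ∑ p ∈ nsplit2 J, ∑ q ∈ nsplit2 K, δ q.1 p.2 • γ (I ++ q.2) (p.1 ++ L)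
        + ∑ p ∈ nsplit3 J, δ K p.2.1 • γ I (p.1 ++ L ++ p.2.2))
      + ∑ k ∈ nsplit2 K,
        (∑ q ∈ split2 k.2, δ q.1 J • γ (k.1 ++ I ++ q.2) L
          + ∑ p ∈ split2 J with p.2 ≠ [], δ k.2 p.1 • γ (k.1 ++ I) (L ++ p.2)
          + ∑ p ∈ split2 J with p.2 ≠ [], ∑ q ∈ split2 k.1, δ q.1 p.2 •
              ∑ r ∈ split2 p.1, δ k.2 r.1 • ft (I ++ q.2) (L ++ r.2)) := by
  have h1 : ∀ k ∈ nsplit2 K, ∑ q ∈ split2 k.2, δ q.1 J • γ (k.1 ++ I ++ q.2) L =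
      δ k.2 J • γ (k.1 ++ I) L + ∑ q ∈ nsplit2 k.2, δ q.1 J • γ (k.1 ++ I ++ q.2) L := by
    intro k hk
    rw [sum_split2_ne_nil (mem_nsplit2.1 hk).2.2, δ_of_ne hJ.symm]
    simp
  have h2 : ∀ k ∈ nsplit2 K, ∑ p ∈ split2 J with p.2 ≠ [], δ k.2 p.1 • γ (k.1 ++ I) (L ++ p.2) =
      ∑ p ∈ nsplit2 J, δ k.2 p.1 • γ (k.1 ++ I) (L ++ p.2) := by
    intro k hk
    rw [sum_split2_filter_right_of_zero _ _ (by simp [δ_of_ne (mem_nsplit2.1 hk).2.2])]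
  have h3 : ∀ k ∈ nsplit2 K, ∑ p ∈ split2 J with p.2 ≠ [], ∑ q ∈ split2 k.1, δ q.1 p.2 •
        ∑ r ∈ split2 p.1, δ k.2 r.1 • ft (I ++ q.2) (L ++ r.2) =
      ∑ p ∈ nsplit2 J,
        ((δ k.1 p.2 * δ k.2 p.1) • ft I L
          + ∑ r ∈ nsplit2 p.1, (δ k.1 p.2 * δ k.2 r.1) • ft I (r.2 ++ L)
          + ∑ q ∈ nsplit2 k.1, (δ q.1 p.2 * δ k.2 p.1) • ft (I ++ q.2) L
          + ∑ q ∈ nsplit2 k.1, ∑ r ∈ nsplit2 p.1,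
              (δ q.1 p.2 * δ k.2 r.1) • ft (I ++ q.2) (r.2 ++ L)) := by
    intro k hk
    obtain ⟨-, hk1, hk2⟩ := mem_nsplit2.1 hk
    rw [sum_split2_filter_right_of_zero]
    · refine Finset.sum_congr rfl fun p hp => ?_
      obtain ⟨-, hp1, hp2⟩ := mem_nsplit2.1 hp
      rw [sum_split2_ne_nil hk1]
      simp only [sum_split2_ne_nil hp1, δ_of_ne hp2.symm, δ_of_ne hk2, zero_smul, zero_add, zero_mul,
        Finset.sum_const_zero,
        List.append_nil, smul_add, Finset.smul_sum, smul_smul, Finset.sum_add_distrib, hft _ L]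
      abel
    · refine Finset.sum_eq_zero fun q _ => ?_
      rw [sum_split2_nil, δ_of_ne hk2]
      simp
  simp only [Finset.sum_add_distrib]
  rw [Finset.sum_congr rfl h1, Finset.sum_congr rfl h2, Finset.sum_congr rfl h3]
  have e11 : ∑ p ∈ nsplit3 J, ∑ q ∈ nsplit2 K, (δ q.1 p.2.2 * δ q.2 p.1) • ft I (p.2.1 ++ L) =
      ∑ k ∈ nsplit2 K, ∑ p ∈ nsplit2 J, ∑ r ∈ nsplit2 p.1,
        (δ k.1 p.2 * δ k.2 r.1) • ft I (r.2 ++ L) := by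
    rw [Finset.sum_comm]
    exact Finset.sum_congr rfl fun k _ => sum_nsplit3' J _
  have e12 : ∑ p ∈ nsplit2 J, ∑ q ∈ nsplit3 K, (δ q.1 p.2 * δ q.2.2 p.1) • ft (I ++ q.2.1) L =
      ∑ k ∈ nsplit2 K, ∑ p ∈ nsplit2 J, ∑ q ∈ nsplit2 k.1,
        (δ q.1 p.2 * δ k.2 p.1) • ft (I ++ q.2) L := by
    rw [Finset.sum_comm (s := nsplit2 K)]
    exact Finset.sum_congr rfl fun p _ => sum_nsplit3' K _
  have e13 : ∑ p ∈ nsplit3 J, ∑ q ∈ nsplit3 K,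
        (δ q.1 p.2.2 * δ q.2.2 p.1) • ft (I ++ q.2.1) (p.2.1 ++ L) =
      ∑ k ∈ nsplit2 K, ∑ p ∈ nsplit2 J, ∑ q ∈ nsplit2 k.1, ∑ r ∈ nsplit2 p.1,
        (δ q.1 p.2 * δ k.2 r.1) • ft (I ++ q.2) (r.2 ++ L) := by
    rw [sum_nsplit3', Finset.sum_comm (s := nsplit2 K)]
    refine Finset.sum_congr rfl fun p _ => ?_
    rw [Finset.sum_comm, sum_nsplit3']
  rw [gammaGamma, e11, e12, e13, sum_nsplit3 K,
    Finset.sum_comm (s := nsplit2 J) (t := nsplit2 K) (f := fun p q => (_ * _) • _),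
    Finset.sum_comm (s := nsplit2 J) (t := nsplit2 K) (f := fun p q => δ q.2 p.1 • _)]
  simp only [Finset.sum_add_distrib]
  abel

end Rotations

/-! ### Operators on cyclic words -/

section Cyclic

variable {A : Type*}

/-- The space spanned by all non-empty cyclic words. -/
def ClosedSpace (A : Type*) := ClosedStates A

instance : AddCommGroup (ClosedSpace A) := inferInstanceAs (AddCommGroup (ClosedStates A))

instance : Module ℂ (ClosedSpace A) := inferInstanceAs (Module ℂ (ClosedStates A))

/-- Endomorphisms of the space spanned by all non-empty cyclic words. -/
abbrev ClosedOp (A : Type*) := Module.End ℂ (ClosedSpace A)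

/-- The cyclic word of a word; it is zero for the empty word. -/
def cw (K : List A) : ClosedSpace A := Ψ K

@[simp] theorem cw_nil : cw ([] : List A) = 0 :=
  (dif_neg fun h => h rfl : Ψ ([] : List A) = 0)

theorem cw_of_ne {K : List A} (hK : K ≠ []) :
    cw K = (Finsupp.single (CWord.mk K hK) 1 : ClosedStates A) := dif_pos hK

theorem CWord.exists_mk (c : CWord A) : ∃ (w : List A) (h : w ≠ []), c = CWord.mk w h := by
  obtain ⟨c, hc⟩ := c
  induction c using Quotient.inductionOn with
  | h w => exact ⟨w, fun h => hc ((Cycle.coe_eq_nil w).2 h), rfl⟩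

theorem cw_rotate (K : List A) (k : ℕ) : cw (K.rotate k) = cw K := by
  by_cases hK : K = []
  · simp [hK]
  · rw [cw_of_ne hK, cw_of_ne (by simpa using hK)]
    congr 1
    exact Subtype.ext (Quotient.sound (List.IsRotated.symm ⟨k, rfl⟩))

theorem cw_append_comm (X Y : List A) : cw (X ++ Y) = cw (Y ++ X) := by
  rw [← cw_rotate (X ++ Y) X.length, List.rotate_append_length_eq]

theorem hom_ext_cw {V : Type*} [AddCommGroup V] [Module ℂ V] {X Y : ClosedSpace A →ₗ[ℂ] V}
    (h : ∀ W, W ≠ [] → X (cw W) = Y (cw W)) : X = Y := by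
  refine Finsupp.lhom_ext' (fun c => LinearMap.ext_ring ?_ :
    ∀ c : CWord A, (X : ClosedStates A →ₗ[ℂ] V) ∘ₗ Finsupp.lsingle c =
      (Y : ClosedStates A →ₗ[ℂ] V) ∘ₗ Finsupp.lsingle c)
  obtain ⟨w, hw, rfl⟩ := c.exists_mk
  have := h w hw
  rwa [cw_of_ne hw] at this

/-- The cyclic word of a word, as a linear map. -/
def close : WordSpace A →ₗ[ℂ] ClosedSpace A := wordLift cw

@[simp] theorem close_wd (W : List A) : close (wd W) = cw W := wordLift_wd _ _

/-- The sum of all words in a cyclic word. -/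
def unroll : ClosedSpace A →ₗ[ℂ] WordSpace A :=
  (Finsupp.linearCombination ℂ fun c : CWord A => Quotient.lift (rsum wd)
    (fun _ _ h => by obtain ⟨k, rfl⟩ := h; exact (rsum_rotate _ _ k).symm) c.1 :
    ClosedStates A →ₗ[ℂ] WordSpace A)

@[simp] theorem unroll_cw (K : List A) : unroll (cw K) = rsum wd K := by
  by_cases hK : K = []
  · simp [hK]
  · rw [cw_of_ne hK]
    exact (Finsupp.linearCombination_single ℂ 1 (CWord.mk K hK)).trans (one_smul _ _)

/-- The operator on cyclic words obtained by cutting the cyclic word in all possible ways. -/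
def cl : WordOp A →ₗ[ℂ] ClosedOp A where
  toFun X := close ∘ₗ X ∘ₗ unroll
  map_add' X Y := by simp [LinearMap.add_comp, LinearMap.comp_add]
  map_smul' c X := by simp [LinearMap.smul_comp, LinearMap.comp_smul]

theorem cl_cw (X : WordOp A) (K : List A) : cl X (cw K) = rsum (fun W => close (X (wd W))) K := by
  change close (X (unroll (cw K))) = _
  rw [unroll_cw, map_rsum, map_rsum]

theorem cl_mul (X Y : WordOp A) : cl (X * Y) = (close ∘ₗ X) ∘ₗ (Y ∘ₗ unroll) := rfl

/-- Composing on cyclic words inserts `unroll ∘ₗ close`, the sum over all ways of recutting the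
intermediate cyclic word. -/
theorem cl_mul_cl (X Y : WordOp A) : cl X * cl Y = cl (X * (unroll ∘ₗ close) * Y) := rfl

/-- Once the word is closed up, a suffix `K` is the same as a prefix standing before `I`. -/
theorem cl_cr_crR (I K : List A) (X : WordOp A) :
    cl (cr I * crR K * X) = cl (cr (K ++ I) * X) := by
  have : close ∘ₗ (cr I * crR K) = close ∘ₗ cr (K ++ I) := hom_ext_wd fun W => by
    simp only [LinearMap.comp_apply, Module.End.mul_apply, crR_wd, cr_wd, close_wd]
    rw [← List.append_assoc, cw_append_comm, List.append_assoc]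
  refine LinearMap.ext fun v => ?_
  exact LinearMap.congr_fun this (X (unroll v))

variable [DecidableEq A]

/-- Operators of the fourth kind on cyclic words. -/
def γc (I J : List A) : ClosedOp A := cl (lo I J)

/-- Operators of the fifth kind on cyclic words. -/
def ftc (I J : List A) : ClosedOp A := cl (fo I J)

theorem γc_cw (I J K : List A) :
    γc I J (cw K) = rsum (fun W => ∑ p ∈ split2 W, δ p.1 J • cw (I ++ p.2)) K := by
  simp [γc, cl_cw, lo, an_wd]

theorem ftc_cw (I J K : List A) : ftc I J (cw K) = rsum (fun W => δ W J) K • cw I := by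
  simp only [ftc, cl_cw, fo_wd, map_smul, close_wd]
  rw [rsum, rsum, Finset.sum_smul]

theorem ftc_append_left (X Y Z : List A) : ftc (X ++ Y) Z = ftc (Y ++ X) Z :=
  hom_ext_cw fun W _ => by rw [ftc_cw, ftc_cw, cw_append_comm]

/-- Counting rotations is symmetric in the two words by `rsum_δ_comm`, so the lower word too matters
only up to rotation. -/
theorem ftc_append_right (X Y Z : List A) : ftc Z (X ++ Y) = ftc Z (Y ++ X) :=
  hom_ext_cw fun W _ => by
    rw [ftc_cw, ftc_cw, rsum_δ_comm, rsum_δ_comm, ← rsum_rotate _ (X ++ Y) X.length,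
      List.rotate_append_length_eq]

theorem ftc_nil_left (J : List A) : ftc [] J = 0 := hom_ext_cw fun W _ => by simp [ftc_cw]

theorem ftc_nil_right (I : List A) : ftc I [] = 0 := hom_ext_cw fun W _ => by
  rw [ftc_cw, rsum_δ_comm, rsum_nil, zero_smul, LinearMap.zero_apply]

theorem unroll_close_mul_fo (K L : List A) :
    (unroll ∘ₗ close) * fo K L = rsum (fun W => fo W L) K := hom_ext_wd fun M => by
  simp only [Module.End.mul_apply, LinearMap.comp_apply, fo_wd, map_smul, close_wd, unroll_cw]
  rw [rsum, rsum, LinearMap.sum_apply, Finset.smul_sum]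
  simp only [fo_wd]

theorem fo_mul_unroll_close (K L : List A) :
    fo K L * (unroll ∘ₗ close) = rsum (fun W => fo K W) L := hom_ext_wd fun M => by
  simp only [Module.End.mul_apply, LinearMap.comp_apply, close_wd, unroll_cw, map_rsum, fo_wd]
  have h := congrArg (· • wd K) (rsum_δ_comm M L)
  simp only [rsum, Finset.sum_smul] at h ⊢
  simp only [h, LinearMap.sum_apply, fo_wd]

theorem ftc_mul_ftc (I J : List A) {K : List A} (hK : K ≠ []) (L : List A) :
    ftc I J * ftc K L = ftFt ftc I J K L := by
  rw [ftc, ftc, cl_mul_cl, mul_assoc, unroll_close_mul_fo, ftFt_eq _ _ _ hK]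
  simp only [rsum, Finset.mul_sum, fo_mul_fo, map_sum, map_smul, ftc]

theorem γc_mul_ftc (I : List A) {J K : List A} (hJ : J ≠ []) (hK : K ≠ []) (L : List A) :
    γc I J * ftc K L = gammaFtPlus ftc I J K L := by
  rw [γc, ftc, cl_mul_cl, mul_assoc, unroll_close_mul_fo,
    gammaFtPlus_eq _ ftc_append_left _ hJ hK]
  simp only [rsum, Finset.mul_sum, lo_mul_fo, map_sum, map_smul, ftc]

theorem ftc_mul_γc {I : List A} (J K : List A) {L : List A} (hI : I ≠ []) (hL : L ≠ []) :
    ftc K L * γc I J = gammaFtMinus ftc I J K L := by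
  rw [γc, ftc, cl_mul_cl, fo_mul_unroll_close, gammaFtMinus_eq _ ftc_append_right _ _ hI hL]
  simp only [rsum, Finset.sum_mul, fo_mul_lo, map_sum, map_smul, ftc]

/-- Cutting a cyclic word after a replacement: the new factor is either left intact or cut. -/
theorem unroll_close_lo_unroll {K L : List A} (hK : K ≠ []) (hL : L ≠ []) :
    (unroll ∘ₗ close) ∘ₗ lo K L ∘ₗ unroll =
      (γo K L + ∑ k ∈ nsplit2 K, crR k.1 * cr k.2 * an L) ∘ₗ unroll := hom_ext_cw fun M _ => by
  simp only [LinearMap.comp_apply, unroll_cw, map_rsum]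
  have h1 : ∀ W : List A, (unroll (close (lo K L (wd W)))) =
      ∑ p ∈ split2 W, ∑ q ∈ split2 p.1, δ q.1 L • wd (p.2 ++ K ++ q.2)
        + (∑ k ∈ nsplit2 K, crR k.1 * cr k.2 * an L) (wd W) := by
    intro W
    simp only [lo, Module.End.mul_apply, an_wd, map_sum, map_smul, cr_wd, close_wd, unroll_cw,
      rsum_append hK, smul_add, Finset.sum_add_distrib, LinearMap.sum_apply, crR_wd]
    have := sum_split2_assoc W fun t => δ t.1 L • wd (t.2.2 ++ K ++ t.2.1)
    simp only at this
    simp only [Finset.smul_sum]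
    rw [this, Finset.sum_comm (s := nsplit2 K)]
  have h2 : ∀ W : List A, γo K L (wd W) =
      ∑ p ∈ split2 W, ∑ q ∈ split2 p.2, δ q.1 L • wd (p.1 ++ K ++ q.2) := by
    intro W
    rw [γo_wd_of_ne hL, sum_split3]
  simp only [h1, LinearMap.add_apply, h2]
  rw [rsum_add, rsum_add]
  -- Here the intact `K` is placed between the two parts of the remaining word in swapped order.
  -- Over all rotations of the original word the swap is immaterial, which turns this sum into `γo K
  -- L`.
  rw [rsum_sum_split2_comm (fun U V => ∑ q ∈ split2 U, δ q.1 L • wd (V ++ K ++ q.2))]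

/-- The part of a product in which the two operators do not overlap is symmetric. -/
theorem cl_disjoint_comm (I K : List A) {J L : List A} (hJ : J ≠ []) (hL : L ≠ []) :
    cl (cr I * γo K L * an J) = cl (cr K * γo I J * an L) := hom_ext_cw fun M _ => by
  have h : ∀ (I K : List A) {J L : List A} (_ : J ≠ []) (_ : L ≠ []) (W : List A),
      close ((cr I * γo K L * an J) (wd W)) = ∑ p ∈ split2 W, ∑ q ∈ split2 p.1, ∑ r ∈ split2 p.2,
        (δ q.1 J * δ r.1 L) • cw (I ++ q.2 ++ K ++ r.2) := by
    intro I K J L hJ hL W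
    simp only [Module.End.mul_apply, an_wd, map_sum, map_smul, γo_wd_of_ne hL, cr_wd, close_wd,
      sum_split3]
    have := sum_split2_assoc W fun t => ∑ r ∈ split2 t.2.2,
      (δ t.1 J * δ r.1 L) • cw (I ++ t.2.1 ++ K ++ r.2)
    rw [← this]
    simp only [Finset.smul_sum, smul_smul, List.append_assoc]
  rw [cl_cw, cl_cw]
  simp only [h I K hJ hL, h K I hL hJ]
  -- Each operator acts at the beginning of one of two disjoint arcs. Exchanging the arcs exchanges
  -- the roles of the operators, and the resulting words differ by a rotation.
  rw [rsum_sum_split2_comm fun U V => ∑ q ∈ split2 U, ∑ r ∈ split2 V,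
    (δ q.1 J * δ r.1 L) • cw (I ++ q.2 ++ K ++ r.2)]
  congr 1
  funext W
  refine Finset.sum_congr rfl fun p _ => ?_
  rw [Finset.sum_comm]
  refine Finset.sum_congr rfl fun q _ => Finset.sum_congr rfl fun r _ => ?_
  rw [mul_comm, List.append_assoc (I ++ _), cw_append_comm]
  simp only [List.append_assoc]

/-- The inserted word has been cut, so the open word reads `k.2`, the rest, `k.1`. Removing `J` from
its front stops within `k.2`, stops in the rest, or uses up the rest and enters `k.1`. In the last
case the whole remaining word is fixed, giving matrix units and hence `ftc`. -/
theorem cl_wrap (I J L : List A) (k : List A × List A) :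
    cl (cr I * an J * (crR k.1 * cr k.2 * an L)) =
      ∑ q ∈ split2 k.2, δ q.1 J • γc (k.1 ++ I ++ q.2) L
        + ∑ p ∈ split2 J with p.2 ≠ [], δ k.2 p.1 • γc (k.1 ++ I) (L ++ p.2)
        + ∑ p ∈ split2 J with p.2 ≠ [], ∑ q ∈ split2 k.1, δ q.1 p.2 •
            ∑ r ∈ split2 p.1, δ k.2 r.1 • ftc (I ++ q.2) (L ++ r.2) := by
  have h0 : cr I * an J * (crR k.1 * cr k.2 * an L) =
      cr I * crR k.1 * (an J * cr k.2 * an L) +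
        ∑ p ∈ split2 J with p.2 ≠ [], ∑ q ∈ split2 k.1, δ q.1 p.2 •
          ∑ r ∈ split2 p.1, δ k.2 r.1 • fo (I ++ q.2) (L ++ r.2) := by
    have : cr I * an J * (crR k.1 * cr k.2 * an L) = cr I * (an J * crR k.1) * (lo k.2 L) := by
      simp only [lo, mul_assoc]
    rw [this, an_mul_crR, mul_add, add_mul]
    refine congrArg₂ _ ?_ ?_
    · simp only [lo, mul_assoc]
    · simp only [Finset.mul_sum, Finset.sum_mul, mul_smul_comm, smul_mul_assoc, cr_mul_fo,
        fo_mul_lo]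
  rw [h0, map_add, cl_cr_crR, an_mul_cr]
  simp only [mul_add, add_mul, Finset.mul_sum, Finset.sum_mul, mul_smul_comm, smul_mul_assoc,
    map_add, map_sum, map_smul, γc, ftc, lo, cr_append, an_append, mul_assoc]

/-- After the first replacement, the new cut leaves `K` intact, giving `an J * γo K L` with its
disjoint term and overlaps, or cuts `K`, giving `cl_wrap`. The overlaps of both types make up
`gammaGamma`. -/
theorem γc_mul_γc (I : List A) {J K L : List A} (hJ : J ≠ []) (hK : K ≠ [])
    (hL : L ≠ []) :
    γc I J * γc K L = cl (cr I * γo K L * an J) + gammaGamma γc ftc I J K L := by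
  have h0 : γc I J * γc K L = cl (cr I * an J * γo K L
      + ∑ k ∈ nsplit2 K, cr I * an J * (crR k.1 * cr k.2 * an L)) := by
    have h1 := congrArg (fun T => close ∘ₗ lo I J ∘ₗ T) (unroll_close_lo_unroll hK hL)
    have h2 : cr I * an J * γo K L + ∑ k ∈ nsplit2 K, cr I * an J * (crR k.1 * cr k.2 * an L) =
        lo I J * (γo K L + ∑ k ∈ nsplit2 K, crR k.1 * cr k.2 * an L) := by
      rw [mul_add, Finset.mul_sum, lo]
    rw [h2]
    exact h1
  rw [h0, mul_assoc (cr I) (an J) (γo K L), an_mul_γo _ _ hL, mul_add, cr_mul_sum_overlap I J hK,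
    gammaGamma_eq _ _ ftc_append_right _ hJ, map_add, map_add, map_sum,
    Finset.sum_congr rfl fun k _ => cl_wrap I J L k, ← mul_assoc, add_assoc]
  simp only [map_add, map_sum, map_smul, γc]

theorem γc_lie_γc {I J K L : List A} (hI : I ≠ []) (hJ : J ≠ []) (hK : K ≠ []) (hL : L ≠ []) :
    γc I J * γc K L - γc K L * γc I J =
      gammaGamma γc ftc I J K L - gammaGamma γc ftc K L I J := by
  rw [γc_mul_γc I hJ hK hL, γc_mul_γc K hL hI hJ, cl_disjoint_comm I K hJ hL, add_sub_add_left_eq_sub]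

theorem gammaΨ_eq (I : List A) {J K : List A} (hJ : J ≠ []) (hK : K ≠ []) :
    γc I J (cw K) = gammaΨ I J K := by
  have h : ∑ p ∈ nsplit2 J, ∑ q ∈ nsplit3 K, (δ q.2.2 p.1 * δ q.1 p.2) • cw (I ++ q.2.1) =
      ∑ q ∈ nsplit3 K, δ (q.2.2 ++ q.1) J • cw (I ++ q.2.1) := by
    rw [Finset.sum_comm]
    refine Finset.sum_congr rfl fun q hq => ?_
    obtain ⟨-, h1, -, h3⟩ := mem_nsplit3.1 hq
    rw [δ_append' h3 h1, Finset.sum_smul]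
  rw [γc_cw, rsum_prefix hK (fun X => δ X J) (δ_of_ne hJ.symm) cw, ← h]
  rfl

theorem ftΨ_eq (I : List A) {J : List A} (hJ : J ≠ []) (K : List A) :
    ftc I J (cw K) = ftΨ I J K := by
  rw [ftc_cw, rsum_δ_comm, rsum_eq hJ, add_smul, Finset.sum_smul]
  rfl

/-- Completeness: removing the first letter and restoring it is the identity except on the empty
word. -/
theorem sum_cr_mul_an [Fintype A] : ∑ k : A, cr [k] * an [k] = 1 - fo [] [] :=
  hom_ext_wd fun W => by
    rw [LinearMap.sub_apply, LinearMap.sum_apply]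
    cases W with
    | nil => simp
    | cons x W =>
      rw [Finset.sum_eq_single x]
      · simp
      · intro k _ hk
        simp [δ_of_ne hk.symm]
      · simp

theorem sum_crR_mul_anR [Fintype A] : ∑ k : A, crR [k] * anR [k] = 1 - fo [] [] := by
  have h : ∀ k : A, crR [k] * anR [k] = rev * (cr [k] * an [k]) * rev := fun k => by
    rw [anR_eq, ← mul_assoc, ← mul_assoc, ← mul_assoc, rev_mul_cr]
    rfl
  simp only [h]
  rw [← Finset.sum_mul, ← Finset.mul_sum, sum_cr_mul_an, mul_sub, sub_mul, mul_one, rev_mul_rev,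
    rev_mul_fo, mul_assoc, rev_mul_rev]
  rfl

/-- On cyclic words, operators of the fifth kind are differences of operators of the fourth. -/
theorem ftc_eq_sub_right [Fintype A] (I J : List A) :
    ftc I J = γc I J - ∑ k, γc (I ++ [k]) (J ++ [k]) := by
  have h : fo I J = lo I J - ∑ k, lo (I ++ [k]) (J ++ [k]) := by
    have h1 : ∑ k, lo (I ++ [k]) (J ++ [k]) = cr I * (∑ k, cr [k] * an [k]) * an J := by
      rw [Finset.mul_sum, Finset.sum_mul]
      simp only [lo, cr_append, an_append, mul_assoc]
    rw [h1, sum_cr_mul_an, mul_sub, sub_mul, mul_one, cr_mul_fo, fo_mul_an, List.append_nil,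
      List.append_nil, lo, sub_sub_cancel]
  rw [ftc, h, map_sub, map_sum]
  rfl

/-- After unrolling, every rotation is present, so prefixes and suffixes are on the same footing. -/
theorem anR_comp_unroll (J : List A) : anR J ∘ₗ unroll = an J ∘ₗ unroll :=
  hom_ext_cw fun M _ => by
    simp only [LinearMap.comp_apply, unroll_cw, map_rsum, anR_wd, an_wd]
    exact rsum_sum_split2_comm (fun U V => δ V J • wd U) M

/-- Around the cyclic word, the first letter can be removed and restored at the end instead. The two
completeness relations, for first and last letters, have the same right-hand side. -/
theorem sum_γc_cons [Fintype A] (I J : List A) :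
    ∑ k, γc (k :: I) (k :: J) = ∑ k, γc (I ++ [k]) (J ++ [k]) := by
  have h1 : ∀ k, γc (k :: I) (k :: J) = cl (cr I * (crR [k] * anR [k]) * an J) := fun k => by
    have h2 : cl (cr (k :: I) * an J * an [k]) = cl (cr (k :: I) * an J * anR [k]) := by
      rw [cl_mul, cl_mul, anR_comp_unroll]
    rw [γc, lo, an_cons, ← mul_assoc, h2, ← List.singleton_append, mul_assoc, ← cl_cr_crR,
      an_mul_anR]
    simp only [mul_assoc]
  have h2 : ∀ k, γc (I ++ [k]) (J ++ [k]) = cl (cr I * (cr [k] * an [k]) * an J) := fun k => by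
    rw [γc, lo, cr_append, an_append]
    simp only [mul_assoc]
  simp only [h1, h2]
  rw [← map_sum, ← map_sum, ← Finset.sum_mul, ← Finset.sum_mul, ← Finset.mul_sum, ← Finset.mul_sum,
    sum_cr_mul_an, sum_crR_mul_anR]

theorem ftc_eq_sub_left [Fintype A] (I J : List A) :
    ftc I J = γc I J - ∑ k, γc (k :: I) (k :: J) := by
  rw [sum_γc_cons, ftc_eq_sub_right]

end Cyclic

/-! ### Lie structures from faithful representations -/

section LieStructures

variable {α : Type*}

theorem bilin_skew {V W : Type*} [AddCommGroup V] [Module ℂ V] [AddCommGroup W] [Module ℂ W]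
    {B : V →ₗ[ℂ] V →ₗ[ℂ] W} (hB : ∀ x, B x x = 0) (x y : V) : B y x = -B x y := by
  have h := hB (x + y)
  simp only [map_add, LinearMap.add_apply, hB, zero_add, add_zero] at h
  exact eq_neg_of_add_eq_zero_left h

/-- Alternating bilinear maps agree if they agree on the pairs of basis vectors, in some order. -/
theorem bilin_ext {W : Type*} [AddCommGroup W] [Module ℂ W]
    {B C : (α →₀ ℂ) →ₗ[ℂ] (α →₀ ℂ) →ₗ[ℂ] W} (hB : ∀ x, B x x = 0) (hC : ∀ x, C x x = 0)
    (h : ∀ i j, B (Finsupp.single i 1) (Finsupp.single j 1) =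
        C (Finsupp.single i 1) (Finsupp.single j 1) ∨
      B (Finsupp.single j 1) (Finsupp.single i 1) =
        C (Finsupp.single j 1) (Finsupp.single i 1)) : B = C := by
  refine Finsupp.lhom_ext' fun i => LinearMap.ext_ring (Finsupp.lhom_ext' fun j =>
    LinearMap.ext_ring ?_)
  rcases h i j with h | h
  · exact h
  · change B (Finsupp.single i 1) (Finsupp.single j 1) = C (Finsupp.single i 1) (Finsupp.single j 1)
    rw [bilin_skew hB, bilin_skew hC, h]

/-- A linear injection into a Lie algebra whose range is closed under the bracket pulls the
bracket back. -/
theorem exists_lieStructure {E : Type*} [LieRing E] [LieAlgebra ℂ E] (ρ : (α →₀ ℂ) →ₗ[ℂ] E)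
    (hρ : Function.Injective ρ)
    (h : ∀ i j, (∃ z, ρ z = ⁅ρ (Finsupp.single i 1), ρ (Finsupp.single j 1)⁆) ∨
      ∃ z, ρ z = ⁅ρ (Finsupp.single j 1), ρ (Finsupp.single i 1)⁆) :
    ∃ S : LieStructure (α →₀ ℂ), ∀ x y, ρ (S.br x y) = ⁅ρ x, ρ y⁆ := by
  obtain ⟨g, hg⟩ := ρ.exists_leftInverse_of_injective (LinearMap.ker_eq_bot.2 hρ)
  have hg' : ∀ x, g (ρ x) = x := fun x => LinearMap.congr_fun hg x
  have h' : ∀ i j, ∃ z, ρ z = ⁅ρ (Finsupp.single i 1), ρ (Finsupp.single j 1)⁆ := by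
    intro i j
    rcases h i j with h | ⟨z, hz⟩
    · exact h
    · exact ⟨-z, by rw [map_neg, hz, lie_skew]⟩
  have hcl : ∀ x y, ⁅ρ x, ρ y⁆ ∈ LinearMap.range ρ := by
    intro x y
    induction x using Finsupp.induction_linear with
    | zero => simp
    | add x x' hx hx' => rw [map_add, add_lie]; exact add_mem hx hx'
    | single i c =>
      induction y using Finsupp.induction_linear with
      | zero => simp
      | add y y' hy hy' => rw [map_add, lie_add]; exact add_mem hy hy'
      | single j d =>
        rw [← mul_one c, ← mul_one d, ← smul_eq_mul, ← smul_eq_mul, ← Finsupp.smul_single,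
          ← Finsupp.smul_single, map_smul, map_smul, smul_lie, lie_smul]
        exact Submodule.smul_mem _ _ (Submodule.smul_mem _ _ (h' i j))
  have hbr : ∀ x y, ρ (g ⁅ρ x, ρ y⁆) = ⁅ρ x, ρ y⁆ := by
    intro x y
    obtain ⟨z, hz⟩ := hcl x y
    rw [← hz, hg']
  -- The bracket is the commutator pulled back by a left inverse `g` of `ρ`. By `hbr`, applying `ρ`
  -- recovers the commutator exactly, so Jacobi can be checked after applying the injection.
  refine ⟨⟨LinearMap.mk₂ ℂ (fun x y => g ⁅ρ x, ρ y⁆) ?_ ?_ ?_ ?_, ?_, ?_⟩, ?_⟩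
  · intro x y z; simp
  · intro c x y; simp
  · intro x y z; simp
  · intro c x y; simp
  · intro x; simp
  · intro x y z
    refine hρ ?_
    simp only [LinearMap.mk₂_apply, map_add, hbr]
    exact (congrArg (fun t => ρ (g t)) (leibniz_lie (ρ x) (ρ y) (ρ z))).trans (by simp)
  · exact hbr

end LieStructures

/-! ### The heterix algebra -/

section Heterix

variable {A : Type*}

theorem gamma'_of_ne {I J : List A} (hI : I ≠ []) (hJ : J ≠ []) :
    gamma' I J = Finsupp.single (Sum.inl (⟨I, hI⟩, ⟨J, hJ⟩)) 1 := dif_pos ⟨hI, hJ⟩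

theorem ft'_of_ne {I J : List A} (hI : I ≠ []) (hJ : J ≠ []) :
    ft' I J = Finsupp.single (Sum.inr (CWord.mk I hI, CWord.mk J hJ)) 1 := dif_pos ⟨hI, hJ⟩

theorem heterix_index_cases {P : HeterixSpace A → Prop}
    (hγ : ∀ I J, I ≠ [] → J ≠ [] → P (gamma' I J)) (hft : ∀ I J, I ≠ [] → J ≠ [] → P (ft' I J))
    (i : (Word A × Word A) ⊕ (CWord A × CWord A)) : P (Finsupp.single i 1) := by
  rcases i with ⟨⟨I, hI⟩, ⟨J, hJ⟩⟩ | ⟨c, d⟩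
  · have := hγ I J hI hJ
    rwa [gamma'_of_ne hI hJ] at this
  · obtain ⟨I, hI, rfl⟩ := c.exists_mk
    obtain ⟨J, hJ, rfl⟩ := d.exists_mk
    have := hft I J hI hJ
    rwa [ft'_of_ne hI hJ] at this

theorem closedBrackets_unique [DecidableEq A]
    {B C : HeterixSpace A →ₗ[ℂ] HeterixSpace A →ₗ[ℂ] HeterixSpace A}
    (hB : ∀ x, B x x = 0) (hC : ∀ x, C x x = 0) (h : ClosedBrackets gamma' ft' B)
    (h' : ClosedBrackets gamma' ft' C) : B = C := by
  refine bilin_ext hB hC fun i j => ?_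
  refine heterix_index_cases (P := fun x => B x (Finsupp.single j 1) = C x (Finsupp.single j 1) ∨
    B (Finsupp.single j 1) x = C (Finsupp.single j 1) x) (fun I J hI hJ => ?_)
    (fun I J hI hJ => ?_) i
  · refine heterix_index_cases (P := fun x => B (gamma' I J) x = C (gamma' I J) x ∨
      B x (gamma' I J) = C x (gamma' I J)) (fun K L hK hL => ?_) (fun K L hK hL => ?_) j
    · exact Or.inl (by rw [h.gamma_gamma I J K L hI hJ hK hL, h'.gamma_gamma I J K L hI hJ hK hL])
    · exact Or.inl (by rw [h.gamma_ft I J K L hI hJ hK hL, h'.gamma_ft I J K L hI hJ hK hL])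
  · refine heterix_index_cases (P := fun x => B (ft' I J) x = C (ft' I J) x ∨
      B x (ft' I J) = C x (ft' I J)) (fun K L hK hL => ?_) (fun K L hK hL => ?_) j
    -- The mixed bracket is prescribed only with the fourth kind on the left, so the swapped pair is
    -- compared here.
    · exact Or.inr (by rw [h.gamma_ft K L I J hK hL hI hJ, h'.gamma_ft K L I J hK hL hI hJ])
    · exact Or.inl (by rw [h.ft_ft I J K L hI hJ hK hL, h'.ft_ft I J K L hI hJ hK hL])

/-- A representative of a cyclic word. -/
def CWord.rep (c : CWord A) : List A := Quotient.out c.1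

theorem CWord.mk_rep_isRotated {I : List A} (hI : I ≠ []) : (CWord.mk I hI).rep ~r I :=
  Quotient.exact (Quotient.out_eq (I : Cycle A))

/-- Coefficients of closed singlet states. -/
def ccoef (c : CWord A) : ClosedSpace A →ₗ[ℂ] ℂ :=
  (Finsupp.lapply c : (CWord A →₀ ℂ) →ₗ[ℂ] ℂ)

theorem ccoef_cw {K : List A} (hK : K ≠ []) : ccoef (CWord.mk K hK) (cw K) = 1 := by
  rw [cw_of_ne hK]
  exact Finsupp.single_eq_same

theorem ccoef_cw_of_ne {c : CWord A} {K : List A} (hK : K ≠ []) (h : CWord.mk K hK ≠ c) :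
    ccoef c (cw K) = 0 := by
  rw [cw_of_ne hK]
  exact Finsupp.single_eq_of_ne h.symm

theorem CWord.rep_ne_nil (c : CWord A) : c.rep ≠ [] := by
  obtain ⟨I, hI, rfl⟩ := c.exists_mk
  intro h
  have := CWord.mk_rep_isRotated hI
  rw [h, List.isRotated_nil_iff'] at this
  exact hI this.symm

theorem CWord.mk_rep (c : CWord A) : CWord.mk c.rep c.rep_ne_nil = c :=
  Subtype.ext (Quotient.out_eq c.1)

/-- The commutator of two pairs of operators. -/
theorem prod_lie (x y : WordOp A × ClosedOp A) :
    ⁅x, y⁆ = (x.1 * y.1 - y.1 * x.1, x.2 * y.2 - y.2 * x.2) := rfl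

variable [DecidableEq A]

/-- Makes `heterixClosed`, which is defined through chosen representatives of cyclic words,
independent of the choice. -/
theorem ftc_isRotated {I I' J J' : List A} (hI : I ~r I') (hJ : J ~r J') :
    ftc I J = ftc I' J' := by
  obtain ⟨k, rfl⟩ := hI
  obtain ⟨m, rfl⟩ := hJ
  refine hom_ext_cw fun W _ => ?_
  rw [ftc_cw, ftc_cw, cw_rotate, rsum_δ_comm W, rsum_δ_comm W, rsum_rotate]

/-- The action of the heterix algebra on open singlet states. -/
def heterixOpen : HeterixSpace A →ₗ[ℂ] WordOp A :=
  Finsupp.linearCombination ℂ (Sum.elim (fun p => γo p.1.1 p.2.1) fun _ => 0)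

/-- The action of the heterix algebra on closed singlet states. -/
def heterixClosed : HeterixSpace A →ₗ[ℂ] ClosedOp A :=
  Finsupp.linearCombination ℂ
    (Sum.elim (fun p => γc p.1.1 p.2.1) fun p => ftc p.1.rep p.2.rep)

theorem heterixOpen_gamma' {I J : List A} (hI : I ≠ []) (hJ : J ≠ []) :
    heterixOpen (gamma' I J) = γo I J := by
  rw [gamma'_of_ne hI hJ]
  exact (Finsupp.linearCombination_single ℂ 1 _).trans (one_smul _ _)

theorem heterixOpen_ft' (I J : List A) : heterixOpen (ft' I J) = 0 := by
  rw [ft']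
  split_ifs with h
  · exact (Finsupp.linearCombination_single ℂ 1 _).trans (one_smul _ _)
  · exact map_zero _

theorem heterixClosed_gamma' {I J : List A} (hI : I ≠ []) (hJ : J ≠ []) :
    heterixClosed (gamma' I J) = γc I J := by
  rw [gamma'_of_ne hI hJ]
  exact (Finsupp.linearCombination_single ℂ 1 _).trans (one_smul _ _)

theorem heterixClosed_ft' (I J : List A) : heterixClosed (ft' I J) = ftc I J := by
  rw [ft']
  split_ifs with h
  · exact ((Finsupp.linearCombination_single ℂ 1 _).trans (one_smul _ _)).trans
      (ftc_isRotated (CWord.mk_rep_isRotated h.1) (CWord.mk_rep_isRotated h.2))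
  · rw [not_and_or, not_not, not_not] at h
    rcases h with rfl | rfl
    · rw [ftc_nil_left]; exact map_zero _
    · rw [ftc_nil_right]; exact map_zero _

/-! ### Faithfulness -/

/-- A factor at least as long as the word can only be the entire word. -/
theorem γo_wd_of_length_le (I : List A) {J W : List A} (hJ : J ≠ []) (h : W.length ≤ J.length) :
    γo I J (wd W) = δ W J • wd I := by
  rw [γo_wd_of_ne hJ, Finset.sum_eq_single ([], W, [])]
  · simp
  · rintro ⟨a, b, c⟩ ht hne
    rw [mem_split3] at ht
    simp only at ht ⊢
    by_cases hb : b = J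
    · subst hb
      exfalso
      have hl := congrArg List.length ht
      simp only [List.length_append] at hl
      have ha : a = [] := List.length_eq_zero_iff.1 (by omega)
      have hc : c = [] := List.length_eq_zero_iff.1 (by omega)
      subst ha hc
      exact hne (by simpa using ht)
    · rw [δ_of_ne hb, zero_smul]
  · intro hn
    exact absurd (mem_split3.2 (by simp)) hn

theorem rsum_δ_ne_zero {J J' : List A} (hJ : J ≠ []) (h : J' ~r J) :
    rsum (fun W => δ W J') J ≠ 0 := by
  obtain ⟨k, rfl⟩ := h
  rw [rsum_rotate]
  have hJ' : J' ≠ [] := fun h => hJ (by simp [h])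
  simp only [rsum, δ]
  rw [Finset.sum_boole, Nat.cast_ne_zero]
  refine Finset.card_ne_zero_of_mem (a := 0) ?_
  simpa using List.length_pos_iff.2 hJ'

theorem rsum_δ_eq_zero {J J' : List A} (h : ¬ J' ~r J) : rsum (fun W => δ W J') J = 0 :=
  Finset.sum_eq_zero fun k _ => δ_of_ne fun hk => h (List.IsRotated.symm ⟨k, hk⟩)

/-- Coefficients of open singlet states. -/
def wcoef (I : List A) : WordSpace A →ₗ[ℂ] ℂ :=
  (Finsupp.lapply I : (List A →₀ ℂ) →ₗ[ℂ] ℂ)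

theorem wcoef_wd (I W : List A) : wcoef I (wd W) = δ W I := by
  change (Finsupp.single W (1 : ℂ)) I = _
  rw [Finsupp.single_apply, δ]

/-- Triangularity in the length of the lower word. Evaluated on a word of length `n`, operators with
lower word of length at least `n` act as matrix units; the coefficients of those with a shorter one
vanish by induction. -/
theorem heterix_coef_inl_eq_zero {x : HeterixSpace A} (hx : heterixOpen x = 0) (n : ℕ) :
    ∀ I J : Word A, J.1.length = n → x (Sum.inl (I, J)) = 0 := by
  induction n using Nat.strong_induction_on with
  | _ n ih =>
    rintro I J hJ
    have h0 : wcoef I.1 (heterixOpen x (wd J.1)) = 0 := by rw [hx]; simp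
    have h1 : heterixOpen x = ∑ a ∈ x.support, x a •
        (Sum.elim (fun p => γo p.1.1 p.2.1) fun _ => 0 :
          ((Word A × Word A) ⊕ (CWord A × CWord A)) → WordOp A) a :=
      Finsupp.linearCombination_apply _ _
    rw [h1, LinearMap.sum_apply, map_sum, Finset.sum_eq_single (Sum.inl (I, J))] at h0
    · simpa [γo_wd_of_length_le _ J.2 le_rfl, wcoef_wd] using h0
    · rintro (⟨I', J'⟩ | p) - hne
      · rw [LinearMap.smul_apply, map_smul, smul_eq_mul]
        rcases lt_or_ge J'.1.length n with hlt | hge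
        · rw [ih _ hlt I' J' rfl, zero_mul]
        · rw [Sum.elim_inl, γo_wd_of_length_le _ J'.2 (hJ.le.trans hge), map_smul, wcoef_wd,
            smul_eq_mul]
          by_cases hJJ : J = J'
          · subst hJJ
            have : I' ≠ I := fun h => hne (by rw [h])
            rw [δ_of_ne fun h => this (Subtype.ext h), mul_zero, mul_zero]
          · rw [δ_of_ne fun h => hJJ (Subtype.ext h), zero_mul, mul_zero]
      · simp
    · intro hns
      rw [Finsupp.notMem_support_iff.1 hns]
      simp

/-- Without the fourth kind, what remains are matrix units on cyclic words, multiplied by a non-zero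
number of coincident rotations; the state `d` and the coefficient at `c` isolate one of them. -/
theorem heterix_coef_inr_eq_zero {x : HeterixSpace A} (hx : heterixClosed x = 0)
    (h : ∀ I J : Word A, x (Sum.inl (I, J)) = 0) (c d : CWord A) : x (Sum.inr (c, d)) = 0 := by
  have h0 : ccoef c (heterixClosed x (cw d.rep)) = 0 := by rw [hx]; simp
  have h1 : heterixClosed x = ∑ a ∈ x.support, x a •
      (Sum.elim (fun p => γc p.1.1 p.2.1) fun p => ftc p.1.rep p.2.rep :
        ((Word A × Word A) ⊕ (CWord A × CWord A)) → ClosedOp A) a :=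
    Finsupp.linearCombination_apply _ _
  rw [h1, LinearMap.sum_apply, map_sum, Finset.sum_eq_single (Sum.inr (c, d))] at h0
  · rw [LinearMap.smul_apply, map_smul, Sum.elim_inr, ftc_cw, map_smul] at h0
    have h2 := ccoef_cw c.rep_ne_nil
    rw [c.mk_rep] at h2
    rw [h2, smul_eq_mul, smul_eq_mul, mul_one] at h0
    exact (mul_eq_zero.1 h0).resolve_right
      (rsum_δ_ne_zero d.rep_ne_nil (List.IsRotated.refl _))
  · rintro (⟨I', J'⟩ | ⟨c', d'⟩) - hne
    · rw [h, zero_smul]; simp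
    · rw [LinearMap.smul_apply, map_smul, Sum.elim_inr, ftc_cw, map_smul]
      by_cases hd : d'.rep ~r d.rep
      · have hd' : d' = d := by
          rw [← d'.mk_rep, ← d.mk_rep]
          exact Subtype.ext (Quotient.sound hd)
        have hc : c' ≠ c := fun hc => hne (by rw [hc, hd'])
        rw [ccoef_cw_of_ne c'.rep_ne_nil (by rwa [c'.mk_rep]), smul_zero, smul_zero]
      · rw [rsum_δ_eq_zero hd, zero_smul, smul_zero]
  · intro hns
    rw [Finsupp.notMem_support_iff.1 hns]
    simp

theorem heterix_faithful {x : HeterixSpace A} (ho : heterixOpen x = 0)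
    (hc : heterixClosed x = 0) : x = 0 := by
  have h1 : ∀ I J : Word A, x (Sum.inl (I, J)) = 0 := fun I J =>
    heterix_coef_inl_eq_zero ho _ I J rfl
  ext (⟨I, J⟩ | ⟨c, d⟩)
  · exact h1 I J
  · exact heterix_coef_inr_eq_zero hc h1 c d

/-! ### The bracket of the heterix algebra -/

/-- The actions of the heterix algebra on open and on closed singlet states. -/
def heterixRep : HeterixSpace A →ₗ[ℂ] WordOp A × ClosedOp A := heterixOpen.prod heterixClosed

theorem heterixRep_injective : Function.Injective (heterixRep (A := A)) := by
  refine (injective_iff_map_eq_zero _).2 fun x hx => ?_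
  exact heterix_faithful (congrArg Prod.fst hx) (congrArg Prod.snd hx)

theorem heterixRep_gammaGamma {I J K L : List A} (hI : I ≠ []) (hL : L ≠ []) :
    heterixRep (gammaGamma gamma' ft' I J K L) =
      (gammaGamma γo (fun _ _ => 0) I J K L, gammaGamma γc ftc I J K L) := by
  refine Prod.ext ?_ ?_
  · refine (map_gammaGamma (V := HeterixSpace A) (W := WordOp A) heterixOpen _ _ I J K L).trans ?_
    exact gammaGamma_congr (fun M N hM hN => heterixOpen_gamma' hM hN)
      (fun M N _ _ => heterixOpen_ft' M N) hI hL
  · refine (map_gammaGamma (V := HeterixSpace A) (W := ClosedOp A) heterixClosed _ _ I J K L).trans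
      ?_
    exact gammaGamma_congr (fun M N hM hN => heterixClosed_gamma' hM hN)
      (fun M N _ _ => heterixClosed_ft' M N) hI hL

theorem heterixRep_gammaFtPlus (I J K L : List A) :
    heterixRep (gammaFtPlus ft' I J K L) = (0, gammaFtPlus ftc I J K L) := by
  refine Prod.ext ?_ ?_
  · refine (map_gammaFtPlus (V := HeterixSpace A) (W := WordOp A) heterixOpen _ I J K L).trans ?_
    simp [gammaFtPlus, heterixOpen_ft']
  · refine (map_gammaFtPlus (V := HeterixSpace A) (W := ClosedOp A) heterixClosed _ I J K L).trans ?_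
    simp only [heterixClosed_ft']

theorem heterixRep_gammaFtMinus (I J K L : List A) :
    heterixRep (gammaFtMinus ft' I J K L) = (0, gammaFtMinus ftc I J K L) := by
  refine Prod.ext ?_ ?_
  · refine (map_gammaFtMinus (V := HeterixSpace A) (W := WordOp A) heterixOpen _ I J K L).trans ?_
    simp [gammaFtMinus, heterixOpen_ft']
  · refine (map_gammaFtMinus (V := HeterixSpace A) (W := ClosedOp A) heterixClosed _ I J K L).trans
      ?_
    simp only [heterixClosed_ft']

theorem heterixRep_ftFt (I J K L : List A) :
    heterixRep (ftFt ft' I J K L) = (0, ftFt ftc I J K L) := by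
  refine Prod.ext ?_ ?_
  · refine (map_ftFt (V := HeterixSpace A) (W := WordOp A) heterixOpen _ I J K L).trans ?_
    simp [ftFt, heterixOpen_ft']
  · refine (map_ftFt (V := HeterixSpace A) (W := ClosedOp A) heterixClosed _ I J K L).trans ?_
    simp only [heterixClosed_ft']

theorem heterixRep_gamma' {I J : List A} (hI : I ≠ []) (hJ : J ≠ []) :
    heterixRep (gamma' I J) = (γo I J, γc I J) :=
  Prod.ext (heterixOpen_gamma' hI hJ) (heterixClosed_gamma' hI hJ)

theorem heterixRep_ft' (I J : List A) : heterixRep (ft' I J) = (0, ftc I J) :=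
  Prod.ext (heterixOpen_ft' I J) (heterixClosed_ft' I J)

theorem heterixRep_lie_gamma' {I J K L : List A} (hI : I ≠ []) (hJ : J ≠ []) (hK : K ≠ [])
    (hL : L ≠ []) : heterixRep (gammaGamma gamma' ft' I J K L - gammaGamma gamma' ft' K L I J) =
      ⁅heterixRep (gamma' I J), heterixRep (gamma' K L)⁆ := by
  rw [heterixRep_gamma' hI hJ, heterixRep_gamma' hK hL, prod_lie, γo_lie_γo hI hJ hK hL,
    γc_lie_γc hI hJ hK hL, map_sub, heterixRep_gammaGamma hI hL, heterixRep_gammaGamma hK hJ]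
  rfl

theorem heterixRep_lie_gamma'_ft' {I J K L : List A} (hI : I ≠ []) (hJ : J ≠ []) (hK : K ≠ [])
    (hL : L ≠ []) : heterixRep (gammaFtPlus ft' I J K L - gammaFtMinus ft' I J K L) =
      ⁅heterixRep (gamma' I J), heterixRep (ft' K L)⁆ := by
  rw [heterixRep_gamma' hI hJ, heterixRep_ft' K L, prod_lie, map_sub, heterixRep_gammaFtPlus,
    heterixRep_gammaFtMinus, γc_mul_ftc I hJ hK, ftc_mul_γc J K hI hL, mul_zero, zero_mul]
  rfl

theorem heterixRep_lie_ft' {I J K L : List A} (hI : I ≠ []) (hK : K ≠ []) :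
    heterixRep (ftFt ft' I J K L - ftFt ft' K L I J) =
      ⁅heterixRep (ft' I J), heterixRep (ft' K L)⁆ := by
  rw [heterixRep_ft' I J, heterixRep_ft' K L, prod_lie, map_sub, heterixRep_ftFt, heterixRep_ftFt,
    ftc_mul_ftc I J hK, ftc_mul_ftc K L hI, mul_zero]
  rfl

/-- The product formulas show that the range is closed under commutators; injectivity then
transports them back to the formal bracket. -/
theorem exists_heterix (A : Type*) [DecidableEq A] : ∃ H : LieStructure (HeterixSpace A),
    (∀ x y, heterixRep (H.br x y) = ⁅heterixRep x, heterixRep y⁆) ∧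
      ClosedBrackets gamma' ft' H.br := by
  obtain ⟨H, hH⟩ := exists_lieStructure (heterixRep (A := A)) heterixRep_injective (by
    intro i j
    refine heterix_index_cases (P := fun x =>
      (∃ z, heterixRep z = ⁅heterixRep x, heterixRep (Finsupp.single j 1)⁆) ∨
        ∃ z, heterixRep z = ⁅heterixRep (Finsupp.single j 1), heterixRep x⁆) (fun I J hI hJ => ?_)
      (fun I J hI hJ => ?_) i
    · refine heterix_index_cases (P := fun x =>
        (∃ z, heterixRep z = ⁅heterixRep (gamma' I J), heterixRep x⁆) ∨
        ∃ z, heterixRep z = ⁅heterixRep x, heterixRep (gamma' I J)⁆) (fun K L hK hL => ?_)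
        (fun K L hK hL => ?_) j
      · exact Or.inl ⟨_, heterixRep_lie_gamma' hI hJ hK hL⟩
      · exact Or.inl ⟨_, heterixRep_lie_gamma'_ft' hI hJ hK hL⟩
    · refine heterix_index_cases (P := fun x =>
        (∃ z, heterixRep z = ⁅heterixRep (ft' I J), heterixRep x⁆) ∨
        ∃ z, heterixRep z = ⁅heterixRep x, heterixRep (ft' I J)⁆) (fun K L hK hL => ?_)
        (fun K L hK hL => ?_) j
      · exact Or.inr ⟨_, heterixRep_lie_gamma'_ft' hK hL hI hJ⟩
      · exact Or.inl ⟨_, heterixRep_lie_ft' hI hK⟩)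
  refine ⟨H, hH, ?_, ?_, ?_⟩
  · intro I J K L hI hJ hK hL
    exact heterixRep_injective ((hH _ _).trans (heterixRep_lie_ft' hI hK).symm)
  · intro I J K L hI hJ hK hL
    exact heterixRep_injective ((hH _ _).trans (heterixRep_lie_gamma'_ft' hI hJ hK hL).symm)
  · intro I J K L hI hJ hK hL
    exact heterixRep_injective ((hH _ _).trans (heterixRep_lie_gamma' hI hJ hK hL).symm)

end Heterix

/-! ### Operators with prescribed letters at the ends -/

section Ends

variable {A : Type*}

theorem commute_rev_conj {X Y : WordOp A} (h : Commute X Y) :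
    Commute (rev * X * rev) (rev * Y * rev) := by
  have key : ∀ X Y : WordOp A, rev * X * rev * (rev * Y * rev) = rev * (X * Y) * rev := by
    intro X Y
    rw [mul_assoc, ← mul_assoc rev (_ * _) rev, ← mul_assoc rev rev, rev_mul_rev, one_mul]
    simp only [mul_assoc]
  rw [commute_iff_eq, key, key, h.eq]

theorem cr_eq (I : List A) : cr I = rev * crR I.reverse * rev := by
  rw [rev_mul_crR, List.reverse_reverse, mul_assoc, rev_mul_rev, mul_one]

theorem crR_eq (I : List A) : crR I = rev * cr I.reverse * rev := by
  rw [rev_mul_cr, List.reverse_reverse, mul_assoc, rev_mul_rev, mul_one]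

variable [DecidableEq A]

/-- Replacing `i :: J` by `i :: I`, summed over `i`, replaces the occurrences of `J` that have some
letter before them. The difference keeps the occurrence at the beginning. -/
theorem sum_γo_cons [Fintype A] (I : List A) {J : List A} (hJ : J ≠ []) :
    γo I J - ∑ i, γo (i :: I) (i :: J) = lo I J := by
  have h : ∑ i, γo (i :: I) (i :: J) = shift (γo I J) := hom_ext_wd fun W => by
    rw [LinearMap.sum_apply]
    induction W with
    | nil => simp [γo_wd_nil]
    | cons x W ih =>
      simp only [γo_wd_cons _ (List.cons_ne_nil _ J), Finset.sum_add_distrib]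
      rw [← map_sum, ih, Finset.sum_eq_single x, shift_wd_cons,
        LinearMap.congr_fun (γo_eq_lo_add_shift I hJ) (wd W)]
      · simp only [lo, Module.End.mul_apply, an_cons_wd_cons, δ_self, one_smul,
          LinearMap.add_apply, map_add, cr_cons x I]
      · intro i _ hi
        simp [lo, δ_of_ne hi.symm]
      · simp
  rw [h]
  exact sub_eq_of_eq_add (γo_eq_lo_add_shift I hJ)

theorem sum_γo_concat [Fintype A] (I : List A) {J : List A} (hJ : J ≠ []) :
    γo I J - ∑ i, γo (I ++ [i]) (J ++ [i]) = ro I J := by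
  have h : ∀ i : A, γo (I ++ [i]) (J ++ [i]) =
      rev * γo (i :: I.reverse) (i :: J.reverse) * rev := fun i => by
    rw [γo_eq]; simp
  simp only [h]
  rw [ro_eq, ← sum_γo_cons _ (by simpa), mul_sub, sub_mul, ← γo_eq, Finset.mul_sum, Finset.sum_mul]

/-- The sum accounts for prefixes followed by at least one more letter; what is left is an exact
match. -/
theorem sum_lo_concat [Fintype A] (I J : List A) :
    lo I J - ∑ k, lo (I ++ [k]) (J ++ [k]) = fo I J := by
  have h1 : ∑ k, lo (I ++ [k]) (J ++ [k]) = cr I * (∑ k, cr [k] * an [k]) * an J := by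
    rw [Finset.mul_sum, Finset.sum_mul]
    simp only [lo, cr_append, an_append, mul_assoc]
  rw [h1, sum_cr_mul_an, mul_sub, sub_mul, mul_one, cr_mul_fo, fo_mul_an, List.append_nil,
    List.append_nil, lo, sub_sub_cancel]

theorem sum_ro_cons [Fintype A] (I J : List A) :
    ro I J - ∑ k, ro (k :: I) (k :: J) = fo I J := by
  have h : ∀ i : A, ro (i :: I) (i :: J) =
      rev * lo (I.reverse ++ [i]) (J.reverse ++ [i]) * rev := fun i => by
    rw [ro_eq]; simp
  simp only [h]
  rw [ro_eq, ← Finset.sum_mul, ← Finset.mul_sum, ← sub_mul, ← mul_sub, sum_lo_concat, rev_mul_fo,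
    mul_assoc, rev_mul_rev]
  simp

/-- Conjugation by the first letter. -/
def Lop (c c' : A) : WordOp A →ₗ[ℂ] WordOp A :=
  LinearMap.mulRight ℂ (an [c']) ∘ₗ LinearMap.mulLeft ℂ (cr [c])

/-- Conjugation by the last letter. -/
def Rop (f f' : A) : WordOp A →ₗ[ℂ] WordOp A :=
  LinearMap.mulRight ℂ (anR [f']) ∘ₗ LinearMap.mulLeft ℂ (crR [f])

theorem Lop_apply (c c' : A) (X : WordOp A) : Lop c c' X = cr [c] * X * an [c'] := rfl

theorem Rop_apply (f f' : A) (X : WordOp A) : Rop f f' X = crR [f] * X * anR [f'] := rfl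

theorem lo_cons (c c' : A) (I J : List A) : lo (c :: I) (c' :: J) = Lop c c' (lo I J) := by
  rw [lo, cr_cons, an_cons, Lop_apply, lo]
  simp only [mul_assoc]

theorem ro_concat (f f' : A) (I J : List A) :
    ro (I ++ [f]) (J ++ [f']) = Rop f f' (ro I J) := by
  rw [ro, crR_append, anR_append, Rop_apply, ro]
  simp only [mul_assoc]

theorem fo_cons (c c' : A) (I J : List A) : fo (c :: I) (c' :: J) = Lop c c' (fo I J) := by
  rw [Lop_apply, cr_mul_fo, fo_mul_an]
  rfl

theorem fo_concat (f f' : A) (I J : List A) :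
    fo (I ++ [f]) (J ++ [f']) = Rop f f' (fo I J) := by
  rw [Rop_apply, crR_mul_fo, fo_mul_anR]

theorem anR_mul_crR_singleton (j k : A) : anR [j] * crR [k] = δ k j • (1 : WordOp A) :=
  hom_ext_wd fun W => by simp [anR_singleton_wd_append]

/-- The adjacent end letters contract to a delta, which is the source of the delta of end labels in
the brackets. -/
theorem Lop_mul_Lop (c₁ c₂ c₃ c₄ : A) (X Y : WordOp A) :
    Lop c₁ c₂ X * Lop c₃ c₄ Y = δ c₃ c₂ • Lop c₁ c₄ (X * Y) := by
  have : Lop c₁ c₂ X * Lop c₃ c₄ Y = cr [c₁] * X * (an [c₂] * cr [c₃]) * Y * an [c₄] := by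
    simp only [Lop_apply, mul_assoc]
  rw [this, an_mul_cr_singleton]
  simp only [Lop_apply, mul_smul_comm, smul_mul_assoc, mul_one, mul_assoc]

theorem Rop_mul_Rop (c₁ c₂ c₃ c₄ : A) (X Y : WordOp A) :
    Rop c₁ c₂ X * Rop c₃ c₄ Y = δ c₃ c₂ • Rop c₁ c₄ (X * Y) := by
  have : Rop c₁ c₂ X * Rop c₃ c₄ Y = crR [c₁] * X * (anR [c₂] * crR [c₃]) * Y * anR [c₄] := by
    simp only [Rop_apply, mul_assoc]
  rw [this, anR_mul_crR_singleton]
  simp only [Rop_apply, mul_smul_comm, smul_mul_assoc, mul_one, mul_assoc]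

theorem Lop_mul {c : A} {Y : WordOp A} (h : Commute (an [c]) Y) (c' : A) (X : WordOp A) :
    Lop c' c X * Y = Lop c' c (X * Y) := by
  rw [Lop_apply, mul_assoc, h.eq, Lop_apply]
  simp only [mul_assoc]

theorem mul_Lop {c : A} {Y : WordOp A} (h : Commute (cr [c]) Y) (c' : A) (X : WordOp A) :
    Y * Lop c c' X = Lop c c' (Y * X) := by
  rw [Lop_apply, ← mul_assoc, ← mul_assoc, ← h.eq, Lop_apply]
  simp only [mul_assoc]

theorem Rop_mul {c : A} {Y : WordOp A} (h : Commute (anR [c]) Y) (c' : A) (X : WordOp A) :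
    Rop c' c X * Y = Rop c' c (X * Y) := by
  rw [Rop_apply, mul_assoc, h.eq, Rop_apply]
  simp only [mul_assoc]

theorem mul_Rop {c : A} {Y : WordOp A} (h : Commute (crR [c]) Y) (c' : A) (X : WordOp A) :
    Y * Rop c c' X = Rop c c' (Y * X) := by
  rw [Rop_apply, ← mul_assoc, ← mul_assoc, ← h.eq, Rop_apply]
  simp only [mul_assoc]

theorem commute_an_crR_singleton {J : List A} {k : A} (h : k ∉ J) :
    Commute (an J) (crR [k]) := by
  induction J with
  | nil => simp
  | cons j J ih =>
    rw [List.mem_cons, not_or] at h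
    rw [an_cons]
    exact (ih h.2).mul_left (an_mul_crR_comm_of_ne j k h.1)

theorem commute_an_singleton_crR {j : A} {K : List A} (h : j ∉ K) :
    Commute (an [j]) (crR K) := by
  induction K with
  | nil => simp
  | cons k K ih =>
    rw [List.mem_cons, not_or] at h
    rw [← List.singleton_append (l := K), crR_append]
    exact (ih h.2).mul_right (an_mul_crR_comm_of_ne j k (Ne.symm h.1))

theorem commute_anR_singleton_cr {j : A} {K : List A} (h : j ∉ K) :
    Commute (anR [j]) (cr K) := by
  have := commute_rev_conj (commute_an_singleton_crR (j := j) (K := K.reverse) (by simpa))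
  rwa [← cr_eq, ← List.reverse_singleton, ← anR_eq] at this

theorem commute_cr_singleton_anR {k : A} {J : List A} (h : k ∉ J) :
    Commute (cr [k]) (anR J) := by
  have := commute_rev_conj (commute_an_crR_singleton (k := k) (J := J.reverse) (by simpa))
  rw [← anR_eq, ← List.reverse_singleton, ← cr_eq] at this
  exact this.symm

/-- The correction in `an_singleton_mul_γo` would need `c` as the first letter of the inserted word.
-/
theorem commute_an_singleton_γo {c : A} {K L : List A} (hK : K ≠ []) (hL : L ≠ []) (h : c ∉ K) :
    Commute (an [c]) (γo K L) := by
  obtain ⟨k, K, rfl⟩ := List.exists_cons_of_ne_nil hK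
  rw [List.mem_cons, not_or] at h
  rw [commute_iff_eq, an_singleton_mul_γo _ hL, cr_cons, ← mul_assoc (an [c]), an_mul_cr_singleton,
    δ_of_ne (Ne.symm h.1), zero_smul, zero_mul, zero_mul, add_zero]

theorem commute_cr_singleton_γo {c : A} (K : List A) {L : List A} (hL : L ≠ []) (h : c ∉ L) :
    Commute (cr [c]) (γo K L) := by
  rw [commute_iff_eq, γo_mul_cr_singleton _ hL]
  obtain ⟨l, L, rfl⟩ := List.exists_cons_of_ne_nil hL
  rw [List.mem_cons, not_or] at h
  rw [an_cons, mul_assoc (cr K), mul_assoc (an L), an_mul_cr_singleton, δ_of_ne h.1, zero_smul,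
    mul_zero, mul_zero, add_zero]

theorem commute_anR_singleton_γo {c : A} {K L : List A} (hK : K ≠ []) (hL : L ≠ []) (h : c ∉ K) :
    Commute (anR [c]) (γo K L) := by
  have := commute_rev_conj (commute_an_singleton_γo (c := c) (K := K.reverse) (L := L.reverse)
    (by simpa) (by simpa) (by simpa))
  rwa [← γo_eq, ← List.reverse_singleton, ← anR_eq] at this

theorem commute_crR_singleton_γo {c : A} (K : List A) {L : List A} (hL : L ≠ []) (h : c ∉ L) :
    Commute (crR [c]) (γo K L) := by
  have := commute_rev_conj (commute_cr_singleton_γo (c := c) K.reverse (L := L.reverse)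
    (by simpa) (by simpa))
  rwa [← γo_eq, ← List.reverse_singleton, ← crR_eq] at this

theorem commute_anR_lo {c : A} {I : List A} (J : List A) (h : c ∉ I) :
    Commute (anR [c]) (lo I J) :=
  (commute_anR_singleton_cr h).mul_right (an_mul_anR J [c]).symm

theorem commute_crR_lo {c : A} (I : List A) {J : List A} (h : c ∉ J) :
    Commute (crR [c]) (lo I J) :=
  Commute.mul_right (cr_mul_crR I [c]).symm (commute_an_crR_singleton h).symm

theorem commute_an_ro {c : A} {I : List A} (J : List A) (h : c ∉ I) :
    Commute (an [c]) (ro I J) :=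
  (commute_an_singleton_crR h).mul_right (an_mul_anR [c] J)

theorem commute_cr_ro {c : A} (I : List A) {J : List A} (h : c ∉ J) :
    Commute (cr [c]) (ro I J) :=
  Commute.mul_right (cr_mul_crR [c] I) (commute_cr_singleton_anR h)

/-- Removing a first letter `c` can interfere with a suffix operation only if `c` is among the
letters appended. -/
theorem commute_an_Rop_ro {c f : A} (f' : A) {I : List A} (J : List A) (h : c ∉ I) (hcf : c ≠ f) :
    Commute (an [c]) (Rop f f' (ro I J)) :=
  ((commute_an_singleton_crR (by simpa)).mul_right (commute_an_ro J h)).mul_right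
    (an_mul_anR [c] [f'])

theorem commute_cr_Rop_ro {c f' : A} (f : A) (I : List A) {J : List A} (h : c ∉ J) (hcf : c ≠ f') :
    Commute (cr [c]) (Rop f f' (ro I J)) :=
  (Commute.mul_right (cr_mul_crR [c] [f]) (commute_cr_ro I h)).mul_right
    (commute_cr_singleton_anR (by simpa))

end Ends

/-! ### The realisation of the grand string algebra in the heterix algebra -/

section Letters

variable {A E : Type*}

theorem adj_append (I J : List A) : adj (E := E) (I ++ J) = adj I ++ adj J := List.map_append

theorem adj_injective : Function.Injective (adj : List A → List (Letter A E)) :=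
  Sum.inl_injective.list_map

@[simp] theorem adj_eq_nil {I : List A} : adj (E := E) I = [] ↔ I = [] := List.map_eq_nil_iff

theorem adj_ne_nil {I : List A} (hI : I ≠ []) : adj (E := E) I ≠ [] := fun h => hI (adj_eq_nil.1 h)

theorem conj_notMem_adj (l : E) (I : List A) : conj l ∉ adj I := by simp [conj, adj]

theorem fund_notMem_adj (l : E) (I : List A) : fund l ∉ adj I := by simp [fund, adj]

theorem conj_ne_fund (l m : E) : (conj l : Letter A E) ≠ fund m := by simp [conj, fund]

variable [DecidableEq A] [DecidableEq E]

@[simp] theorem δ_adj (I J : List A) : δ (adj (E := E) I) (adj J) = δ I J := δ_map adj_injective I J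

@[simp] theorem δ_conj (l m : E) : δ (conj l : Letter A E) (conj m) = δ l m :=
  δ_map (g := (conj : E → Letter A E)) (fun a b h => by simpa [conj] using h) l m

@[simp] theorem δ_fund (l m : E) : δ (fund l : Letter A E) (fund m) = δ l m :=
  δ_map (g := (fund : E → Letter A E)) (fun a b h => by simpa [fund] using h) l m

variable {V : Type*} [AddCommMonoid V]

theorem sum_split2_adj (W : List A) (F : List (Letter A E) × List (Letter A E) → V) :
    ∑ p ∈ split2 (adj W), F p = ∑ p ∈ split2 W, F (adj p.1, adj p.2) := sum_split2_map _ _ _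

theorem sum_split3_adj (W : List A)
    (F : List (Letter A E) × List (Letter A E) × List (Letter A E) → V) :
    ∑ p ∈ split3 (adj W) with p.2.1 ≠ [], F p =
      ∑ p ∈ split3 W with p.2.1 ≠ [], F (adj p.1, adj p.2.1, adj p.2.2) := by
  rw [Finset.sum_filter, Finset.sum_filter, adj, sum_split3_map]
  refine Finset.sum_congr rfl fun p _ => ?_
  by_cases h : p.2.1 = [] <;> simp [h, adj]

end Letters

/-! ### Actions of the differences `l'`, `r'`, `f'` on words and on cyclic words -/

section HeterixValues

variable {A : Type*} [DecidableEq A] [Fintype A]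

theorem heterixOpen_l' {I J : List A} (hI : I ≠ []) (hJ : J ≠ []) :
    heterixOpen (l' I J) = lo I J := by
  rw [l', ← sum_γo_cons I hJ]
  refine (map_sub heterixOpen _ _).trans ?_
  rw [heterixOpen_ft', sub_zero]
  refine (map_sub heterixOpen _ _).trans ?_
  rw [heterixOpen_gamma' hI hJ]
  refine congrArg _ ((map_sum heterixOpen _ _).trans ?_)
  exact Finset.sum_congr rfl fun i _ =>
    heterixOpen_gamma' (List.cons_ne_nil _ _) (List.cons_ne_nil _ _)

theorem heterixOpen_r' {I J : List A} (hI : I ≠ []) (hJ : J ≠ []) :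
    heterixOpen (r' I J) = ro I J := by
  rw [r', ← sum_γo_concat I hJ]
  refine (map_sub heterixOpen _ _).trans ?_
  rw [heterixOpen_ft', sub_zero]
  refine (map_sub heterixOpen _ _).trans ?_
  rw [heterixOpen_gamma' hI hJ]
  refine congrArg _ ((map_sum heterixOpen _ _).trans ?_)
  exact Finset.sum_congr rfl fun i _ => heterixOpen_gamma' (by simp) (by simp)

theorem heterixOpen_f' {I J : List A} (hI : I ≠ []) (hJ : J ≠ []) :
    heterixOpen (f' I J) = fo I J := by
  rw [f', ← sum_lo_concat I J]
  refine (map_sub heterixOpen _ _).trans ?_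
  rw [heterixOpen_l' hI hJ]
  refine congrArg _ ((map_sum heterixOpen _ _).trans ?_)
  exact Finset.sum_congr rfl fun i _ => heterixOpen_l' (by simp) (by simp)

/-- This is why `ft'` is subtracted in `l'`: on cyclic words the remaining difference of fourth-kind
operators is exactly the fifth-kind operator. -/
theorem heterixClosed_l' {I J : List A} (hI : I ≠ []) (hJ : J ≠ []) :
    heterixClosed (l' I J) = 0 := by
  have h : heterixClosed (∑ i : A, gamma' (i :: I) (i :: J)) = ∑ i, γc (i :: I) (i :: J) :=
    (map_sum heterixClosed _ _).trans (Finset.sum_congr rfl fun i _ =>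
      heterixClosed_gamma' (List.cons_ne_nil _ _) (List.cons_ne_nil _ _))
  rw [l']
  refine (map_sub heterixClosed _ _).trans ?_
  rw [heterixClosed_ft', ftc_eq_sub_left, ← h, ← heterixClosed_gamma' hI hJ]
  exact sub_eq_zero.2 (map_sub heterixClosed _ _)

theorem heterixClosed_r' {I J : List A} (hI : I ≠ []) (hJ : J ≠ []) :
    heterixClosed (r' I J) = 0 := by
  have h : heterixClosed (∑ i : A, gamma' (I ++ [i]) (J ++ [i])) =
      ∑ i, γc (I ++ [i]) (J ++ [i]) :=
    (map_sum heterixClosed _ _).trans (Finset.sum_congr rfl fun i _ =>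
      heterixClosed_gamma' (by simp) (by simp))
  rw [r']
  refine (map_sub heterixClosed _ _).trans ?_
  rw [heterixClosed_ft', ftc_eq_sub_right, ← h, ← heterixClosed_gamma' hI hJ]
  exact sub_eq_zero.2 (map_sub heterixClosed _ _)

theorem heterixClosed_f' {I J : List A} (hI : I ≠ []) (hJ : J ≠ []) :
    heterixClosed (f' I J) = 0 := by
  rw [f']
  refine (map_sub heterixClosed _ _).trans ?_
  rw [heterixClosed_l' hI hJ, zero_sub, neg_eq_zero]
  refine (map_sum heterixClosed _ _).trans ?_
  exact Finset.sum_eq_zero fun i _ => heterixClosed_l' (by simp) (by simp)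

end HeterixValues

/-! ### Basis of the grand string algebra and the map to the heterix algebra -/

section Realisation

variable {A E : Type*}

theorem opγ_of_ne {I J : List A} (hI : I ≠ []) (hJ : J ≠ []) :
    opγ (E := E) I J = Finsupp.single (GrandIndex.fourth ⟨I, hI⟩ ⟨J, hJ⟩) 1 := dif_pos ⟨hI, hJ⟩

theorem opft_of_ne {I J : List A} (hI : I ≠ []) (hJ : J ≠ []) :
    opft (E := E) I J = Finsupp.single (GrandIndex.fifth (CWord.mk I hI) (CWord.mk J hJ)) 1 :=
  dif_pos ⟨hI, hJ⟩

theorem grand_index_cases {P : GrandSpace A E → Prop}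
    (h1 : ∀ l₁ l₂ I J l₃ l₄, P (opF l₁ l₂ I J l₃ l₄)) (h2 : ∀ l₁ l₂ I J, P (opL l₁ l₂ I J))
    (h3 : ∀ I J l₁ l₂, P (opR I J l₁ l₂)) (h4 : ∀ I J, I ≠ [] → J ≠ [] → P (opγ I J))
    (h5 : ∀ I J, I ≠ [] → J ≠ [] → P (opft I J)) (i : GrandIndex A E) :
    P (Finsupp.single i 1) := by
  rcases i with ⟨l₁, l₂, I, J, l₃, l₄⟩ | ⟨l₁, l₂, I, J⟩ | ⟨I, J, l₁, l₂⟩ | ⟨⟨I, hI⟩, ⟨J, hJ⟩⟩ | ⟨c, d⟩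
  · exact h1 _ _ _ _ _ _
  · exact h2 _ _ _ _
  · exact h3 _ _ _ _
  · have := h4 I J hI hJ
    rwa [opγ_of_ne hI hJ] at this
  · obtain ⟨I, hI, rfl⟩ := c.exists_mk
    obtain ⟨J, hJ, rfl⟩ := d.exists_mk
    have := h5 I J hI hJ
    rwa [opft_of_ne hI hJ] at this

/-- A symmetric relation holds between all pairs of basic operators if it holds for the pairs
whose brackets are prescribed. -/
theorem grand_pair_cases {P : GrandSpace A E → GrandSpace A E → Prop}
    (symm : ∀ x y, P x y → P y x)
    (h11 : ∀ l₁ l₂ I J l₃ l₄ m₁ m₂ K L m₃ m₄, P (opF l₁ l₂ I J l₃ l₄) (opF m₁ m₂ K L m₃ m₄))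
    (h12 : ∀ l₁ l₂ I J l₃ l₄ m₁ m₂ K L, P (opF l₁ l₂ I J l₃ l₄) (opL m₁ m₂ K L))
    (h13 : ∀ l₁ l₂ I J l₃ l₄ m₁ m₂ K L, P (opF l₁ l₂ I J l₃ l₄) (opR K L m₁ m₂))
    (h14 : ∀ l₁ l₂ I J l₃ l₄ K L, K ≠ [] → L ≠ [] → P (opF l₁ l₂ I J l₃ l₄) (opγ K L))
    (h15 : ∀ l₁ l₂ I J l₃ l₄ K L, K ≠ [] → L ≠ [] → P (opF l₁ l₂ I J l₃ l₄) (opft K L))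
    (h22 : ∀ l₁ l₂ I J m₁ m₂ K L, P (opL l₁ l₂ I J) (opL m₁ m₂ K L))
    (h23 : ∀ l₁ l₂ I J m₁ m₂ K L, P (opL l₁ l₂ I J) (opR K L m₁ m₂))
    (h24 : ∀ l₁ l₂ I J K L, K ≠ [] → L ≠ [] → P (opL l₁ l₂ I J) (opγ K L))
    (h25 : ∀ l₁ l₂ I J K L, K ≠ [] → L ≠ [] → P (opL l₁ l₂ I J) (opft K L))
    (h33 : ∀ l₁ l₂ I J m₁ m₂ K L, P (opR I J l₁ l₂) (opR K L m₁ m₂))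
    (h34 : ∀ l₁ l₂ I J K L, K ≠ [] → L ≠ [] → P (opR I J l₁ l₂) (opγ K L))
    (h35 : ∀ l₁ l₂ I J K L, K ≠ [] → L ≠ [] → P (opR I J l₁ l₂) (opft K L))
    (h44 : ∀ I J K L, I ≠ [] → J ≠ [] → K ≠ [] → L ≠ [] → P (opγ I J) (opγ K L))
    (h45 : ∀ I J K L, I ≠ [] → J ≠ [] → K ≠ [] → L ≠ [] → P (opγ I J) (opft K L))
    (h55 : ∀ I J K L, I ≠ [] → J ≠ [] → K ≠ [] → L ≠ [] → P (opft I J) (opft K L))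
    (i j : GrandIndex A E) : P (Finsupp.single i 1) (Finsupp.single j 1) := by
  refine grand_index_cases (P := fun x => P x (Finsupp.single j 1)) ?_ ?_ ?_ ?_ ?_ i
  · intro l₁ l₂ I J l₃ l₄
    exact grand_index_cases (P := fun y => P (opF l₁ l₂ I J l₃ l₄) y)
      (fun _ _ _ _ _ _ => h11 _ _ _ _ _ _ _ _ _ _ _ _)
      (fun _ _ _ _ => h12 _ _ _ _ _ _ _ _ _ _) (fun _ _ _ _ => h13 _ _ _ _ _ _ _ _ _ _)
      (fun _ _ => h14 _ _ _ _ _ _ _ _) (fun _ _ => h15 _ _ _ _ _ _ _ _) j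
  · intro l₁ l₂ I J
    exact grand_index_cases (P := fun y => P (opL l₁ l₂ I J) y)
      (fun _ _ _ _ _ _ => symm _ _ (h12 _ _ _ _ _ _ _ _ _ _))
      (fun _ _ _ _ => h22 _ _ _ _ _ _ _ _) (fun _ _ _ _ => h23 _ _ _ _ _ _ _ _)
      (fun _ _ => h24 _ _ _ _ _ _) (fun _ _ => h25 _ _ _ _ _ _) j
  · intro I J l₁ l₂
    exact grand_index_cases (P := fun y => P (opR I J l₁ l₂) y)
      (fun _ _ _ _ _ _ => symm _ _ (h13 _ _ _ _ _ _ _ _ _ _))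
      (fun _ _ _ _ => symm _ _ (h23 _ _ _ _ _ _ _ _)) (fun _ _ _ _ => h33 _ _ _ _ _ _ _ _)
      (fun _ _ => h34 _ _ _ _ _ _) (fun _ _ => h35 _ _ _ _ _ _) j
  · intro I J hI hJ
    exact grand_index_cases (P := fun y => P (opγ I J) y)
      (fun _ _ _ _ _ _ => symm _ _ (h14 _ _ _ _ _ _ _ _ hI hJ))
      (fun _ _ _ _ => symm _ _ (h24 _ _ _ _ _ _ hI hJ))
      (fun _ _ _ _ => symm _ _ (h34 _ _ _ _ _ _ hI hJ))
      (fun _ _ => h44 _ _ _ _ hI hJ) (fun _ _ => h45 _ _ _ _ hI hJ) j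
  · intro I J hI hJ
    exact grand_index_cases (P := fun y => P (opft I J) y)
      (fun _ _ _ _ _ _ => symm _ _ (h15 _ _ _ _ _ _ _ _ hI hJ))
      (fun _ _ _ _ => symm _ _ (h25 _ _ _ _ _ _ hI hJ))
      (fun _ _ _ _ => symm _ _ (h35 _ _ _ _ _ _ hI hJ))
      (fun _ _ hK hL => symm _ _ (h45 _ _ _ _ hK hL hI hJ)) (fun _ _ => h55 _ _ _ _ hI hJ) j

theorem ft'_isRotated {I I' J J' : List A} (hI : I ~r I') (hJ : J ~r J') : ft' I J = ft' I' J' := by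
  have h1 : I = [] ↔ I' = [] := by
    constructor <;> rintro rfl
    · exact List.isRotated_nil_iff'.1 hI |>.symm
    · exact List.isRotated_nil_iff.1 hI
  have h2 : J = [] ↔ J' = [] := by
    constructor <;> rintro rfl
    · exact List.isRotated_nil_iff'.1 hJ |>.symm
    · exact List.isRotated_nil_iff.1 hJ
  by_cases h : I ≠ [] ∧ J ≠ []
  · have h' : I' ≠ [] ∧ J' ≠ [] := ⟨fun hh => h.1 (h1.2 hh), fun hh => h.2 (h2.2 hh)⟩
    rw [ft'_of_ne h.1 h.2, ft'_of_ne h'.1 h'.2]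
    have e1 : CWord.mk I h.1 = CWord.mk I' h'.1 := Subtype.ext (Quotient.sound hI)
    have e2 : CWord.mk J h.2 = CWord.mk J' h'.2 := Subtype.ext (Quotient.sound hJ)
    rw [e1, e2]
  · have h' : ¬ (I' ≠ [] ∧ J' ≠ []) := fun hh => h ⟨fun x => hh.1 (h1.1 x), fun x => hh.2 (h2.1 x)⟩
    rw [ft', dif_neg h, ft', dif_neg h']

variable [Fintype A] [Fintype E]

/-- The images of the basic operators in the heterix algebra. -/
def iotaIndex : GrandIndex A E → HeterixSpace (Letter A E)
  | .first l₁ l₂ I J l₃ l₄ => f' (conj l₁ :: adj I ++ [fund l₃]) (conj l₂ :: adj J ++ [fund l₄])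
  | .second l₁ l₂ I J => l' (conj l₁ :: adj I) (conj l₂ :: adj J)
  | .third I J l₃ l₄ => r' (adj I ++ [fund l₃]) (adj J ++ [fund l₄])
  | .fourth I J => gamma' (adj I.1) (adj J.1)
  | .fifth c d => ft' (adj c.rep) (adj d.rep)

/-- The realisation of the grand string algebra in the heterix algebra. -/
def iota : GrandSpace A E →ₗ[ℂ] HeterixSpace (Letter A E) :=
  Finsupp.linearCombination ℂ iotaIndex

theorem iota_single (i : GrandIndex A E) : iota (Finsupp.single i 1) = iotaIndex i :=
  (Finsupp.linearCombination_single ℂ 1 _).trans (one_smul _ _)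

theorem heterixRealisation_iota : HeterixRealisation (iota (A := A) (E := E)) where
  fourth I J hI hJ := by rw [opγ_of_ne hI hJ, iota_single]; rfl
  fifth I J hI hJ := by
    rw [opft_of_ne hI hJ, iota_single]
    exact ft'_isRotated ((CWord.mk_rep_isRotated hI).map _) ((CWord.mk_rep_isRotated hJ).map _)
  second l₁ l₂ I J := iota_single _
  third l₃ l₄ I J := iota_single _
  first l₁ l₂ l₃ l₄ I J := iota_single _

end Realisation

/-! ### Brackets of the five kinds computed in the concrete representation -/

section GrandBracketValues

variable {A E : Type*} [DecidableEq A] [DecidableEq E] [Fintype A] [Fintype E]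

/-- The action of the grand string algebra on words in the larger alphabet. -/
def grandOpen : GrandSpace A E →ₗ[ℂ] WordOp (Letter A E) := heterixOpen ∘ₗ iota

/-- The action of the grand string algebra on cyclic words in the larger alphabet. -/
def grandClosed : GrandSpace A E →ₗ[ℂ] ClosedOp (Letter A E) := heterixClosed ∘ₗ iota

/-- The action of the grand string algebra on words and on cyclic words in the larger alphabet. -/
def grandRep : GrandSpace A E →ₗ[ℂ] WordOp (Letter A E) × ClosedOp (Letter A E) :=
  heterixRep ∘ₗ iota

theorem grandOpen_opL (l₁ l₂ : E) (I J : List A) :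
    grandOpen (opL l₁ l₂ I J) = Lop (conj l₁) (conj l₂) (lo (adj I) (adj J)) := by
  rw [← lo_cons, ← heterixOpen_l' (List.cons_ne_nil _ _) (List.cons_ne_nil _ _),
    ← heterixRealisation_iota.second]
  rfl

theorem grandOpen_opR (l₁ l₂ : E) (I J : List A) :
    grandOpen (opR I J l₁ l₂) = Rop (fund l₁) (fund l₂) (ro (adj I) (adj J)) := by
  rw [← ro_concat, ← heterixOpen_r' (by simp) (by simp), ← heterixRealisation_iota.third]
  rfl

theorem grandOpen_opF (l₁ l₂ l₃ l₄ : E) (I J : List A) :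
    grandOpen (opF l₁ l₂ I J l₃ l₄) =
      Lop (conj l₁) (conj l₂) (Rop (fund l₃) (fund l₄) (fo (adj I) (adj J))) := by
  rw [← fo_concat, ← fo_cons, ← heterixOpen_f' (List.cons_ne_nil _ _) (List.cons_ne_nil _ _)]
  exact congrArg heterixOpen (heterixRealisation_iota.first l₁ l₂ l₃ l₄ I J)

theorem grandOpen_opγ {I J : List A} (hI : I ≠ []) (hJ : J ≠ []) :
    grandOpen (opγ (E := E) I J) = γo (adj I) (adj J) := by
  rw [← heterixOpen_gamma' (adj_ne_nil hI) (adj_ne_nil hJ), ← heterixRealisation_iota.fourth _ _ hI hJ]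
  rfl

theorem grandOpen_opft {I J : List A} (hI : I ≠ []) (hJ : J ≠ []) :
    grandOpen (opft (E := E) I J) = 0 := by
  rw [← heterixOpen_ft' (adj I) (adj J), ← heterixRealisation_iota.fifth _ _ hI hJ]
  rfl

theorem grandClosed_opL (l₁ l₂ : E) (I J : List A) : grandClosed (opL l₁ l₂ I J) = 0 := by
  rw [← heterixClosed_l' (List.cons_ne_nil (conj l₁) (adj I)) (List.cons_ne_nil (conj l₂) (adj J)),
    ← heterixRealisation_iota.second]
  rfl

theorem grandClosed_opR (l₁ l₂ : E) (I J : List A) : grandClosed (opR I J l₁ l₂) = 0 := by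
  rw [← heterixClosed_r' (I := adj I ++ [fund l₁]) (J := adj J ++ [fund l₂]) (by simp) (by simp),
    ← heterixRealisation_iota.third]
  rfl

theorem grandClosed_opF (l₁ l₂ l₃ l₄ : E) (I J : List A) :
    grandClosed (opF l₁ l₂ I J l₃ l₄) = 0 := by
  rw [← heterixClosed_f' (I := conj l₁ :: adj I ++ [fund l₃]) (J := conj l₂ :: adj J ++ [fund l₄])
    (by simp) (by simp), ← heterixRealisation_iota.first]
  rfl

theorem grandRep_opγ {I J : List A} (hI : I ≠ []) (hJ : J ≠ []) :
    grandRep (opγ (E := E) I J) = heterixRep (gamma' (adj I) (adj J)) :=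
  congrArg heterixRep (heterixRealisation_iota.fourth _ _ hI hJ)

theorem grandRep_opft {I J : List A} (hI : I ≠ []) (hJ : J ≠ []) :
    grandRep (opft (E := E) I J) = heterixRep (ft' (adj I) (adj J)) :=
  congrArg heterixRep (heterixRealisation_iota.fifth _ _ hI hJ)

/-- When `a` acts by zero on cyclic words, the closed components vanish and only the identity on
words has to be checked. -/
theorem grandRep_lie {x a b : GrandSpace A E}
    (ho : grandOpen x = grandOpen a * grandOpen b - grandOpen b * grandOpen a)
    (hc : grandClosed x = 0) (ha : grandClosed a = 0) : grandRep x = ⁅grandRep a, grandRep b⁆ := by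
  refine Prod.ext ho (hc.trans ?_)
  have : (grandRep a).2 = 0 := ha
  exact (by rw [this, zero_lie] : (0 : ClosedOp (Letter A E)) = ⁅(grandRep a).2, (grandRep b).2⁆)

theorem grandRep_lie_FF (l₁ l₂ l₃ l₄ l₅ l₆ l₇ l₈ : E) (I J K L : List A) :
    grandRep ((δ l₅ l₂ * δ K J * δ l₇ l₄) • opF l₁ l₆ I L l₃ l₈
        - (δ l₁ l₆ * δ I L * δ l₃ l₈) • opF l₅ l₂ K J l₇ l₄) =
      ⁅grandRep (opF l₁ l₂ I J l₃ l₄), grandRep (opF l₅ l₆ K L l₇ l₈)⁆ := by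
  refine grandRep_lie ?_ ?_ (grandClosed_opF _ _ _ _ _ _)
  · simp only [map_sub, map_smul, grandOpen_opF, Lop_mul_Lop, Rop_mul_Rop, fo_mul_fo, δ_conj,
      δ_fund, δ_adj, smul_smul]
    congr 2 <;> ring
  · simp [grandClosed_opF]

/-- The conjugate letters contract, while the fundamental letters pass through the prefix
replacement, which involves original letters only. -/
theorem grandRep_lie_FL (l₁ l₂ l₃ l₄ l₅ l₆ : E) (I J K L : List A) :
    grandRep (δ l₅ l₂ • ∑ p ∈ split2 J, δ K p.1 • opF l₁ l₆ I (L ++ p.2) l₃ l₄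
        - δ l₁ l₆ • ∑ p ∈ split2 I, δ p.1 L • opF l₅ l₂ (K ++ p.2) J l₃ l₄) =
      ⁅grandRep (opF l₁ l₂ I J l₃ l₄), grandRep (opL l₅ l₆ K L)⁆ := by
  refine grandRep_lie ?_ ?_ (grandClosed_opF _ _ _ _ _ _)
  · simp only [map_sub, map_smul, map_sum, grandOpen_opF, grandOpen_opL, Lop_mul_Lop,
      Rop_mul (commute_anR_lo _ (fund_notMem_adj _ _)),
      mul_Rop (commute_crR_lo _ (fund_notMem_adj _ _)), fo_mul_lo, lo_mul_fo, sum_split2_adj, δ_conj,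
      δ_adj, adj_append]
  · simp [grandClosed_opF]

theorem grandRep_lie_FR (l₁ l₂ l₃ l₄ l₅ l₆ : E) (I J K L : List A) :
    grandRep (δ l₅ l₄ • ∑ p ∈ split2 J, δ K p.2 • opF l₁ l₂ I (p.1 ++ L) l₃ l₆
        - δ l₃ l₆ • ∑ p ∈ split2 I, δ p.2 L • opF l₁ l₂ (p.1 ++ K) J l₅ l₄) =
      ⁅grandRep (opF l₁ l₂ I J l₃ l₄), grandRep (opR K L l₅ l₆)⁆ := by
  refine grandRep_lie ?_ ?_ (grandClosed_opF _ _ _ _ _ _)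
  · simp only [map_sub, map_smul, map_sum, grandOpen_opF, grandOpen_opR,
      Lop_mul (commute_an_Rop_ro _ _ (conj_notMem_adj _ _) (conj_ne_fund _ _)),
      mul_Lop (commute_cr_Rop_ro _ _ (conj_notMem_adj _ _) (conj_ne_fund _ _)), Rop_mul_Rop,
      fo_mul_ro, ro_mul_fo, sum_split2_adj, δ_fund, δ_adj, adj_append]
  · simp [grandClosed_opF]

theorem grandRep_lie_Fγ (l₁ l₂ l₃ l₄ : E) (I J : List A) {K L : List A} (hK : K ≠ [])
    (hL : L ≠ []) :
    grandRep (∑ p ∈ (split3 J).filter (fun p => p.2.1 ≠ []),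
          δ K p.2.1 • opF l₁ l₂ I (p.1 ++ L ++ p.2.2) l₃ l₄
        - ∑ p ∈ (split3 I).filter (fun p => p.2.1 ≠ []),
          δ p.2.1 L • opF l₁ l₂ (p.1 ++ K ++ p.2.2) J l₃ l₄) =
      ⁅grandRep (opF l₁ l₂ I J l₃ l₄), grandRep (opγ K L)⁆ := by
  have hK' := adj_ne_nil (E := E) hK
  have hL' := adj_ne_nil (E := E) hL
  refine grandRep_lie ?_ ?_ (grandClosed_opF _ _ _ _ _ _)
  · simp only [map_sub, map_smul, map_sum, grandOpen_opF, grandOpen_opγ hK hL,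
      Lop_mul (commute_an_singleton_γo hK' hL' (conj_notMem_adj _ _)),
      mul_Lop (commute_cr_singleton_γo _ hL' (conj_notMem_adj _ _)),
      Rop_mul (commute_anR_singleton_γo hK' hL' (fund_notMem_adj _ _)),
      mul_Rop (commute_crR_singleton_γo _ hL' (fund_notMem_adj _ _)),
      γo_mul_fo, fo_mul_γo _ _ hK' hL', sum_split3_adj, δ_adj, adj_append]
  · simp [grandClosed_opF]

theorem grandRep_lie_LL (l₁ l₂ l₃ l₄ : E) (I J K L : List A) :
    grandRep (δ l₃ l₂ • lHalf (opL l₁ l₄) I J K L - δ l₁ l₄ • lHalf (opL l₃ l₂) K L I J) =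
      ⁅grandRep (opL l₁ l₂ I J), grandRep (opL l₃ l₄ K L)⁆ := by
  refine grandRep_lie ?_ ?_ (grandClosed_opL _ _ _ _)
  · simp only [map_sub, map_smul, map_lHalf, grandOpen_opL, Lop_mul_Lop, lo_mul_lo, δ_conj, adj,
      lHalf_map Sum.inl_injective]
  · simp only [map_sub, map_smul, map_lHalf, grandClosed_opL]
    simp [lHalf]

theorem grandRep_lie_RR (l₁ l₂ l₃ l₄ : E) (I J K L : List A) :
    grandRep (δ l₃ l₂ • rHalf (fun M N => opR M N l₁ l₄) I J K L
        - δ l₁ l₄ • rHalf (fun M N => opR M N l₃ l₂) K L I J) =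
      ⁅grandRep (opR I J l₁ l₂), grandRep (opR K L l₃ l₄)⁆ := by
  refine grandRep_lie ?_ ?_ (grandClosed_opR _ _ _ _)
  · simp only [map_sub, map_smul, map_rHalf, grandOpen_opR, Rop_mul_Rop, ro_mul_ro, δ_fund, adj,
      rHalf_map Sum.inl_injective]
  · simp only [map_sub, map_smul, map_rHalf, grandClosed_opR]
    simp [rHalf]

theorem grandRep_lie_Lγ (l₁ l₂ : E) (I J : List A) {K L : List A} (hK : K ≠ []) (hL : L ≠ []) :
    grandRep (lGamma (opL l₁ l₂) I J K L) = ⁅grandRep (opL l₁ l₂ I J), grandRep (opγ K L)⁆ := by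
  have hK' := adj_ne_nil (E := E) hK
  have hL' := adj_ne_nil (E := E) hL
  refine grandRep_lie ?_ ?_ (grandClosed_opL _ _ _ _)
  · rw [grandOpen_opL, grandOpen_opγ hK hL,
      Lop_mul (commute_an_singleton_γo hK' hL' (conj_notMem_adj _ _)),
      mul_Lop (commute_cr_singleton_γo _ hL' (conj_notMem_adj _ _)), ← map_sub,
      lo_lie_γo _ _ hK' hL', map_lGamma, map_lGamma]
    simp only [grandOpen_opL, adj, lGamma_map Sum.inl_injective]
  · rw [map_lGamma]
    simp [lGamma, grandClosed_opL]

theorem grandRep_lie_Rγ (l₁ l₂ : E) (I J : List A) {K L : List A} (hK : K ≠ []) (hL : L ≠ []) :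
    grandRep (rGamma (fun M N => opR M N l₁ l₂) I J K L) =
      ⁅grandRep (opR I J l₁ l₂), grandRep (opγ K L)⁆ := by
  have hK' := adj_ne_nil (E := E) hK
  have hL' := adj_ne_nil (E := E) hL
  refine grandRep_lie ?_ ?_ (grandClosed_opR _ _ _ _)
  · rw [grandOpen_opR, grandOpen_opγ hK hL,
      Rop_mul (commute_anR_singleton_γo hK' hL' (fund_notMem_adj _ _)),
      mul_Rop (commute_crR_singleton_γo _ hL' (fund_notMem_adj _ _)), ← map_sub,
      ro_lie_γo _ _ hK' hL', map_rGamma, map_rGamma]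
    simp only [grandOpen_opR, adj, rGamma_map Sum.inl_injective]
  · rw [map_rGamma]
    simp [rGamma, grandClosed_opR]

theorem grandRep_lie_LR (l₁ l₂ l₃ l₄ : E) (I J K L : List A) :
    grandRep (∑ p ∈ split2 J, ∑ q ∈ split2 K, δ q.1 p.2 • opF l₁ l₂ (I ++ q.2) (p.1 ++ L) l₃ l₄
        - ∑ p ∈ split2 I, ∑ q ∈ split2 L, δ p.2 q.1 • opF l₁ l₂ (p.1 ++ K) (J ++ q.2) l₃ l₄) =
      ⁅grandRep (opL l₁ l₂ I J), grandRep (opR K L l₃ l₄)⁆ := by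
  refine grandRep_lie ?_ ?_ (grandClosed_opL _ _ _ _)
  · rw [grandOpen_opL, grandOpen_opR,
      Lop_mul (commute_an_Rop_ro _ _ (conj_notMem_adj _ _) (conj_ne_fund _ _)),
      mul_Lop (commute_cr_Rop_ro _ _ (conj_notMem_adj _ _) (conj_ne_fund _ _)),
      Rop_mul (commute_anR_lo _ (fund_notMem_adj _ _)),
      mul_Rop (commute_crR_lo _ (fund_notMem_adj _ _)), ← map_sub, ← map_sub, lo_lie_ro]
    simp only [map_sub, map_smul, map_sum, grandOpen_opF, sum_split2_adj, δ_adj, adj_append]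
  · simp [grandClosed_opF]

theorem grandRep_lie_ft {a : GrandSpace A E} (ha : grandClosed a = 0) {K L : List A} (hK : K ≠ [])
    (hL : L ≠ []) : grandRep (0 : GrandSpace A E) = ⁅grandRep a, grandRep (opft K L)⁆ := by
  refine grandRep_lie ?_ (map_zero _) ha
  rw [grandOpen_opft hK hL, mul_zero, zero_mul, sub_zero, map_zero]

omit [DecidableEq A] [DecidableEq E] in
theorem iota_opγ (I J : List A) : iota (opγ (E := E) I J) = gamma' (adj I) (adj J) := by
  by_cases h : I ≠ [] ∧ J ≠ []
  · exact heterixRealisation_iota.fourth _ _ h.1 h.2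
  · rw [opγ, dif_neg h, map_zero, gamma', dif_neg (by simpa using h)]

omit [DecidableEq A] [DecidableEq E] in
theorem iota_opft (I J : List A) : iota (opft (E := E) I J) = ft' (adj I) (adj J) := by
  by_cases h : I ≠ [] ∧ J ≠ []
  · exact heterixRealisation_iota.fifth _ _ h.1 h.2
  · rw [opft, dif_neg h, map_zero, ft', dif_neg (by simpa using h)]

/-- Embedding the original letters in the larger alphabet is injective, so it preserves splittings
and deltas; the bracket is inherited from the heterix algebra. -/
theorem grandRep_lie_γγ {I J K L : List A} (hI : I ≠ []) (hJ : J ≠ []) (hK : K ≠ [])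
    (hL : L ≠ []) :
    grandRep (gammaGamma (opγ (E := E)) opft I J K L - gammaGamma opγ opft K L I J) =
      ⁅grandRep (opγ (E := E) I J), grandRep (opγ (E := E) K L)⁆ := by
  have h : ∀ I J K L : List A, iota (gammaGamma (opγ (A := A) (E := E)) opft I J K L) =
      gammaGamma gamma' ft' (adj I) (adj J) (adj K) (adj L) := fun I J K L => by
    rw [map_gammaGamma, adj, adj, adj, adj, gammaGamma_map Sum.inl_injective]
    simp only [iota_opγ, iota_opft, adj]
  rw [grandRep_opγ hI hJ, grandRep_opγ hK hL, ← heterixRep_lie_gamma' (adj_ne_nil hI)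
    (adj_ne_nil hJ) (adj_ne_nil hK) (adj_ne_nil hL), ← h, ← h, ← map_sub]
  rfl

theorem grandRep_lie_γft {I J K L : List A} (hI : I ≠ []) (hJ : J ≠ []) (hK : K ≠ [])
    (hL : L ≠ []) :
    grandRep (gammaFtPlus (opft (E := E)) I J K L - gammaFtMinus opft I J K L) =
      ⁅grandRep (opγ (E := E) I J), grandRep (opft (E := E) K L)⁆ := by
  have h1 : iota (gammaFtPlus (opft (E := E)) I J K L) =
      gammaFtPlus ft' (adj I) (adj J) (adj K) (adj L) := by
    rw [map_gammaFtPlus, adj, adj, adj, adj, gammaFtPlus_map Sum.inl_injective]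
    simp only [iota_opft, adj]
  have h2 : iota (gammaFtMinus (opft (E := E)) I J K L) =
      gammaFtMinus ft' (adj I) (adj J) (adj K) (adj L) := by
    rw [map_gammaFtMinus, adj, adj, adj, adj, gammaFtMinus_map Sum.inl_injective]
    simp only [iota_opft, adj]
  rw [grandRep_opγ hI hJ, grandRep_opft hK hL, ← heterixRep_lie_gamma'_ft' (adj_ne_nil hI)
    (adj_ne_nil hJ) (adj_ne_nil hK) (adj_ne_nil hL), ← h1, ← h2, ← map_sub]
  rfl

theorem grandRep_lie_ftft {I J K L : List A} (hI : I ≠ []) (hJ : J ≠ []) (hK : K ≠ [])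
    (hL : L ≠ []) :
    grandRep (ftFt (opft (E := E)) I J K L - ftFt opft K L I J) =
      ⁅grandRep (opft (E := E) I J), grandRep (opft (E := E) K L)⁆ := by
  have h : ∀ I J K L : List A, iota (ftFt (opft (E := E)) I J K L) =
      ftFt ft' (adj I) (adj J) (adj K) (adj L) := fun I J K L => by
    rw [map_ftFt, adj, adj, adj, adj, ftFt_map Sum.inl_injective]
    simp only [iota_opft, adj]
  rw [grandRep_opft hI hJ, grandRep_opft hK hL, ← heterixRep_lie_ft' (adj_ne_nil hI)
    (adj_ne_nil hK), ← h, ← h, ← map_sub]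
  rfl

end GrandBracketValues

/-! ### The realisation is faithful -/

section Injective

variable {A E : Type*}

/-- The coordinates at `e j` form a family dual to `v`, so they recover the coefficients. -/
theorem linearCombination_injective_of_leading {α β : Type*} (v : α → β →₀ ℂ) (e : α → β)
    (h : ∀ i j, v i (e j) = Finsupp.single i (1 : ℂ) j) :
    Function.Injective (Finsupp.linearCombination ℂ v) := by
  have key : ∀ x j, Finsupp.linearCombination ℂ v x (e j) = x j := fun x j => by
    rw [Finsupp.linearCombination_apply, Finsupp.sum_apply]
    simp only [Finsupp.smul_apply, h, smul_eq_mul]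
    classical
    simp only [Finsupp.single_apply, mul_ite, mul_one, mul_zero]
    simp [Finsupp.sum, eq_comm]
  exact fun x y hxy => Finsupp.ext fun j => by rw [← key x, hxy, key]

theorem isRotated_of_adj {I J : List A} (h : adj (E := E) I ~r adj J) : I ~r J := by
  obtain ⟨n, hn⟩ := h
  exact ⟨n, adj_injective (by rw [← hn, adj, adj, List.map_rotate])⟩

/-- The leading terms of the images of the basic operators in the heterix algebra. -/
def leading : GrandIndex A E →
    (Word (Letter A E) × Word (Letter A E)) ⊕ (CWord (Letter A E) × CWord (Letter A E))
  | .first l₁ l₂ I J l₃ l₄ => .inl (⟨conj l₁ :: adj I ++ [fund l₃], List.cons_ne_nil _ _⟩,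
      ⟨conj l₂ :: adj J ++ [fund l₄], List.cons_ne_nil _ _⟩)
  | .second l₁ l₂ I J => .inl (⟨conj l₁ :: adj I, List.cons_ne_nil _ _⟩,
      ⟨conj l₂ :: adj J, List.cons_ne_nil _ _⟩)
  | .third I J l₃ l₄ => .inl (⟨adj I ++ [fund l₃], by simp⟩, ⟨adj J ++ [fund l₄], by simp⟩)
  | .fourth I J => .inl (⟨adj I.1, adj_ne_nil I.2⟩, ⟨adj J.1, adj_ne_nil J.2⟩)
  | .fifth c d => .inr (CWord.mk (adj c.rep) (adj_ne_nil c.rep_ne_nil),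
      CWord.mk (adj d.rep) (adj_ne_nil d.rep_ne_nil))

/-- The end labels and the interior of a word. -/
def letters (W : List (Letter A E)) : List E × List A × List E :=
  (W.filterMap fun x => x.getRight?.bind Sum.getLeft?, W.filterMap Sum.getLeft?,
    W.filterMap fun x => x.getRight?.bind Sum.getRight?)

@[simp] theorem letters_adj (I : List A) : letters (E := E) (adj I) = ([], I, []) := by
  simp [letters, adj, List.filterMap_map, Function.comp_def]

@[simp] theorem letters_conj_cons (l : E) (W : List (Letter A E)) :
    letters (conj l :: W) = (l :: (letters W).1, (letters W).2) := by
  simp [letters, conj, List.filterMap_cons]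

@[simp] theorem letters_concat_fund (l : E) (W : List (Letter A E)) :
    letters (W ++ [fund l]) = ((letters W).1, (letters W).2.1, (letters W).2.2 ++ [l]) := by
  simp [letters, fund]

/-- `letters` recovers the labels and the interior sequence of a leading word, and which labels are
present tells the first four kinds apart. The fifth kind is separated by the sum and identified up
to rotation. -/
theorem leading_injective : Function.Injective (leading (A := A) (E := E)) := by
  have h5 : ∀ {c d : CWord A}, CWord.mk (adj (E := E) c.rep) (adj_ne_nil c.rep_ne_nil) =
      CWord.mk (adj d.rep) (adj_ne_nil d.rep_ne_nil) → c = d := fun {c d} h => by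
    have : c.rep ~r d.rep := isRotated_of_adj (E := E) (Quotient.exact (congrArg Subtype.val h))
    rw [← c.mk_rep, ← d.mk_rep]
    exact Subtype.ext (Quotient.sound this)
  intro i j h
  have h' := congrArg (Sum.elim (fun p => some (letters p.1.1, letters p.2.1)) fun _ => none) h
  rcases i with ⟨l₁, l₂, I, J, l₃, l₄⟩ | ⟨l₁, l₂, I, J⟩ | ⟨I, J, l₁, l₂⟩ | ⟨⟨I, hI⟩, ⟨J, hJ⟩⟩ | ⟨c, d⟩ <;>
  rcases j with ⟨m₁, m₂, K, L, m₃, m₄⟩ | ⟨m₁, m₂, K, L⟩ | ⟨K, L, m₁, m₂⟩ | ⟨⟨K, hI⟩, ⟨L, hJ⟩⟩ | ⟨e, f⟩ <;>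
  simp only [leading, Sum.elim_inl, Sum.elim_inr, letters_conj_cons, letters_concat_fund,
    letters_adj, Option.some.injEq, Prod.mk.injEq, List.cons_append, reduceCtorEq, and_false,
    false_and, List.cons.injEq, true_and, and_true, List.nil_append,
    List.cons_ne_nil] at h'
  · obtain ⟨⟨rfl, rfl, rfl⟩, rfl, rfl, rfl⟩ := h'
    rfl
  · obtain ⟨⟨rfl, rfl⟩, rfl, rfl⟩ := h'
    rfl
  · obtain ⟨⟨rfl, rfl⟩, rfl, rfl⟩ := h'
    rfl
  · obtain ⟨rfl, rfl⟩ := h'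
    rfl
  · simp only [leading, Sum.inr.injEq, Prod.mk.injEq] at h
    rw [h5 h.1, h5 h.2]

/-- A conjugate letter in a leading word stands in first position, so terms with a letter prepended
to it meet no leading coordinate. -/
theorem gamma'_apply_leading_of_conj {P : List (Letter A E)} (Q : List (Letter A E)) {l : E}
    (h : conj l ∈ P.tail) (j : GrandIndex A E) : gamma' P Q (leading j) = 0 := by
  rw [gamma']
  split_ifs with hPQ
  · refine Finsupp.single_eq_of_ne fun he => ?_
    rcases j with _ | _ | _ | _ | _ <;>
    simp only [leading, Sum.inl.injEq, Prod.mk.injEq, Subtype.mk.injEq, reduceCtorEq] at he <;>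
    rw [← he.1] at h
    · simp [conj, adj, fund] at h
    · simp [conj, adj] at h
    · replace h := List.mem_of_mem_tail h
      simp [conj, adj, fund] at h
    · replace h := List.mem_of_mem_tail h
      simp [conj, adj] at h
  · rfl

theorem gamma'_apply_leading_of_fund {P : List (Letter A E)} (Q : List (Letter A E)) {l : E}
    (h : fund l ∈ P.dropLast) (j : GrandIndex A E) : gamma' P Q (leading j) = 0 := by
  rw [gamma']
  split_ifs with hPQ
  · refine Finsupp.single_eq_of_ne fun he => ?_
    rcases j with _ | _ | _ | _ | _ <;>
    simp only [leading, Sum.inl.injEq, Prod.mk.injEq, Subtype.mk.injEq, reduceCtorEq] at he <;>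
    rw [← he.1] at h
    · rw [List.dropLast_concat] at h
      simp [conj, adj, fund] at h
    · replace h := List.mem_of_mem_dropLast h
      simp [conj, adj, fund] at h
    · rw [List.dropLast_concat] at h
      simp [adj, fund] at h
    · replace h := List.mem_of_mem_dropLast h
      simp [fund, adj] at h
  · rfl

/-- The cyclic leading words consist of original letters only. -/
theorem ft'_apply_leading {P : List (Letter A E)} (Q : List (Letter A E)) {x : E ⊕ E}
    (h : Sum.inr x ∈ P) (j : GrandIndex A E) : ft' P Q (leading j) = 0 := by
  rw [ft']
  split_ifs with hPQ
  · refine Finsupp.single_eq_of_ne fun he => ?_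
    rcases j with _ | _ | _ | _ | ⟨c, d⟩ <;>
    simp only [leading, Sum.inr.injEq, Prod.mk.injEq, reduceCtorEq] at he
    have h1 : adj c.rep ~r P := Quotient.exact (congrArg Subtype.val he.1)
    rw [← h1.mem_iff] at h
    simp [adj] at h
  · rfl

theorem gamma'_apply_leading {P Q : List (Letter A E)} (hP : P ≠ []) (hQ : Q ≠ [])
    {i : GrandIndex A E} (hi : leading i = Sum.inl (⟨P, hP⟩, ⟨Q, hQ⟩)) (j : GrandIndex A E) :
    gamma' P Q (leading j) = Finsupp.single i (1 : ℂ) j := by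
  rw [gamma'_of_ne hP hQ, ← hi, Finsupp.single_apply_left leading_injective]

variable [Fintype A] [Fintype E]

/-- Each correction in `l'`, `r'` or `f'` displaces an end letter from its place by prepending or
appending another letter, or is a cyclic word containing an end letter. None contributes a leading
coordinate. -/
theorem iotaIndex_apply_leading (i j : GrandIndex A E) :
    iotaIndex i (leading j) = Finsupp.single i (1 : ℂ) j := by
  have hl : ∀ (l₁ l₂ : E) (P Q : List (Letter A E)),
      l' (conj l₁ :: P) (conj l₂ :: Q) (leading j) =
        gamma' (conj l₁ :: P) (conj l₂ :: Q) (leading j) := fun l₁ l₂ P Q => by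
    rw [l', Finsupp.sub_apply, Finsupp.sub_apply, Finsupp.finsetSum_apply, Finset.sum_eq_zero
      fun i _ => gamma'_apply_leading_of_conj (l := l₁) _ (by simp) j,
      ft'_apply_leading (x := Sum.inl l₁) _ (by simp [conj]), sub_zero, sub_zero]
  rcases i with ⟨l₁, l₂, I, J, l₃, l₄⟩ | ⟨l₁, l₂, I, J⟩ | ⟨I, J, l₁, l₂⟩ | ⟨⟨I, hI⟩, ⟨J, hJ⟩⟩ | ⟨c, d⟩
  · have h : ∀ k : Letter A E, l' (conj l₁ :: adj I ++ [fund l₃] ++ [k])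
        (conj l₂ :: adj J ++ [fund l₄] ++ [k]) (leading j) = 0 := fun k => by
      have hk : fund l₃ ∈ (conj l₁ :: (adj I ++ [fund l₃] ++ [k])).dropLast := by
        rw [← List.cons_append, List.dropLast_concat]; simp
      simp only [List.cons_append]
      rw [hl, gamma'_apply_leading_of_fund _ hk]
    rw [iotaIndex, f', Finsupp.sub_apply, Finsupp.finsetSum_apply,
      Finset.sum_eq_zero fun k _ => h k, sub_zero]
    exact (hl _ _ _ _).trans (gamma'_apply_leading _ _ rfl j)
  · exact (hl _ _ _ _).trans (gamma'_apply_leading _ _ rfl j)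
  · rw [iotaIndex, r', Finsupp.sub_apply, Finsupp.sub_apply, Finsupp.finsetSum_apply,
      Finset.sum_eq_zero fun i _ => gamma'_apply_leading_of_fund (l := l₁) _ (by simp) j,
      ft'_apply_leading (x := Sum.inr l₁) _ (by simp [fund]), sub_zero, sub_zero]
    exact gamma'_apply_leading _ _ rfl j
  · exact gamma'_apply_leading _ _ rfl j
  · rw [iotaIndex, ft'_of_ne (adj_ne_nil c.rep_ne_nil) (adj_ne_nil d.rep_ne_nil)]
    exact Finsupp.single_apply_left leading_injective (GrandIndex.fifth c d) j 1

theorem iota_injective : Function.Injective (iota (A := A) (E := E)) :=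
  linearCombination_injective_of_leading _ leading iotaIndex_apply_leading

variable [DecidableEq A] [DecidableEq E]

theorem grandRep_injective : Function.Injective (grandRep (A := A) (E := E)) :=
  heterixRep_injective.comp iota_injective

end Injective

/-! ### The grand string algebra, its ideals and subalgebras -/

namespace LieStructure

variable {α : Type*} (S : LieStructure (α →₀ ℂ))

/-- By bilinearity and antisymmetry it suffices to bracket generators of `W` with basis vectors on
the right. -/
theorem exists_lieIdeal {W : Submodule ℂ (α →₀ ℂ)} {s : Set (α →₀ ℂ)}
    (hW : W = Submodule.span ℂ s) (hne : W ≠ ⊤)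
    (h : ∀ w ∈ s, ∀ i, S.br w (Finsupp.single i 1) ∈ W) :
    ∃ I : LieIdeal ℂ S.Carrier, I.toSubmodule = W.map S.of.toLinearMap ∧ I ≠ ⊤ := by
  have key : ∀ x, ∀ w ∈ W, S.br x w ∈ W := by
    intro x w hw
    rw [bilin_skew S.br_self]
    refine neg_mem ?_
    have hw' := hw
    rw [hW] at hw'
    induction hw' using Submodule.span_induction with
    | zero => simp
    | smul c y hy ih =>
      rw [map_smul, LinearMap.smul_apply]
      exact W.smul_mem _ (ih (hW ▸ hy))
    | add y z hy hz ih ih' =>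
      rw [map_add, LinearMap.add_apply]
      exact add_mem (ih (hW ▸ hy)) (ih' (hW ▸ hz))
    | mem y hy =>
      induction x using Finsupp.induction_linear with
      | zero => simp
      | add x x' hx hx' => rw [map_add]; exact add_mem hx hx'
      | single i c =>
        rw [← mul_one c, ← smul_eq_mul, ← Finsupp.smul_single, map_smul]
        exact W.smul_mem _ (h y hy i)
  refine ⟨{ W.map S.of.toLinearMap with lie_mem := ?_ }, rfl, fun h' => hne ?_⟩
  · rintro x _ ⟨w, hw, rfl⟩
    exact ⟨_, key (S.of.symm x) w hw, rfl⟩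
  · have h2 : W.map S.of.toLinearMap = ⊤ := congrArg LieSubmodule.toSubmodule h'
    refine eq_top_iff.2 fun x _ => ?_
    have hx : S.of x ∈ W.map S.of.toLinearMap := h2 ▸ Submodule.mem_top
    obtain ⟨w, hw, hwx⟩ := hx
    exact S.of.injective hwx ▸ hw

theorem exists_lieSubalgebra {s : Set (α →₀ ℂ)}
    (h : ∀ v ∈ s, ∀ w ∈ s, S.br v w ∈ Submodule.span ℂ s) :
    ∃ M : LieSubalgebra ℂ S.Carrier,
      M.toSubmodule = (Submodule.span ℂ s).map S.of.toLinearMap := by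
  have key : ∀ v ∈ Submodule.span ℂ s, ∀ w ∈ Submodule.span ℂ s,
      S.br v w ∈ Submodule.span ℂ s := fun v hv w hw => by
    induction hv, hw using Submodule.span_induction₂ with
    | mem_mem v w hv hw => exact h v hv w hw
    | zero_left => simp
    | zero_right => simp
    | add_left => rw [map_add, LinearMap.add_apply]; exact add_mem ‹_› ‹_›
    | add_right => rw [map_add]; exact add_mem ‹_› ‹_›
    | smul_left => rw [map_smul, LinearMap.smul_apply]; exact Submodule.smul_mem _ _ ‹_›
    | smul_right => rw [map_smul]; exact Submodule.smul_mem _ _ ‹_›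
  refine ⟨{ (Submodule.span ℂ s).map S.of.toLinearMap with lie_mem' := ?_ }, rfl⟩
  rintro _ _ ⟨v, hv, rfl⟩ ⟨w, hw, rfl⟩
  exact ⟨_, key v hv w hw, rfl⟩

end LieStructure

section Grand

variable {A E : Type*} [DecidableEq A] [DecidableEq E]

theorem grandBrackets_unique {B C : GrandSpace A E →ₗ[ℂ] GrandSpace A E →ₗ[ℂ] GrandSpace A E}
    (hB : ∀ x, B x x = 0) (hC : ∀ x, C x x = 0) (h : GrandBrackets B) (h' : GrandBrackets C) :
    B = C := by
  refine bilin_ext hB hC fun i j => Or.inl ?_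
  refine grand_pair_cases (P := fun x y => B x y = C x y) ?_ ?_ ?_ ?_ ?_ ?_ ?_ ?_ ?_ ?_ ?_ ?_ ?_
    ?_ ?_ ?_ i j
  · intro x y hxy
    rw [bilin_skew hB, bilin_skew hC, hxy]
  · intros; rw [h.first_first, h'.first_first]
  · intros; rw [h.first_second, h'.first_second]
  · intros; rw [h.first_third, h'.first_third]
  · intro l₁ l₂ I J l₃ l₄ K L hK hL
    rw [h.first_fourth _ _ _ _ _ _ _ _ hK hL,
      h'.first_fourth _ _ _ _ _ _ _ _ hK hL]
  · intro l₁ l₂ I J l₃ l₄ K L hK hL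
    rw [h.first_fifth _ _ _ _ _ _ _ _ hK hL,
      h'.first_fifth _ _ _ _ _ _ _ _ hK hL]
  · intros; rw [h.second_second, h'.second_second]
  · intros; rw [h.second_third, h'.second_third]
  · intro l₁ l₂ I J K L hK hL
    rw [h.second_fourth _ _ _ _ _ _ hK hL,
      h'.second_fourth _ _ _ _ _ _ hK hL]
  · intro l₁ l₂ I J K L hK hL
    rw [h.second_fifth _ _ _ _ _ _ hK hL,
      h'.second_fifth _ _ _ _ _ _ hK hL]
  · intros; rw [h.third_third, h'.third_third]
  · intro l₁ l₂ I J K L hK hL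
    rw [h.third_fourth _ _ _ _ _ _ hK hL,
      h'.third_fourth _ _ _ _ _ _ hK hL]
  · intro l₁ l₂ I J K L hK hL
    rw [h.third_fifth _ _ _ _ _ _ hK hL,
      h'.third_fifth _ _ _ _ _ _ hK hL]
  · intro I J K L hI hJ hK hL
    rw [h.fourth_fifth.gamma_gamma _ _ _ _ hI hJ hK hL,
      h'.fourth_fifth.gamma_gamma _ _ _ _ hI hJ hK hL]
  · intro I J K L hI hJ hK hL
    rw [h.fourth_fifth.gamma_ft _ _ _ _ hI hJ hK hL,
      h'.fourth_fifth.gamma_ft _ _ _ _ hI hJ hK hL]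
  · intro I J K L hI hJ hK hL
    rw [h.fourth_fifth.ft_ft _ _ _ _ hI hJ hK hL,
      h'.fourth_fifth.ft_ft _ _ _ _ hI hJ hK hL]

variable [Fintype A] [Fintype E]

theorem grandRep_neg_lie {x y z : GrandSpace A E} (h : grandRep z = ⁅grandRep x, grandRep y⁆) :
    grandRep (-z) = ⁅grandRep y, grandRep x⁆ := by
  rw [← lie_skew, ← h]
  exact map_neg grandRep z

theorem exists_grandRep_lie (i j : GrandIndex A E) :
    ∃ z, grandRep z = ⁅grandRep (Finsupp.single i 1), grandRep (Finsupp.single j 1)⁆ := by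
  refine grand_pair_cases (P := fun x y => ∃ z, grandRep z = ⁅grandRep x, grandRep y⁆)
    ?_ ?_ ?_ ?_ ?_ ?_ ?_ ?_ ?_ ?_ ?_ ?_ ?_ ?_ ?_ ?_ i j
  · exact fun x y ⟨z, hz⟩ => ⟨-z, grandRep_neg_lie hz⟩
  · exact fun _ _ _ _ _ _ _ _ _ _ _ _ => ⟨_, grandRep_lie_FF _ _ _ _ _ _ _ _ _ _ _ _⟩
  · exact fun _ _ _ _ _ _ _ _ _ _ => ⟨_, grandRep_lie_FL _ _ _ _ _ _ _ _ _ _⟩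
  · exact fun _ _ _ _ _ _ _ _ _ _ => ⟨_, grandRep_lie_FR _ _ _ _ _ _ _ _ _ _⟩
  · exact fun _ _ _ _ _ _ _ _ hK hL => ⟨_, grandRep_lie_Fγ _ _ _ _ _ _ hK hL⟩
  · exact fun _ _ _ _ _ _ _ _ hK hL => ⟨_, grandRep_lie_ft (grandClosed_opF _ _ _ _ _ _) hK hL⟩
  · exact fun _ _ _ _ _ _ _ _ => ⟨_, grandRep_lie_LL _ _ _ _ _ _ _ _⟩
  · exact fun _ _ _ _ _ _ _ _ => ⟨_, grandRep_lie_LR _ _ _ _ _ _ _ _⟩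
  · exact fun _ _ _ _ _ _ hK hL => ⟨_, grandRep_lie_Lγ _ _ _ _ hK hL⟩
  · exact fun _ _ _ _ _ _ hK hL => ⟨_, grandRep_lie_ft (grandClosed_opL _ _ _ _) hK hL⟩
  · exact fun _ _ _ _ _ _ _ _ => ⟨_, grandRep_lie_RR _ _ _ _ _ _ _ _⟩
  · exact fun _ _ _ _ _ _ hK hL => ⟨_, grandRep_lie_Rγ _ _ _ _ hK hL⟩
  · exact fun _ _ _ _ _ _ hK hL => ⟨_, grandRep_lie_ft (grandClosed_opR _ _ _ _) hK hL⟩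
  · exact fun _ _ _ _ hI hJ hK hL => ⟨_, grandRep_lie_γγ hI hJ hK hL⟩
  · exact fun _ _ _ _ hI hJ hK hL => ⟨_, grandRep_lie_γft hI hJ hK hL⟩
  · exact fun _ _ _ _ hI hJ hK hL => ⟨_, grandRep_lie_ftft hI hJ hK hL⟩

theorem exists_grand (A E : Type*) [DecidableEq A] [DecidableEq E] [Fintype A] [Fintype E] :
    ∃ G : LieStructure (GrandSpace A E),
      (∀ x y, grandRep (G.br x y) = ⁅grandRep x, grandRep y⁆) ∧ GrandBrackets G.br := by
  obtain ⟨G, hG⟩ := exists_lieStructure (grandRep (A := A) (E := E)) grandRep_injective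
    fun i j => Or.inl (exists_grandRep_lie i j)
  have key : ∀ {x y z}, grandRep z = ⁅grandRep x, grandRep y⁆ → G.br x y = z := fun h =>
    grandRep_injective ((hG _ _).trans h.symm)
  refine ⟨G, hG, ?_, ?_, ?_, ?_, ?_, ?_, ?_, ?_, ?_, ?_, ?_, ?_, ?_, ?_, ?_⟩
  · exact fun _ _ _ _ _ _ _ _ hK hL => key (grandRep_lie_ft (grandClosed_opF _ _ _ _ _ _) hK hL)
  · exact fun _ _ _ _ _ _ hK hL => key (grandRep_lie_ft (grandClosed_opL _ _ _ _) hK hL)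
  · exact fun _ _ _ _ _ _ hK hL => key (grandRep_lie_ft (grandClosed_opR _ _ _ _) hK hL)
  · exact fun _ _ _ _ _ _ _ _ _ _ _ _ => key (grandRep_lie_FF _ _ _ _ _ _ _ _ _ _ _ _)
  · exact fun _ _ _ _ _ _ _ _ _ _ => key (grandRep_lie_FL _ _ _ _ _ _ _ _ _ _)
  · exact fun _ _ _ _ _ _ _ _ _ _ => key (grandRep_lie_FR _ _ _ _ _ _ _ _ _ _)
  · exact fun _ _ _ _ _ _ _ _ hK hL => key (grandRep_lie_Fγ _ _ _ _ _ _ hK hL)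
  · exact fun _ _ _ _ _ _ _ _ => key (grandRep_lie_LL _ _ _ _ _ _ _ _)
  · exact fun _ _ _ _ _ _ _ _ => key (grandRep_lie_RR _ _ _ _ _ _ _ _)
  · exact fun _ _ _ _ _ _ _ _ => key (grandRep_lie_LR _ _ _ _ _ _ _ _)
  · exact fun _ _ _ _ _ _ hK hL => key (grandRep_lie_Lγ _ _ _ _ hK hL)
  · exact fun _ _ _ _ _ _ hK hL => key (grandRep_lie_Rγ _ _ _ _ hK hL)
  · exact fun _ _ _ _ hI hJ hK hL => key (grandRep_lie_ftft hI hJ hK hL)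
  · exact fun _ _ _ _ hI hJ hK hL => key (grandRep_lie_γft hI hJ hK hL)
  · exact fun _ _ _ _ hI hJ hK hL => key (grandRep_lie_γγ hI hJ hK hL)

end Grand

/-! ### Distinguished ideals and subalgebras -/

section Ideals

variable {A E : Type*} [DecidableEq A] [DecidableEq E] {G : LieStructure (GrandSpace A E)}

omit [DecidableEq A] [DecidableEq E] in
theorem ne_top_of_apply_eq_zero {W : Submodule ℂ (GrandSpace A E)} {i : GrandIndex A E}
    (h : ∀ w ∈ W, w i = 0) : W ≠ ⊤ := fun hW => by
  have := h (Finsupp.single i 1) (hW ▸ Submodule.mem_top)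
  simp at this

theorem exists_firstKind_ideal [Nonempty A] (hG : GrandBrackets G.br) :
    ∃ I : LieIdeal ℂ G.Carrier, I.toSubmodule = (firstKind A E).map G.of.toLinearMap ∧ I ≠ ⊤ := by
  obtain ⟨a⟩ := ‹Nonempty A›
  refine G.exists_lieIdeal rfl ?_ ?_
  · refine ne_top_of_apply_eq_zero (i := .fourth ⟨[a], by simp⟩ ⟨[a], by simp⟩) fun w hw => ?_
    induction hw using Submodule.span_induction with
    | zero => rfl
    | add x y _ _ hx hy => rw [Finsupp.add_apply, hx, hy, add_zero]
    | smul c x _ hx => rw [Finsupp.smul_apply, hx, smul_zero]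
    | mem x hx =>
      obtain ⟨l₁, l₂, I, J, l₃, l₄, rfl⟩ := hx
      simp [opF]
  · rintro _ ⟨l₁, l₂, I, J, l₃, l₄, rfl⟩ i
    -- Membership is tested in the quotient, where every first-kind operator is zero; the prescribed
    -- right-hand sides then collapse.
    have hF : ∀ l₁ l₂ I J l₃ l₄, (firstKind A E).mkQ (opF l₁ l₂ I J l₃ l₄) = 0 := fun _ _ _ _ _ _ =>
      (Submodule.Quotient.mk_eq_zero _).2 (Submodule.subset_span ⟨_, _, _, _, _, _, rfl⟩)
    refine (Submodule.Quotient.mk_eq_zero _).1 ?_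
    change (firstKind A E).mkQ _ = 0
    generalize (firstKind A E).mkQ = T at hF ⊢
    refine grand_index_cases (P := fun x => T (G.br (opF l₁ l₂ I J l₃ l₄) x) = 0)
      ?_ ?_ ?_ ?_ ?_ i
    · intros; rw [hG.first_first]; simp [hF]
    · intros; rw [hG.first_second]; simp [hF]
    · intros; rw [hG.first_third]; simp [hF]
    · intro K L hK hL; rw [hG.first_fourth _ _ _ _ _ _ _ _ hK hL]; simp [hF]
    · intro K L hK hL; rw [hG.first_fifth _ _ _ _ _ _ _ _ hK hL]; simp

theorem exists_three_kinds_ideal [Nonempty A] (hG : GrandBrackets G.br) :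
    ∃ I : LieIdeal ℂ G.Carrier, I.toSubmodule =
      (firstKind A E ⊔ secondKind A E ⊔ thirdKind A E).map G.of.toLinearMap ∧ I ≠ ⊤ := by
  obtain ⟨a⟩ := ‹Nonempty A›
  have hW : firstKind A E ⊔ secondKind A E ⊔ thirdKind A E = _ :=
    ((Submodule.span_union _ _).trans (congrArg (· ⊔ _) (Submodule.span_union _ _))).symm
  refine G.exists_lieIdeal hW ?_ ?_
  · refine ne_top_of_apply_eq_zero (i := .fourth ⟨[a], by simp⟩ ⟨[a], by simp⟩) fun w hw => ?_
    rw [hW] at hw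
    induction hw using Submodule.span_induction with
    | zero => rfl
    | add x y _ _ hx hy => rw [Finsupp.add_apply, hx, hy, add_zero]
    | smul c x _ hx => rw [Finsupp.smul_apply, hx, smul_zero]
    | mem x hx =>
      rcases hx with (⟨_, _, _, _, _, _, rfl⟩ | ⟨_, _, _, _, rfl⟩) | ⟨_, _, _, _, rfl⟩
      · simp [opF]
      · simp [opL]
      · simp [opR]
  · intro w hw i
    have hF : ∀ l₁ l₂ I J l₃ l₄, (firstKind A E ⊔ secondKind A E ⊔ thirdKind A E).mkQ
        (opF l₁ l₂ I J l₃ l₄) = 0 := fun _ _ _ _ _ _ => (Submodule.Quotient.mk_eq_zero _).2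
      (Submodule.mem_sup_left (Submodule.mem_sup_left
        (Submodule.subset_span ⟨_, _, _, _, _, _, rfl⟩)))
    have hL : ∀ l₁ l₂ I J, (firstKind A E ⊔ secondKind A E ⊔ thirdKind A E).mkQ
        (opL l₁ l₂ I J) = 0 := fun _ _ _ _ => (Submodule.Quotient.mk_eq_zero _).2
      (Submodule.mem_sup_left (Submodule.mem_sup_right
        (Submodule.subset_span ⟨_, _, _, _, rfl⟩)))
    have hR : ∀ I J l₁ l₂, (firstKind A E ⊔ secondKind A E ⊔ thirdKind A E).mkQ
        (opR I J l₁ l₂) = 0 := fun _ _ _ _ => (Submodule.Quotient.mk_eq_zero _).2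
      (Submodule.mem_sup_right (Submodule.subset_span ⟨_, _, _, _, rfl⟩))
    refine (Submodule.Quotient.mk_eq_zero _).1 ?_
    change (firstKind A E ⊔ secondKind A E ⊔ thirdKind A E).mkQ _ = 0
    generalize (firstKind A E ⊔ secondKind A E ⊔ thirdKind A E).mkQ = T at hF hL hR ⊢
    rcases hw with (⟨l₁, l₂, I, J, l₃, l₄, rfl⟩ | ⟨l₁, l₂, I, J, rfl⟩) | ⟨I, J, l₁, l₂, rfl⟩
    · refine grand_index_cases (P := fun x => T (G.br (opF l₁ l₂ I J l₃ l₄) x) = 0)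
        ?_ ?_ ?_ ?_ ?_ i
      · intros; rw [hG.first_first]; simp [hF]
      · intros; rw [hG.first_second]; simp [hF]
      · intros; rw [hG.first_third]; simp [hF]
      · intro K L hK hL; rw [hG.first_fourth _ _ _ _ _ _ _ _ hK hL]; simp [hF]
      · intro K L hK hL; rw [hG.first_fifth _ _ _ _ _ _ _ _ hK hL]; simp
    · refine grand_index_cases (P := fun x => T (G.br (opL l₁ l₂ I J) x) = 0)
        ?_ ?_ ?_ ?_ ?_ i
      · intros; rw [bilin_skew G.br_self, hG.first_second]; simp [hF]
      · intros; rw [hG.second_second, map_sub, map_smul, map_smul]; simp [hL, lHalf]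
      · intros; rw [hG.second_third]; simp [hF]
      · intro K L hK hL'; rw [hG.second_fourth _ _ _ _ _ _ hK hL']; simp [hL, lGamma]
      · intro K L hK hL; rw [hG.second_fifth _ _ _ _ _ _ hK hL]; simp
    · refine grand_index_cases (P := fun x => T (G.br (opR I J l₁ l₂) x) = 0)
        ?_ ?_ ?_ ?_ ?_ i
      · intros; rw [bilin_skew G.br_self, hG.first_third]; simp [hF]
      · intros; rw [bilin_skew G.br_self, hG.second_third]; simp [hF]
      · intros; rw [hG.third_third, map_sub, map_smul, map_smul]; simp [hR, rHalf]
      · intro K L hK hL'; rw [hG.third_fourth _ _ _ _ _ _ hK hL']; simp [hR, rGamma]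
      · intro K L hK hL; rw [hG.third_fifth _ _ _ _ _ _ hK hL]; simp

theorem exists_fifthKind_ideal [Nonempty A] (hG : GrandBrackets G.br) :
    ∃ I : LieIdeal ℂ G.Carrier, I.toSubmodule = (fifthKind A E).map G.of.toLinearMap ∧ I ≠ ⊤ := by
  obtain ⟨a⟩ := ‹Nonempty A›
  refine G.exists_lieIdeal rfl ?_ ?_
  · refine ne_top_of_apply_eq_zero (i := .fourth ⟨[a], by simp⟩ ⟨[a], by simp⟩) fun w hw => ?_
    induction hw using Submodule.span_induction with
    | zero => rfl
    | add x y _ _ hx hy => rw [Finsupp.add_apply, hx, hy, add_zero]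
    | smul c x _ hx => rw [Finsupp.smul_apply, hx, smul_zero]
    | mem x hx =>
      obtain ⟨I, J, hI, hJ, rfl⟩ := hx
      simp [opft_of_ne hI hJ]
  · rintro _ ⟨I, J, hI, hJ, rfl⟩ i
    -- Empty words are allowed because `opft` is then zero by default, so no side conditions arise
    -- when the bracket formulas are simplified.
    have hft : ∀ I J, (fifthKind A E).mkQ (opft I J) = 0 := fun I J => by
      by_cases h : I ≠ [] ∧ J ≠ []
      · exact (Submodule.Quotient.mk_eq_zero _).2 (Submodule.subset_span ⟨_, _, h.1, h.2, rfl⟩)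
      · rw [opft, dif_neg h, map_zero]
    refine (Submodule.Quotient.mk_eq_zero _).1 ?_
    change (fifthKind A E).mkQ _ = 0
    generalize (fifthKind A E).mkQ = T at hft ⊢
    refine grand_index_cases (P := fun x => T (G.br (opft I J) x) = 0) ?_ ?_ ?_ ?_ ?_ i
    · intros; rw [bilin_skew G.br_self, hG.first_fifth _ _ _ _ _ _ _ _ hI hJ]; simp
    · intros; rw [bilin_skew G.br_self, hG.second_fifth _ _ _ _ _ _ hI hJ]; simp
    · intros; rw [bilin_skew G.br_self, hG.third_fifth _ _ _ _ _ _ hI hJ]; simp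
    · intro K L hK hL
      rw [bilin_skew G.br_self, hG.fourth_fifth.gamma_ft _ _ _ _ hK hL hI hJ]
      simp [gammaFtPlus, gammaFtMinus, hft]
    · intro K L hK hL
      rw [hG.fourth_fifth.ft_ft _ _ _ _ hI hJ hK hL]
      simp [ftFt, hft]

theorem exists_secondKind_subalgebra (hG : GrandBrackets G.br) :
    ∃ M : LieSubalgebra ℂ G.Carrier, M.toSubmodule = (secondKind A E).map G.of.toLinearMap := by
  refine G.exists_lieSubalgebra ?_
  rintro _ ⟨l₁, l₂, I, J, rfl⟩ _ ⟨l₃, l₄, K, L, rfl⟩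
  have hL : ∀ l₁ l₂ I J, (secondKind A E).mkQ (opL l₁ l₂ I J) = 0 := fun _ _ _ _ =>
    (Submodule.Quotient.mk_eq_zero _).2 (Submodule.subset_span ⟨_, _, _, _, rfl⟩)
  refine (Submodule.Quotient.mk_eq_zero _).1 ?_
  change (secondKind A E).mkQ _ = 0
  generalize (secondKind A E).mkQ = T at hL ⊢
  rw [hG.second_second]
  simp [lHalf, hL]

theorem exists_thirdKind_subalgebra (hG : GrandBrackets G.br) :
    ∃ M : LieSubalgebra ℂ G.Carrier, M.toSubmodule = (thirdKind A E).map G.of.toLinearMap := by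
  refine G.exists_lieSubalgebra ?_
  rintro _ ⟨I, J, l₁, l₂, rfl⟩ _ ⟨K, L, l₃, l₄, rfl⟩
  have hR : ∀ I J l₁ l₂, (thirdKind A E).mkQ (opR I J l₁ l₂) = 0 := fun _ _ _ _ =>
    (Submodule.Quotient.mk_eq_zero _).2 (Submodule.subset_span ⟨_, _, _, _, rfl⟩)
  refine (Submodule.Quotient.mk_eq_zero _).1 ?_
  change (thirdKind A E).mkQ _ = 0
  generalize (thirdKind A E).mkQ = T at hR ⊢
  rw [hG.third_third]
  simp [rHalf, hR]

end Ideals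

/-! ### Representations on open and closed singlet states -/

/-- A linear map compatible with the bracket, as a homomorphism of Lie algebras. -/
def LieStructure.lieHom {V E : Type*} [AddCommGroup V] [Module ℂ V] [LieRing E] [LieAlgebra ℂ E]
    (S : LieStructure V) (ρ : V →ₗ[ℂ] E) (h : ∀ x y, ρ (S.br x y) = ⁅ρ x, ρ y⁆) :
    S.Carrier →ₗ⁅ℂ⁆ E :=
  { ρ ∘ₗ S.of.symm.toLinearMap with map_lie' := fun {x y} => h (S.of.symm x) (S.of.symm y) }

/-- A subspace invariant under a Lie algebra carries a representation of it. -/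
theorem exists_restrict {L V W : Type*} [LieRing L] [LieAlgebra ℂ L] [AddCommGroup V] [Module ℂ V]
    [AddCommGroup W] [Module ℂ W] (ρ : L →ₗ⁅ℂ⁆ Module.End ℂ W) (j : V →ₗ[ℂ] W)
    (hj : Function.Injective j) (h : ∀ x v, ρ x (j v) ∈ LinearMap.range j) :
    ∃ σ : L →ₗ⁅ℂ⁆ Module.End ℂ V, ∀ x v, ρ x (j v) = j (σ x v) := by
  obtain ⟨g, hg⟩ := j.exists_leftInverse_of_injective (LinearMap.ker_eq_bot.2 hj)
  have hj' : ∀ x v, j (g (ρ x (j v))) = ρ x (j v) := fun x v => by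
    obtain ⟨w, hw⟩ := h x v
    rw [← hw]
    exact congrArg j (LinearMap.congr_fun hg w)
  refine ⟨{ toFun := fun x => g ∘ₗ ρ x ∘ₗ j, map_add' := ?_, map_smul' := ?_, map_lie' := ?_ },
    fun x v => (hj' x v).symm⟩
  · intro x y
    rw [map_add, LinearMap.add_comp, LinearMap.comp_add]
  · intro c x
    rw [map_smul, LinearMap.smul_comp, LinearMap.comp_smul, RingHom.id_apply]
  · intro x y
    refine LinearMap.ext fun v => hj ?_
    change j (g (ρ ⁅x, y⁆ (j v))) =
      j (g (ρ x (j (g (ρ y (j v))))) - g (ρ y (j (g (ρ x (j v))))))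
    rw [map_sub, hj', hj', hj', hj', hj', LieHom.map_lie]
    rfl

/-- Endomorphisms of the space spanned by all words, as endomorphisms of open singlet states. -/
def openEnd (A : Type*) : WordOp A →ₗ⁅ℂ⁆ Module.End ℂ (HeterixOpenStates A) where
  toFun X := X
  map_add' _ _ := rfl
  map_smul' _ _ := rfl
  map_lie' := rfl

/-- Endomorphisms of the space spanned by all cyclic words, as endomorphisms of closed singlet
states. -/
def closedEnd (A : Type*) : ClosedOp A →ₗ⁅ℂ⁆ Module.End ℂ (ClosedStates A) where
  toFun X := X
  map_add' _ _ := rfl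
  map_smul' _ _ := rfl
  map_lie' := rfl

section Heterix

variable {A : Type*} [DecidableEq A]

theorem heterixOpenAction : HeterixOpenAction
    ((openEnd A : WordOp A →ₗ[ℂ] Module.End ℂ (HeterixOpenStates A)) ∘ₗ heterixOpen) where
  ft I J K _ _ := congrArg (fun X : WordOp A => X (wd K)) (heterixOpen_ft' I J)
  gamma I _ K hI hJ := (congrArg (fun X : WordOp A => X (wd K)) (heterixOpen_gamma' hI hJ)).trans
    (γo_wd I _ K)

theorem heterixClosedAction : HeterixClosedAction
    ((closedEnd A : ClosedOp A →ₗ[ℂ] Module.End ℂ (ClosedStates A)) ∘ₗ heterixClosed) where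
  ft I _ K _ hJ _ := (congrArg (fun X : ClosedOp A => X (cw K)) (heterixClosed_ft' I _)).trans
    (ftΨ_eq I hJ K)
  gamma I _ K hI hJ hK :=
    (congrArg (fun X : ClosedOp A => X (cw K)) (heterixClosed_gamma' hI hJ)).trans
      (gammaΨ_eq I hJ hK)

end Heterix

/-! ### String states as invariant subspaces of the heterix states -/

section Embeddings

variable {A E : Type*}

/-- Open singlet states as words in the larger alphabet. -/
def openEmb : OpenStates A E →ₗ[ℂ] HeterixOpenStates (Letter A E) :=
  Finsupp.lmapDomain ℂ ℂ fun t => conj t.1 :: adj t.2.1 ++ [fund t.2.2]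

/-- Closed singlet states as cyclic words in the larger alphabet. -/
def closedEmb (A E : Type*) : ClosedStates A →ₗ[ℂ] ClosedStates (Letter A E) :=
  Finsupp.lmapDomain ℂ ℂ fun c => CWord.mk (adj c.rep) (adj_ne_nil c.rep_ne_nil)

theorem openEmb_st (r₁ r₂ : E) (K : List A) :
    openEmb (st r₁ K r₂) = s' (conj r₁ :: adj K ++ [fund r₂]) := Finsupp.mapDomain_single

theorem openEmb_st' (r₁ r₂ : E) (K : List A) :
    openEmb (st r₁ K r₂) = cr [conj r₁] (crR [fund r₂] (wd (adj K))) := by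
  rw [openEmb_st, crR_wd, cr_wd]
  rfl

theorem openEmb_injective : Function.Injective (openEmb (A := A) (E := E)) := by
  refine Finsupp.mapDomain_injective ?_
  rintro ⟨r₁, K, r₂⟩ ⟨s₁, L, s₂⟩ h
  have := congrArg letters h
  simpa [and_assoc] using this

theorem closedEmb_Ψ (K : List A) : closedEmb A E (Ψ K) = Ψ (adj K) := by
  by_cases hK : K = []
  · subst hK
    exact (map_zero _).trans rfl
  · rw [Ψ, dif_pos hK, Ψ, dif_pos (adj_ne_nil hK)]
    refine Finsupp.mapDomain_single.trans (congrArg (fun c => Finsupp.single c 1) ?_)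
    exact Subtype.ext (Quotient.sound ((CWord.mk_rep_isRotated hK).map _))

theorem closedEmb_injective : Function.Injective (closedEmb A E) := by
  refine Finsupp.mapDomain_injective fun c d h => ?_
  have : c.rep ~r d.rep := isRotated_of_adj (E := E) (Quotient.exact (congrArg Subtype.val h))
  rw [← c.mk_rep, ← d.mk_rep]
  exact Subtype.ext (Quotient.sound this)

variable [DecidableEq A] [DecidableEq E]

theorem Lop_cr {B : Type*} [DecidableEq B] (c c' d : B) (X : WordOp B) (v : WordSpace B) :
    Lop c c' X (cr [d] v) = δ d c' • cr [c] (X v) := by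
  have : Lop c c' X * cr [d] = δ d c' • (cr [c] * X) := by
    rw [Lop_apply, mul_assoc, an_mul_cr_singleton, mul_smul_comm, mul_one]
  exact congrArg (fun T : WordOp B => T v) this

theorem Rop_crR {B : Type*} [DecidableEq B] (c c' d : B) (X : WordOp B) (v : WordSpace B) :
    Rop c c' X (crR [d] v) = δ d c' • crR [c] (X v) := by
  have : Rop c c' X * crR [d] = δ d c' • (crR [c] * X) := by
    rw [Rop_apply, mul_assoc, anR_mul_crR_singleton, mul_smul_comm, mul_one]
  exact congrArg (fun T : WordOp B => T v) this

theorem lo_wd {B : Type*} [DecidableEq B] (I J W : List B) :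
    lo I J (wd W) = ∑ q ∈ split2 W, δ q.1 J • wd (I ++ q.2) := by
  simp [lo, an_wd]

theorem ro_wd {B : Type*} [DecidableEq B] (I J W : List B) :
    ro I J (wd W) = ∑ q ∈ split2 W, δ q.2 J • wd (q.1 ++ I) := by
  simp [ro, anR_wd]

theorem commute_apply {B : Type*} {X Y : WordOp B} (h : Commute X Y) (v : WordSpace B) :
    Y (X v) = X (Y v) := congrArg (fun T : WordOp B => T v) h.eq.symm

theorem closedEmb_gammaΨ (I J K : List A) :
    closedEmb A E (gammaΨ I J K) = gammaΨ (adj I) (adj J) (adj K) := by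
  simp only [gammaΨ, adj, sum_nsplit2_map, sum_nsplit3_map, δ_map Sum.inl_injective.list_map,
    ← List.map_append, map_add, map_sum, map_smul, closedEmb_Ψ]

theorem closedEmb_ftΨ (I J K : List A) :
    closedEmb A E (ftΨ I J K) = ftΨ (adj I) (adj J) (adj K) := by
  simp only [ftΨ, adj, sum_nsplit2_map, δ_map Sum.inl_injective.list_map, ← List.map_append,
    map_add, map_sum, map_smul, closedEmb_Ψ]

variable [Fintype A] [Fintype E]

theorem grandOpen_opF_openEmb (l₁ l₂ l₃ l₄ l₅ l₆ : E) (I J K : List A) :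
    grandOpen (opF l₁ l₂ I J l₃ l₄) (openEmb (st l₅ K l₆)) =
      openEmb ((δ l₅ l₂ * δ K J * δ l₆ l₄) • st l₁ I l₃) := by
  rw [map_smul, openEmb_st', openEmb_st', grandOpen_opF, Lop_cr, Rop_crR, fo_wd, map_smul, map_smul,
    map_smul, smul_smul, smul_smul, δ_conj, δ_fund, δ_adj, mul_right_comm]
  rfl

theorem grandOpen_opL_openEmb (l₁ l₂ l₃ l₄ : E) (I J K : List A) :
    grandOpen (opL l₁ l₂ I J) (openEmb (st l₃ K l₄)) =
      openEmb (δ l₃ l₂ • ∑ q ∈ split2 K, δ q.1 J • st l₁ (I ++ q.2) l₄) := by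
  rw [map_smul, map_sum, openEmb_st', grandOpen_opL, Lop_cr,
    commute_apply (commute_crR_lo _ (fund_notMem_adj _ _)), lo_wd, sum_split2_adj]
  simp only [map_sum, map_smul, openEmb_st', δ_conj, δ_adj, adj_append]
  rfl

theorem grandOpen_opR_openEmb (l₁ l₂ l₃ l₄ : E) (I J K : List A) :
    grandOpen (opR I J l₁ l₂) (openEmb (st l₃ K l₄)) =
      openEmb (δ l₄ l₂ • ∑ q ∈ split2 K, δ q.2 J • st l₃ (q.1 ++ I) l₁) := by
  rw [map_smul, map_sum, openEmb_st', grandOpen_opR,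
    commute_apply (commute_cr_Rop_ro _ _ (conj_notMem_adj _ _) (conj_ne_fund _ _)), Rop_crR, ro_wd,
    sum_split2_adj]
  simp only [map_sum, map_smul, openEmb_st', δ_fund, δ_adj, adj_append]
  rfl

theorem grandOpen_opγ_openEmb (l₁ l₂ : E) {I J : List A} (hI : I ≠ []) (hJ : J ≠ [])
    (K : List A) :
    grandOpen (opγ I J) (openEmb (st l₁ K l₂)) = openEmb (∑ q ∈ split3 K with q.2.1 ≠ [],
      δ q.2.1 J • st l₁ (q.1 ++ I ++ q.2.2) l₂) := by
  have hJ' := adj_ne_nil (E := E) hJ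
  rw [map_sum, openEmb_st', grandOpen_opγ hI hJ,
    commute_apply (commute_cr_singleton_γo _ hJ' (conj_notMem_adj _ _)),
    commute_apply (commute_crR_singleton_γo _ hJ' (fund_notMem_adj _ _)), γo_wd, sum_split3_adj]
  simp only [map_sum, map_smul, openEmb_st', δ_adj, adj_append]
  rfl

/-- On states with one conjugate letter in front and one fundamental letter behind, every kind
preserves this shape, so the heterix representation restricts. -/
theorem grandOpen_openEmb_mem (x : GrandSpace A E) (v : OpenStates A E) :
    openEnd _ (grandOpen x) (openEmb v) ∈ LinearMap.range (openEmb (A := A) (E := E)) := by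
  induction v using Finsupp.induction_linear with
  | zero => rw [map_zero, map_zero]; exact zero_mem _
  | add v w hv hw => rw [map_add, map_add]; exact add_mem hv hw
  | single t c =>
    rw [← mul_one c, ← smul_eq_mul, ← Finsupp.smul_single, map_smul, map_smul]
    refine Submodule.smul_mem _ _ ?_
    change openEnd _ (grandOpen x) (openEmb (st t.1 t.2.1 t.2.2)) ∈ _
    induction x using Finsupp.induction_linear with
    | zero => rw [map_zero, map_zero]; exact zero_mem _
    | add v w hv hw => rw [map_add, map_add]; exact add_mem hv hw
    | single i c =>
      rw [← mul_one c, ← smul_eq_mul, ← Finsupp.smul_single, map_smul, map_smul]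
      refine Submodule.smul_mem _ _ ?_
      refine grand_index_cases (P := fun x => openEnd _ (grandOpen x)
        (openEmb (st t.1 t.2.1 t.2.2)) ∈ LinearMap.range (openEmb (A := A) (E := E)))
        ?_ ?_ ?_ ?_ ?_ i
      · exact fun _ _ _ _ _ _ => ⟨_, (grandOpen_opF_openEmb _ _ _ _ _ _ _ _ _).symm⟩
      · exact fun _ _ _ _ => ⟨_, (grandOpen_opL_openEmb _ _ _ _ _ _ _).symm⟩
      · exact fun _ _ _ _ => ⟨_, (grandOpen_opR_openEmb _ _ _ _ _ _ _).symm⟩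
      · exact fun _ _ hI hJ => ⟨_, (grandOpen_opγ_openEmb _ _ hI hJ _).symm⟩
      · intro I J hI hJ
        rw [grandOpen_opft hI hJ, map_zero]
        exact zero_mem _

/-- The embedding is injective, so the formulas in the larger alphabet determine the restricted
action. -/
theorem grandOpenAction {σ : GrandSpace A E →ₗ[ℂ] Module.End ℂ (OpenStates A E)}
    (h : ∀ x v, openEnd _ (grandOpen x) (openEmb v) = openEmb (σ x v)) : GrandOpenAction σ where
  first _ _ _ _ _ _ _ _ _ := openEmb_injective ((h _ _).symm.trans (grandOpen_opF_openEmb ..))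
  second _ _ _ _ _ _ _ := openEmb_injective ((h _ _).symm.trans (grandOpen_opL_openEmb ..))
  third _ _ _ _ _ _ _ := openEmb_injective ((h _ _).symm.trans (grandOpen_opR_openEmb ..))
  fourth _ _ _ _ _ hI hJ :=
    openEmb_injective ((h _ _).symm.trans (grandOpen_opγ_openEmb _ _ hI hJ _))
  fifth _ _ _ _ _ hI hJ := openEmb_injective <| (h _ _).symm.trans <| by
    rw [grandOpen_opft hI hJ, map_zero, map_zero]
    rfl

theorem grandClosed_opγ_closedEmb {I J K : List A} (hI : I ≠ []) (hJ : J ≠ []) (hK : K ≠ []) :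
    closedEnd _ (grandClosed (opγ (E := E) I J)) (closedEmb A E (Ψ K)) =
      closedEmb A E (gammaΨ I J K) := by
  have h : grandClosed (opγ (E := E) I J) = γc (adj I) (adj J) :=
    (congrArg heterixClosed (heterixRealisation_iota.fourth I J hI hJ)).trans
      (heterixClosed_gamma' (adj_ne_nil hI) (adj_ne_nil hJ))
  rw [h, closedEmb_Ψ, closedEmb_gammaΨ]
  exact gammaΨ_eq _ (adj_ne_nil hJ) (adj_ne_nil hK)

theorem grandClosed_opft_closedEmb {I J : List A} (hI : I ≠ []) (hJ : J ≠ []) (K : List A) :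
    closedEnd _ (grandClosed (opft (E := E) I J)) (closedEmb A E (Ψ K)) =
      closedEmb A E (ftΨ I J K) := by
  have h : grandClosed (opft (E := E) I J) = ftc (adj I) (adj J) :=
    (congrArg heterixClosed (heterixRealisation_iota.fifth I J hI hJ)).trans
      (heterixClosed_ft' (adj I) (adj J))
  rw [h, closedEmb_Ψ, closedEmb_ftΨ]
  exact ftΨ_eq _ (adj_ne_nil hJ) _

theorem grandClosed_closedEmb_mem (x : GrandSpace A E) (v : ClosedStates A) :
    closedEnd _ (grandClosed x) (closedEmb A E v) ∈ LinearMap.range (closedEmb A E) := by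
  induction v using Finsupp.induction_linear with
  | zero => rw [map_zero, map_zero]; exact zero_mem _
  | add v w hv hw => rw [map_add, map_add]; exact add_mem hv hw
  | single t c =>
    obtain ⟨K, hK, rfl⟩ := t.exists_mk
    rw [← mul_one c, ← smul_eq_mul, ← Finsupp.smul_single, map_smul, map_smul]
    refine Submodule.smul_mem _ _ ?_
    have hΨ : Finsupp.single (CWord.mk K hK) (1 : ℂ) = Ψ K := by rw [Ψ, dif_pos hK]
    rw [hΨ]
    induction x using Finsupp.induction_linear with
    | zero => rw [map_zero, map_zero]; exact zero_mem _
    | add v w hv hw => rw [map_add, map_add]; exact add_mem hv hw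
    | single i c =>
      rw [← mul_one c, ← smul_eq_mul, ← Finsupp.smul_single, map_smul, map_smul]
      refine Submodule.smul_mem _ _ ?_
      refine grand_index_cases (P := fun x => closedEnd _ (grandClosed x)
        (closedEmb A E (Ψ K)) ∈ LinearMap.range (closedEmb A E)) ?_ ?_ ?_ ?_ ?_ i
      · intros; rw [grandClosed_opF, map_zero]; exact zero_mem _
      · intros; rw [grandClosed_opL, map_zero]; exact zero_mem _
      · intros; rw [grandClosed_opR, map_zero]; exact zero_mem _
      · exact fun _ _ hI hJ => ⟨_, (grandClosed_opγ_closedEmb hI hJ hK).symm⟩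
      · exact fun _ _ hI hJ => ⟨_, (grandClosed_opft_closedEmb hI hJ _).symm⟩

theorem grandClosedAction {σ : GrandSpace A E →ₗ[ℂ] Module.End ℂ (ClosedStates A)}
    (h : ∀ x v, closedEnd _ (grandClosed x) (closedEmb A E v) = closedEmb A E (σ x v)) :
    GrandClosedAction σ where
  first _ _ _ _ _ _ _ _ := closedEmb_injective (E := E) <| (h _ _).symm.trans <| by
    rw [grandClosed_opF, map_zero, map_zero]; rfl
  second _ _ _ _ _ _ := closedEmb_injective (E := E) <| (h _ _).symm.trans <| by
    rw [grandClosed_opL, map_zero, map_zero]; rfl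
  third _ _ _ _ _ _ := closedEmb_injective (E := E) <| (h _ _).symm.trans <| by
    rw [grandClosed_opR, map_zero, map_zero]; rfl
  fourth _ _ _ hI hJ hK :=
    closedEmb_injective (E := E) ((h _ _).symm.trans (grandClosed_opγ_closedEmb hI hJ hK))
  fifth _ _ _ hI hJ _ :=
    closedEmb_injective (E := E) ((h _ _).symm.trans (grandClosed_opft_closedEmb hI hJ _))

end Embeddings

/-! ### Relations among operators on open and on closed states -/

section Relations

variable {A E : Type*}

theorem openStates_hom_ext {X Y : Module.End ℂ (OpenStates A E)}
    (h : ∀ r₁ K r₂, X (st r₁ K r₂) = Y (st r₁ K r₂)) : X = Y :=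
  Finsupp.lhom_ext' fun t => LinearMap.ext_ring (h t.1 t.2.1 t.2.2)

theorem closedStates_hom_ext {X Y : Module.End ℂ (ClosedStates A)}
    (h : ∀ K, K ≠ [] → X (Ψ K) = Y (Ψ K)) : X = Y := by
  refine Finsupp.lhom_ext' fun c => LinearMap.ext_ring ?_
  obtain ⟨K, hK, rfl⟩ := c.exists_mk
  have := h K hK
  rwa [Ψ, dif_pos hK] at this

/-- Attaching end labels to a word. -/
def addEnds (r₁ r₂ : E) : WordSpace A →ₗ[ℂ] OpenStates A E := wordLift fun K => st r₁ K r₂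

@[simp] theorem addEnds_wd (r₁ r₂ : E) (K : List A) : addEnds r₁ r₂ (wd K) = st r₁ K r₂ :=
  wordLift_wd _ _

theorem sum_δ_smul [DecidableEq E] [Fintype E] {V : Type*} [AddCommGroup V] [Module ℂ V] (r : E) (F : E → V) :
    ∑ l, δ r l • F l = F r := by simp [δ, ite_smul]

variable [DecidableEq A]

namespace GrandClosedAction

variable {σ : GrandSpace A E →ₗ[ℂ] Module.End ℂ (ClosedStates A)} (h : GrandClosedAction σ)

include h

/-- Identifies the restricted action with the cyclic operators over the original alphabet, so that
the sums in the relations run over original letters only. -/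
theorem opγ_eq {I J : List A} (hI : I ≠ []) (hJ : J ≠ []) :
    σ (opγ I J) = closedEnd A (γc I J) := closedStates_hom_ext fun K hK =>
  (h.fourth I J K hI hJ hK).trans (gammaΨ_eq I hJ hK).symm

theorem opft_eq {I J : List A} (hI : I ≠ []) (hJ : J ≠ []) :
    σ (opft I J) = closedEnd A (ftc I J) := closedStates_hom_ext fun K hK =>
  (h.fifth I J K hI hJ hK).trans (ftΨ_eq I hJ K).symm

variable [Fintype A]

theorem opft_eq_sub_right {I J : List A} (hI : I ≠ []) (hJ : J ≠ []) :
    σ (opft I J) = σ (opγ I J - ∑ k, opγ (I ++ [k]) (J ++ [k])) := by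
  have hne : ∀ (W : List A) (j : A), W ++ [j] ≠ [] := by simp
  rw [map_sub, map_sum, h.opγ_eq hI hJ, h.opft_eq hI hJ, ftc_eq_sub_right, map_sub, map_sum]
  simp only [h.opγ_eq (hne I _) (hne J _)]

theorem opft_eq_sub_left {I J : List A} (hI : I ≠ []) (hJ : J ≠ []) :
    σ (opft I J) = σ (opγ I J - ∑ k, opγ (k :: I) (k :: J)) := by
  rw [map_sub, map_sum, h.opγ_eq hI hJ, h.opft_eq hI hJ, ftc_eq_sub_left, map_sub, map_sum]
  simp only [h.opγ_eq (List.cons_ne_nil _ I) (List.cons_ne_nil _ J)]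

end GrandClosedAction

variable [DecidableEq E]

namespace GrandOpenAction

variable {σ : GrandSpace A E →ₗ[ℂ] Module.End ℂ (OpenStates A E)} (h : GrandOpenAction σ)

include h

theorem opF_st (l₁ l₂ l₃ l₄ r₁ r₂ : E) (I J K : List A) :
    σ (opF l₁ l₂ I J l₃ l₄) (st r₁ K r₂) =
      δ r₁ l₂ • δ r₂ l₄ • addEnds l₁ l₃ (fo I J (wd K)) := by
  rw [h.first, fo_wd, map_smul, addEnds_wd, smul_smul, smul_smul]
  congr 1
  ring

theorem opL_st (l₁ l₂ r₁ r₂ : E) (I J K : List A) :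
    σ (opL l₁ l₂ I J) (st r₁ K r₂) = δ r₁ l₂ • addEnds l₁ r₂ (lo I J (wd K)) := by
  rw [h.second, lo_wd]
  simp

theorem opR_st (l₁ l₂ r₁ r₂ : E) (I J K : List A) :
    σ (opR I J l₁ l₂) (st r₁ K r₂) = δ r₂ l₂ • addEnds r₁ l₁ (ro I J (wd K)) := by
  rw [h.third, ro_wd]
  simp

theorem opγ_st (r₁ r₂ : E) {I J : List A} (hI : I ≠ []) (hJ : J ≠ []) (K : List A) :
    σ (opγ I J) (st r₁ K r₂) = addEnds r₁ r₂ (γo I J (wd K)) := by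
  rw [h.fourth _ _ _ _ _ hI hJ, γo_wd]
  simp

variable [Fintype A] [Fintype E]

/-- Summing over the label removes any condition on the end, leaving replacement of a prefix in the
interior word. Over the original alphabet this is the difference in `sum_γo_cons`. -/
theorem sum_opL (I : List A) {J : List A} (hI : I ≠ []) (hJ : J ≠ []) :
    σ (∑ l, opL l l I J) = σ (opγ I J - ∑ i, opγ (i :: I) (i :: J)) :=
  openStates_hom_ext fun r₁ K r₂ => by
    rw [map_sum, map_sub, map_sum, LinearMap.sum_apply, LinearMap.sub_apply, LinearMap.sum_apply]
    simp only [h.opL_st, sum_δ_smul, h.opγ_st _ _ hI hJ,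
      h.opγ_st _ _ (List.cons_ne_nil _ I) (List.cons_ne_nil _ J)]
    rw [← sum_γo_cons I hJ, LinearMap.sub_apply, LinearMap.sum_apply, map_sub, map_sum]

theorem sum_opR (I : List A) {J : List A} (hI : I ≠ []) (hJ : J ≠ []) :
    σ (∑ l, opR I J l l) = σ (opγ I J - ∑ j, opγ (I ++ [j]) (J ++ [j])) :=
  openStates_hom_ext fun r₁ K r₂ => by
    rw [map_sum, map_sub, map_sum, LinearMap.sum_apply, LinearMap.sub_apply, LinearMap.sum_apply]
    have hne : ∀ (W : List A) (j : A), W ++ [j] ≠ [] := by simp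
    simp only [h.opR_st, sum_δ_smul, h.opγ_st _ _ hI hJ, h.opγ_st _ _ (hne I _) (hne J _)]
    rw [← sum_γo_concat I hJ, LinearMap.sub_apply, LinearMap.sum_apply, map_sub, map_sum]

/-- Both sides leave the right-hand end free: the interior identity is `sum_lo_concat`, with the
left end carried along. -/
theorem sum_opF_right (l₁ l₂ : E) (I J : List A) :
    σ (∑ l, opF l₁ l₂ I J l l) =
      σ (opL l₁ l₂ I J - ∑ j, opL l₁ l₂ (I ++ [j]) (J ++ [j])) :=
  openStates_hom_ext fun r₁ K r₂ => by
    rw [map_sum, map_sub, map_sum, LinearMap.sum_apply, LinearMap.sub_apply, LinearMap.sum_apply]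
    simp only [h.opF_st, h.opL_st, ← Finset.smul_sum, sum_δ_smul]
    rw [← sum_lo_concat I J, LinearMap.sub_apply, LinearMap.sum_apply, map_sub, map_sum, smul_sub]

theorem sum_opF_left (l₃ l₄ : E) (I J : List A) :
    σ (∑ l, opF l l I J l₃ l₄) = σ (opR I J l₃ l₄ - ∑ i, opR (i :: I) (i :: J) l₃ l₄) :=
  openStates_hom_ext fun r₁ K r₂ => by
    rw [map_sum, map_sub, map_sum, LinearMap.sum_apply, LinearMap.sub_apply, LinearMap.sum_apply]
    simp only [h.opF_st, h.opR_st, ← Finset.smul_sum, sum_δ_smul]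
    rw [← sum_ro_cons I J, LinearMap.sub_apply, LinearMap.sum_apply, map_sub, map_sum, smul_sub]

end GrandOpenAction

end Relations

section HeterixRepresentations

variable {A : Type*} [DecidableEq A] (H : LieStructure (HeterixSpace A))
  (h : ∀ x y, heterixRep (H.br x y) = ⁅heterixRep x, heterixRep y⁆)

include h

theorem heterixOpen_br (x y : HeterixSpace A) :
    heterixOpen (H.br x y) = ⁅heterixOpen x, heterixOpen y⁆ :=
  congrArg Prod.fst ((h x y).trans (prod_lie (heterixRep x) (heterixRep y)))

theorem heterixClosed_br (x y : HeterixSpace A) :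
    heterixClosed (H.br x y) = ⁅heterixClosed x, heterixClosed y⁆ :=
  congrArg Prod.snd ((h x y).trans (prod_lie (heterixRep x) (heterixRep y)))

/-- The representation of the heterix algebra on open singlet states. -/
def heterixOpenHom : H.Carrier →ₗ⁅ℂ⁆ Module.End ℂ (HeterixOpenStates A) :=
  (openEnd A).comp (H.lieHom heterixOpen (heterixOpen_br H h))

/-- The representation of the heterix algebra on closed singlet states. -/
def heterixClosedHom : H.Carrier →ₗ⁅ℂ⁆ Module.End ℂ (ClosedStates A) :=
  (closedEnd A).comp (H.lieHom heterixClosed (heterixClosed_br H h))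

end HeterixRepresentations

/-! ### Direct sums of representations and quotients by kernels -/

section Representations

variable {L V W : Type*} [LieRing L] [LieAlgebra ℂ L] [AddCommGroup V] [Module ℂ V]
  [AddCommGroup W] [Module ℂ W]

/-- The direct sum of two representations. -/
def prodRep (ρ : L →ₗ⁅ℂ⁆ Module.End ℂ V) (σ : L →ₗ⁅ℂ⁆ Module.End ℂ W) :
    L →ₗ⁅ℂ⁆ Module.End ℂ (V × W) where
  toFun x := (ρ x).prodMap (σ x)
  map_add' x y := by rw [map_add, map_add, LinearMap.prodMap_add]
  map_smul' c x := by rw [map_smul, map_smul, LinearMap.prodMap_smul, RingHom.id_apply]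
  map_lie' {x y} := by
    refine LinearMap.ext fun v => ?_
    change (ρ ⁅x, y⁆ v.1, σ ⁅x, y⁆ v.2) =
      (ρ x (ρ y v.1) - ρ y (ρ x v.1), σ x (σ y v.2) - σ y (σ x v.2))
    rw [LieHom.map_lie, LieHom.map_lie]
    rfl

theorem prodRep_reducible (ρ : L →ₗ⁅ℂ⁆ Module.End ℂ V) (σ : L →ₗ⁅ℂ⁆ Module.End ℂ W) [Nontrivial V]
    [Nontrivial W] : ∀ U ∈ ({LinearMap.range (LinearMap.inl ℂ V W),
      LinearMap.range (LinearMap.inr ℂ V W)} : Set (Submodule ℂ (V × W))),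
      U ≠ ⊥ ∧ U ≠ ⊤ ∧ ∀ x, ∀ v ∈ U, prodRep ρ σ x v ∈ U := by
  obtain ⟨v, hv⟩ := exists_ne (0 : V)
  obtain ⟨w, hw⟩ := exists_ne (0 : W)
  rintro U (rfl | rfl)
  · refine ⟨fun h => hv ?_, fun h => hw ?_, ?_⟩
    · have : LinearMap.inl ℂ V W v ∈ (⊥ : Submodule ℂ (V × W)) := h ▸ LinearMap.mem_range_self _ v
      exact congrArg Prod.fst ((Submodule.mem_bot ℂ).1 this)
    · have : ((0, w) : V × W) ∈ LinearMap.range (LinearMap.inl ℂ V W) := h ▸ Submodule.mem_top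
      obtain ⟨u, hu⟩ := this
      exact (congrArg Prod.snd hu).symm
    · rintro x _ ⟨u, rfl⟩
      exact ⟨ρ x u, Prod.ext rfl (map_zero (σ x)).symm⟩
  · refine ⟨fun h => hw ?_, fun h => hv ?_, ?_⟩
    · have : LinearMap.inr ℂ V W w ∈ (⊥ : Submodule ℂ (V × W)) := h ▸ LinearMap.mem_range_self _ w
      exact congrArg Prod.snd ((Submodule.mem_bot ℂ).1 this)
    · have : ((v, 0) : V × W) ∈ LinearMap.range (LinearMap.inr ℂ V W) := h ▸ Submodule.mem_top
      obtain ⟨u, hu⟩ := this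
      exact (congrArg Prod.fst hu).symm
    · rintro x _ ⟨u, rfl⟩
      exact ⟨σ x u, Prod.ext (map_zero (ρ x)).symm rfl⟩

theorem exists_quotKerEquivRange (ρ : L →ₗ⁅ℂ⁆ Module.End ℂ V) :
    ∃ e : (L ⧸ ρ.ker) ≃ₗ⁅ℂ⁆ ρ.range,
      ∀ x, (e (LieSubmodule.Quotient.mk x) : Module.End ℂ V) = ρ x :=
  ⟨ρ.quotKerEquivRange, fun _ => rfl⟩

end Representations

/-! ### Kernels of the two string representations -/

section Kernels

variable {A E : Type*} [DecidableEq A] {G : LieStructure (GrandSpace A E)}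

theorem fifthKind_le_ker [DecidableEq E] {ρ : G.Carrier →ₗ⁅ℂ⁆ Module.End ℂ (OpenStates A E)}
    (h : GrandOpenAction ((ρ : G.Carrier →ₗ[ℂ] _) ∘ₗ G.of.toLinearMap)) :
    (fifthKind A E).map G.of.toLinearMap ≤ ρ.ker.toSubmodule := by
  rw [fifthKind, Submodule.map_span_le]
  rintro _ ⟨I, J, hI, hJ, rfl⟩
  exact LieHom.mem_ker.2 (openStates_hom_ext fun r₁ K r₂ => h.fifth r₁ r₂ I J K hI hJ)

theorem three_kinds_le_ker {ρ : G.Carrier →ₗ⁅ℂ⁆ Module.End ℂ (ClosedStates A)}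
    (h : GrandClosedAction ((ρ : G.Carrier →ₗ[ℂ] _) ∘ₗ G.of.toLinearMap)) :
    (firstKind A E ⊔ secondKind A E ⊔ thirdKind A E).map G.of.toLinearMap ≤ ρ.ker.toSubmodule := by
  rw [Submodule.map_sup, Submodule.map_sup, firstKind, secondKind, thirdKind]
  refine sup_le (sup_le ?_ ?_) ?_ <;> rw [Submodule.map_span_le]
  · rintro _ ⟨l₁, l₂, I, J, l₃, l₄, rfl⟩
    exact LieHom.mem_ker.2 (closedStates_hom_ext fun K hK => h.first l₁ l₂ l₃ l₄ I J K hK)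
  · rintro _ ⟨l₁, l₂, I, J, rfl⟩
    exact LieHom.mem_ker.2 (closedStates_hom_ext fun K hK => h.second l₁ l₂ I J K hK)
  · rintro _ ⟨I, J, l₃, l₄, rfl⟩
    exact LieHom.mem_ker.2 (closedStates_hom_ext fun K hK => h.third l₃ l₄ I J K hK)

omit [DecidableEq A] in
theorem ideal_ne_bot {W : Submodule ℂ (GrandSpace A E)} {I : LieIdeal ℂ G.Carrier}
    (hW : W.map G.of.toLinearMap ≤ I.toSubmodule) {x : GrandSpace A E} (hx : x ∈ W) (hx0 : x ≠ 0) :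
    I ≠ ⊥ := by
  rintro rfl
  have h : G.of x ∈ (⊥ : LieIdeal ℂ G.Carrier) := hW (Submodule.mem_map_of_mem hx)
  exact hx0 (G.of.injective (((LieSubmodule.mem_bot _).1 h).trans (map_zero G.of).symm))

end Kernels

end GrandString

end

/-! ### Assembly of the theorem -/

open GrandString in
theorem mainTheorem1 (Λ ΛF : ℕ) (hΛ : 0 < Λ) (hΛF : 0 < ΛF) :
    ∃ (G : LieStructure (GrandSpace (Fin Λ) (Fin ΛF)))
      (H : LieStructure (HeterixSpace (Letter (Fin Λ) (Fin ΛF))))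
      (ι : G.Carrier →ₗ⁅ℂ⁆ H.Carrier)
      (ρo : G.Carrier →ₗ⁅ℂ⁆ Module.End ℂ (OpenStates (Fin Λ) (Fin ΛF)))
      (ρc : G.Carrier →ₗ⁅ℂ⁆ Module.End ℂ (ClosedStates (Fin Λ)))
      (ρ : G.Carrier →ₗ⁅ℂ⁆
        Module.End ℂ (OpenStates (Fin Λ) (Fin ΛF) × ClosedStates (Fin Λ)))
      (ρo' : H.Carrier →ₗ⁅ℂ⁆ Module.End ℂ (HeterixOpenStates (Letter (Fin Λ) (Fin ΛF))))
      (ρc' : H.Carrier →ₗ⁅ℂ⁆ Module.End ℂ (ClosedStates (Letter (Fin Λ) (Fin ΛF))))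
      (jo : OpenStates (Fin Λ) (Fin ΛF) →ₗ[ℂ] HeterixOpenStates (Letter (Fin Λ) (Fin ΛF)))
      (jc : ClosedStates (Fin Λ) →ₗ[ℂ] ClosedStates (Letter (Fin Λ) (Fin ΛF))),
      -- the brackets of the grand string algebra define the Lie algebra `G`, unambiguously
      (GrandBrackets G.br ∧
        ∀ B : GrandSpace (Fin Λ) (Fin ΛF) →ₗ[ℂ] GrandSpace (Fin Λ) (Fin ΛF) →ₗ[ℂ]
            GrandSpace (Fin Λ) (Fin ΛF),
          (∀ x, B x x = 0) → GrandBrackets B → B = G.br) ∧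
      -- distinguished ideals and subalgebras
      (∀ W ∈ ({firstKind _ _, firstKind _ _ ⊔ secondKind _ _ ⊔ thirdKind _ _, fifthKind _ _} :
          Set (Submodule ℂ (GrandSpace (Fin Λ) (Fin ΛF)))),
        ∃ I : LieIdeal ℂ G.Carrier, I.toSubmodule = W.map G.of.toLinearMap ∧ I ≠ ⊤) ∧
      (∀ W ∈ ({secondKind _ _, thirdKind _ _} :
          Set (Submodule ℂ (GrandSpace (Fin Λ) (Fin ΛF)))),
        ∃ M : LieSubalgebra ℂ G.Carrier, M.toSubmodule = W.map G.of.toLinearMap) ∧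
      -- `H` is the heterix algebra, acting faithfully on its open and closed singlet states
      (ClosedBrackets gamma' ft' H.br ∧
        (∀ B : HeterixSpace (Letter (Fin Λ) (Fin ΛF)) →ₗ[ℂ]
            HeterixSpace (Letter (Fin Λ) (Fin ΛF)) →ₗ[ℂ] HeterixSpace (Letter (Fin Λ) (Fin ΛF)),
          (∀ x, B x x = 0) → ClosedBrackets gamma' ft' B → B = H.br) ∧
        HeterixOpenAction ((ρo' : H.Carrier →ₗ[ℂ] _) ∘ₗ H.of.toLinearMap) ∧
        HeterixClosedAction ((ρc' : H.Carrier →ₗ[ℂ] _) ∘ₗ H.of.toLinearMap) ∧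
        ∀ x, ρo' x = 0 → ρc' x = 0 → x = 0) ∧
      -- `G` is a subalgebra of `H` through the relabelling of the end degrees of freedom
      (Function.Injective ι ∧
        HeterixRealisation
          (H.of.symm.toLinearMap ∘ₗ (ι : G.Carrier →ₗ[ℂ] H.Carrier) ∘ₗ G.of.toLinearMap)) ∧
      -- the open and closed singlet states form a representation of `G`
      (GrandOpenAction ((ρo : G.Carrier →ₗ[ℂ] _) ∘ₗ G.of.toLinearMap) ∧
        GrandClosedAction ((ρc : G.Carrier →ₗ[ℂ] _) ∘ₗ G.of.toLinearMap) ∧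
        ∀ x s Ψs, ρ x (s, Ψs) = (ρo x s, ρc x Ψs)) ∧
      -- this representation is reducible
      (∀ W ∈ ({LinearMap.range (LinearMap.inl ℂ _ _), LinearMap.range (LinearMap.inr ℂ _ _)} :
          Set (Submodule ℂ (OpenStates (Fin Λ) (Fin ΛF) × ClosedStates (Fin Λ)))),
        W ≠ ⊥ ∧ W ≠ ⊤ ∧ ∀ x, ∀ v ∈ W, ρ x v ∈ W) ∧
      -- it is the restriction of the action of `H` to the corresponding subspaces of states
      (Function.Injective jo ∧ Function.Injective jc ∧
        (∀ r₁ K r₂, jo (st r₁ K r₂) = s' (conj r₁ :: adj K ++ [fund r₂])) ∧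
        (∀ K, K ≠ [] → jc (Ψ K) = Ψ (adj K)) ∧
        (∀ x s, ρo' (ι x) (jo s) = jo (ρo x s)) ∧
        ∀ x Ψs, ρc' (ι x) (jc Ψs) = jc (ρc x Ψs)) ∧
      -- the open string algebra `ρo.range` is a proper quotient of `G`
      ((∃ e : (G.Carrier ⧸ ρo.ker) ≃ₗ⁅ℂ⁆ ρo.range,
          ∀ x, (e (LieSubmodule.Quotient.mk x) : Module.End ℂ _) = ρo x) ∧
        (fifthKind _ _).map G.of.toLinearMap ≤ ρo.ker.toSubmodule ∧ ρo.ker ≠ ⊥ ∧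
        (∀ I J, I ≠ [] → J ≠ [] → ρo (G.of (∑ l, opL l l I J)) =
          ρo (G.of (opγ I J - ∑ i, opγ (i :: I) (i :: J)))) ∧
        (∀ I J, I ≠ [] → J ≠ [] → ρo (G.of (∑ l, opR I J l l)) =
          ρo (G.of (opγ I J - ∑ j, opγ (I ++ [j]) (J ++ [j])))) ∧
        (∀ l₁ l₂ I J, ρo (G.of (∑ l, opF l₁ l₂ I J l l)) =
          ρo (G.of (opL l₁ l₂ I J - ∑ j, opL l₁ l₂ (I ++ [j]) (J ++ [j])))) ∧
        ∀ l₃ l₄ I J, ρo (G.of (∑ l, opF l l I J l₃ l₄)) =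
          ρo (G.of (opR I J l₃ l₄ - ∑ i, opR (i :: I) (i :: J) l₃ l₄))) ∧
      -- the closed string (cyclix) algebra `ρc.range` is a proper quotient of `G`
      ((∃ e : (G.Carrier ⧸ ρc.ker) ≃ₗ⁅ℂ⁆ ρc.range,
          ∀ x, (e (LieSubmodule.Quotient.mk x) : Module.End ℂ _) = ρc x) ∧
        (firstKind _ _ ⊔ secondKind _ _ ⊔ thirdKind _ _).map G.of.toLinearMap ≤
          ρc.ker.toSubmodule ∧ ρc.ker ≠ ⊥ ∧
        (∀ I J, I ≠ [] → J ≠ [] → ρc (G.of (opft I J)) =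
          ρc (G.of (opγ I J - ∑ k, opγ (I ++ [k]) (J ++ [k])))) ∧
        ∀ I J, I ≠ [] → J ≠ [] → ρc (G.of (opft I J)) =
          ρc (G.of (opγ I J - ∑ k, opγ (k :: I) (k :: J)))) := by
  obtain ⟨G, hG, hGB⟩ := exists_grand (Fin Λ) (Fin ΛF)
  obtain ⟨H, hH, hHB⟩ := exists_heterix (Letter (Fin Λ) (Fin ΛF))
  have a : Fin Λ := ⟨0, hΛ⟩
  have b : Fin ΛF := ⟨0, hΛF⟩
  have hA : Nonempty (Fin Λ) := ⟨a⟩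
  -- Both brackets are computed by commutators of the same operators, so injectivity of `heterixRep`
  -- makes `iota` a homomorphism.
  let ι : G.Carrier →ₗ⁅ℂ⁆ H.Carrier := G.lieHom (H.of.toLinearMap ∘ₗ iota) fun x y =>
    congrArg H.of (heterixRep_injective ((hG x y).trans (hH (iota x) (iota y)).symm))
  let ρo' := heterixOpenHom H hH
  let ρc' := heterixClosedHom H hH
  -- The representations on string states are restrictions of the heterix actions; the intertwining
  -- property comes with the construction.
  obtain ⟨ρo, hρo⟩ := exists_restrict (ρo'.comp ι) openEmb openEmb_injective
    grandOpen_openEmb_mem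
  obtain ⟨ρc, hρc⟩ := exists_restrict (ρc'.comp ι) (closedEmb (Fin Λ) (Fin ΛF)) closedEmb_injective
    grandClosed_closedEmb_mem
  have ho : GrandOpenAction ((ρo : G.Carrier →ₗ[ℂ] _) ∘ₗ G.of.toLinearMap) := grandOpenAction hρo
  have hc : GrandClosedAction ((ρc : G.Carrier →ₗ[ℂ] _) ∘ₗ G.of.toLinearMap) :=
    grandClosedAction hρc
  -- Reducibility needs both summands to be non-zero; the label `b` and the letter `a` provide
  -- states.
  have : Nontrivial (OpenStates (Fin Λ) (Fin ΛF)) :=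
    have : Nonempty (Fin ΛF × List (Fin Λ) × Fin ΛF) := ⟨(b, [], b)⟩
    inferInstance
  have : Nontrivial (ClosedStates (Fin Λ)) :=
    have : Nonempty (CWord (Fin Λ)) := ⟨CWord.mk [a] (List.cons_ne_nil _ _)⟩
    inferInstance
  refine ⟨G, H, ι, ρo, ρc, prodRep ρo ρc, ρo', ρc', openEmb, closedEmb _ _, ⟨hGB, fun B hB hB' =>
    grandBrackets_unique hB G.br_self hB' hGB⟩, ?_, ?_, ⟨hHB, fun B hB hB' =>
    closedBrackets_unique hB H.br_self hB' hHB, heterixOpenAction, heterixClosedAction, fun x hx hx' =>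
    heterix_faithful hx hx'⟩, ⟨iota_injective, heterixRealisation_iota⟩, ⟨ho, hc, fun _ _ _ => rfl⟩,
    prodRep_reducible ρo ρc, ⟨openEmb_injective, closedEmb_injective, fun _ _ _ => openEmb_st _ _ _,
    fun K _ => closedEmb_Ψ K, hρo, hρc⟩, ⟨exists_quotKerEquivRange ρo, fifthKind_le_ker ho,
    -- A fifth-kind basis vector witnesses a non-zero open kernel; for the closed kernel a
    -- second-kind one is used below.
    ideal_ne_bot (fifthKind_le_ker ho) (x := opft [a] [a]) (Submodule.subset_span
      ⟨_, _, List.cons_ne_nil _ _, List.cons_ne_nil _ _, rfl⟩) ?_, fun I J hI hJ =>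
    ho.sum_opL I hI hJ, fun I J hI hJ => ho.sum_opR I hI hJ, ho.sum_opF_right, ho.sum_opF_left⟩,
    ⟨exists_quotKerEquivRange ρc, three_kinds_le_ker hc, ideal_ne_bot (three_kinds_le_ker hc)
      (x := opL b b [] []) (Submodule.mem_sup_left (Submodule.mem_sup_right (Submodule.subset_span
      ⟨_, _, _, _, rfl⟩))) ?_, fun I J hI hJ => hc.opft_eq_sub_right hI hJ,
    fun I J hI hJ => hc.opft_eq_sub_left hI hJ⟩⟩
  · rintro W (rfl | rfl | rfl)
    · exact exists_firstKind_ideal hGB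
    · exact exists_three_kinds_ideal hGB
    · exact exists_fifthKind_ideal hGB
  · rintro W (rfl | rfl)
    · exact exists_secondKind_subalgebra hGB
    · exact exists_thirdKind_subalgebra hGB
  · rw [opft_of_ne (List.cons_ne_nil _ _) (List.cons_ne_nil _ _)]
    exact Finsupp.single_ne_zero.2 one_ne_zero
  · exact Finsupp.single_ne_zero.2 one_ne_zero
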